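/- Let $\mathbb T^n=(\mathbb R/\mathbb Z)^n$, let $k\ge 0$ be an integer, and let $\rho_0\in C^k(\mathbb T^n)$ be real-valued with $\rho_0>0$ everywhere. Let $$\mathbb D=L^2(\mathbb T^n)\times\{h\in L^2(\mathbb T^n;\mathbb R^n): h=\sqrt{\rho_0}\,\nabla w\ \text{for some}\ w\in L^2(\mathbb T^n)\ \text{with weak gradient}\ \nabla w\in L^2\},$$ and let $\mathcal L(\tau)=e^{\tau L}$, $\tau\in\mathbb R$, be the strongly continuous group on $\mathbb D$ generated by $$L\begin{pmatrix}\phi\\ \sqrt{\rho_0}\nabla w\end{pmatrix}=-\begin{pmatrix}\operatorname{div}(\rho_0\nabla w)\\ \sqrt{\rho_0}\,\nabla\phi\end{pmatrix}$$ with its maximal domain in $\mathbb D$. Write $\mathcal L_2(\tau)V$ for the last $n$ components of $\mathcal L(\tau)V$. For a vector-valued distribution $f$, let $\mathbb H^\perp_{\rho_0}f=\rho_0\nabla\Psi$, where $\Psi\in H^1(\mathbb T^n)$, $\int_{\mathbb T^n}\Psi\,dx=0$, solves $\int_{\mathbb T^n}\rho_0\nabla\Psi\cdot\nabla\eta\,dx=\langle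 f,\nabla\eta\rangle$ for all $\eta\in C^\infty(\mathbb T^n)$, whenever such a $\Psi$ exists. For a vector field $u$ and $V\in\mathbb D$ put, in the sense of distributions, $$B_1(u,V)(s)=\operatorname{div}\big(\sqrt{\rho_0}\,u\otimes\mathcal L_2(s)V+\sqrt{\rho_0}\,\mathcal L_2(s)V\otimes u\big),$$ $$\mathcal Q_1(u,V)=\lim_{\tau\to\infty}\frac1\tau\int_0^\tau\mathcal L(-s)\begin{pmatrix}0\\ \frac1{\sqrt{\rho_0}}\mathbb H^\perp_{\rho_0}B_1(u,V)(s)\end{pmatrix}ds ,$$ the limit being taken in $L^2(\mathbb T^n)\times L^2(\mathbb T^n;\mathbb R^n)$. Let $u\in L^2(\mathbb T^n;\mathbb R^n)$ satisfy $\operatorname{div}(\rho_0u)=0$ in the sense of distributions, and assume that either $k>\frac n2+1$, or $k\ge1$ and $u\in L^\infty(\mathbb T^n;\mathbb R^n)$. Then for every $V\in\mathbb D$ with components in $H^k(\mathbb T^n)$, the field $\mathbb H^\perp_{\rho_0}B_1(u,V)(s)\in L^2(\mathbb T^n;\mathbb R^n)$ exists for every $s\in\mathbb R$, the limit defining $\mathcal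 Q_1(u,V)$ exists, and $$\int_{\mathbb T^n}\mathcal Q_1(u,V)\cdot V\,dx=0 .$$ Moreover, for all $V_1,V_2\in\mathbb D$ with components in $H^k(\mathbb T^n)$, $$\int_{\mathbb T^n}\big[\mathcal Q_1(u,V_1)\cdot V_2+\mathcal Q_1(u,V_2)\cdot V_1\big]\,dx=0 .$$ -/

import Mathlib

open MeasureTheory Filter Topology
open scoped ContDiff

noncomputable section

/-- The flat torus `𝕋ⁿ = (ℝ/ℤ)ⁿ`, with its normalized Lebesgue measure `volume`. -/
abbrev Torus (n : ℕ) : Type := Fin n → UnitAddCircle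

/-- The Euclidean space `ℝⁿ` in which vector fields take their values. -/
abbrev Vec (n : ℕ) : Type := EuclideanSpace ℝ (Fin n)

/-- `f` is of class `C^k` on the torus: its periodic lift to `ℝⁿ` is of class `C^k`. -/
def TorusContDiff {n : ℕ} (k : WithTop ℕ∞) (f : Torus n → ℝ) : Prop :=
  ContDiff ℝ k (fun y : Fin n → ℝ => f (fun i => (y i : UnitAddCircle)))

/-- The classical partial derivative `∂ᵢ f`. -/
def partialD {n : ℕ} (i : Fin n) (f : Torus n → ℝ) (x : Torus n) : ℝ :=
  deriv (fun t : ℝ => f (x + Pi.single i (t : UnitAddCircle))) 0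

/-- The classical gradient `∇f`. -/
def torusGrad {n : ℕ} (f : Torus n → ℝ) (x : Torus n) : Vec n :=
  WithLp.toLp 2 (fun i => partialD i f x)

/-- `g = ∂ᵢ f` in the sense of distributions. -/
def HasWeakPartial {n : ℕ} (i : Fin n) (f g : Torus n → ℝ) : Prop :=
  ∀ η : Torus n → ℝ, TorusContDiff ∞ η →
    ∫ x, f x * partialD i η x = -∫ x, g x * η x

/-- `g = ∇f` in the sense of distributions. -/
def HasWeakGrad {n : ℕ} (f : Torus n → ℝ) (g : Torus n → Vec n) : Prop :=
  ∀ i, HasWeakPartial i f (fun x => g x i)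

/-- `f` belongs to the Sobolev space `H^k(𝕋ⁿ)`. -/
def MemSobolev {n : ℕ} : ℕ → (Torus n → ℝ) → Prop
  | 0, f => MemLp f 2
  | k + 1, f => MemLp f 2 ∧ ∀ i, ∃ g, HasWeakPartial i f g ∧ MemSobolev k g

/-- `L²(𝕋ⁿ)`. -/
abbrev L2Scalar (n : ℕ) : Type := Lp ℝ 2 (volume : Measure (Torus n))

/-- `L²(𝕋ⁿ; ℝⁿ)`. -/
abbrev L2Field (n : ℕ) : Type := Lp (Vec n) 2 (volume : Measure (Torus n))

/-- `L²(𝕋ⁿ) × L²(𝕋ⁿ; ℝⁿ)` with its Hilbert space structure. -/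
abbrev L2State (n : ℕ) : Type := WithLp 2 (L2Scalar n × L2Field n)

theorem partialD_coe {n : ℕ} (i : Fin n) (f : Torus n → ℝ) (hf : TorusContDiff ∞ f)
    (y : Fin n → ℝ) :
    partialD i f (fun j => (y j : UnitAddCircle)) =
      fderiv ℝ (fun y : Fin n → ℝ => f (fun j => (y j : UnitAddCircle))) y (Pi.single i 1) := by
  have hd : DifferentiableAt ℝ (fun y : Fin n → ℝ => f (fun j => (y j : UnitAddCircle))) y :=
    (ContDiff.differentiable hf (by simp)) y
  have h := hd.hasFDerivAt.hasLineDerivAt (Pi.single i (1 : ℝ))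
  rw [← h.lineDeriv]
  unfold partialD lineDeriv
  congr 1
  funext t
  congr 1
  funext j
  by_cases hj : j = i
  · subst hj; simp
  · simp [hj]

theorem continuous_partialD {n : ℕ} (i : Fin n) (f : Torus n → ℝ) (hf : TorusContDiff ∞ f) :
    Continuous (partialD i f) := by
  have hq : IsOpenQuotientMap
      (Pi.map (fun (_ : Fin n) (t : ℝ) => (t : UnitAddCircle))) :=
    IsOpenQuotientMap.piMap (fun _ => QuotientAddGroup.isOpenQuotientMap_mk)
  rw [hq.isQuotientMap.continuous_iff]
  have h1 : Continuous
      (fderiv ℝ (fun y : Fin n → ℝ => f (fun j => (y j : UnitAddCircle)))) :=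
    ContDiff.continuous_fderiv hf (by simp)
  have h2 := h1.clm_apply (continuous_const (y := (Pi.single i 1 : Fin n → ℝ)))
  refine h2.congr (fun y => ?_)
  exact (partialD_coe i f hf y).symm

theorem TorusContDiff.continuous_fun {n : ℕ} {k : WithTop ℕ∞} {f : Torus n → ℝ}
    (hf : TorusContDiff k f) : Continuous f := by
  have hq : IsOpenQuotientMap
      (Pi.map (fun (_ : Fin n) (t : ℝ) => (t : UnitAddCircle))) :=
    IsOpenQuotientMap.piMap (fun _ => QuotientAddGroup.isOpenQuotientMap_mk)
  rw [hq.isQuotientMap.continuous_iff]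
  exact ContDiff.continuous hf

theorem integrable_mul_continuous {n : ℕ} {f η : Torus n → ℝ} (hf : MemLp f 2)
    (hη : Continuous η) : Integrable (fun x => f x * η x) := by
  have h1 : MemLp η 2 := hη.memLp_of_hasCompactSupport (HasCompactSupport.of_compactSpace η)
  exact hf.integrable_mul h1

theorem memLp_coord {n : ℕ} (g : L2Field n) (i : Fin n) :
    MemLp (fun x => g x i) 2 :=
  (EuclideanSpace.proj i : Vec n →L[ℝ] ℝ).comp_memLp' (Lp.memLp g)

theorem HasWeakGrad.add {n : ℕ} {f₁ f₂ : L2Scalar n} {g₁ g₂ : L2Field n}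
    (h₁ : HasWeakGrad f₁ g₁) (h₂ : HasWeakGrad f₂ g₂) :
    HasWeakGrad ((f₁ + f₂ : L2Scalar n) : Torus n → ℝ) ((g₁ + g₂ : L2Field n)) := by
  intro i η hη
  have hc := continuous_partialD i η hη
  have hc' := hη.continuous_fun
  have e1 : ∫ x, (f₁ + f₂ : L2Scalar n) x * partialD i η x
      = ∫ x, (f₁ x * partialD i η x + f₂ x * partialD i η x) := by
    refine integral_congr_ae ?_
    filter_upwards [Lp.coeFn_add f₁ f₂] with x hx
    rw [hx, Pi.add_apply, add_mul]
  have e2 : ∫ x, (g₁ + g₂ : L2Field n) x i * η x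
      = ∫ x, (g₁ x i * η x + g₂ x i * η x) := by
    refine integral_congr_ae ?_
    filter_upwards [Lp.coeFn_add g₁ g₂] with x hx
    rw [hx, Pi.add_apply, PiLp.add_apply, add_mul]
  have a := h₁ i η hη
  have b := h₂ i η hη
  rw [e1, e2,
    integral_add (integrable_mul_continuous (Lp.memLp f₁) hc)
      (integrable_mul_continuous (Lp.memLp f₂) hc),
    integral_add (integrable_mul_continuous (memLp_coord g₁ i) hc')
      (integrable_mul_continuous (memLp_coord g₂ i) hc'), a, b]
  ring

theorem HasWeakGrad.smul {n : ℕ} {f : L2Scalar n} {g : L2Field n} (c : ℝ)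
    (h : HasWeakGrad f g) :
    HasWeakGrad ((c • f : L2Scalar n) : Torus n → ℝ) ((c • g : L2Field n)) := by
  intro i η hη
  have e1 : ∫ x, (c • f : L2Scalar n) x * partialD i η x
      = ∫ x, c * (f x * partialD i η x) := by
    refine integral_congr_ae ?_
    filter_upwards [Lp.coeFn_smul c f] with x hx
    rw [hx, Pi.smul_apply, smul_eq_mul, mul_assoc]
  have e2 : ∫ x, (c • g : L2Field n) x i * η x = ∫ x, c * (g x i * η x) := by
    refine integral_congr_ae ?_
    filter_upwards [Lp.coeFn_smul c g] with x hx
    rw [hx, Pi.smul_apply, PiLp.smul_apply, smul_eq_mul, mul_assoc]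
  have a := h i η hη
  rw [e1, e2, integral_const_mul, integral_const_mul, a]
  ring

theorem HasWeakGrad.zero {n : ℕ} :
    HasWeakGrad ((0 : L2Scalar n) : Torus n → ℝ) ((0 : L2Field n)) := by
  have hw := HasWeakGrad.smul (n := n) (f := 0) (g := 0) 0
  intro i η hη
  have e1 : ∫ x, (0 : L2Scalar n) x * partialD i η x = ∫ _x : Torus n, (0 : ℝ) := by
    refine integral_congr_ae ?_
    filter_upwards [Lp.coeFn_zero ℝ 2 (volume : Measure (Torus n))] with x hx
    rw [hx, Pi.zero_apply, zero_mul]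
  have e2 : ∫ x, (0 : L2Field n) x i * η x = ∫ _x : Torus n, (0 : ℝ) := by
    refine integral_congr_ae ?_
    filter_upwards [Lp.coeFn_zero (Vec n) 2 (volume : Measure (Torus n))] with x hx
    rw [hx, Pi.zero_apply, PiLp.zero_apply, zero_mul]
  rw [e1, e2]
  simp

/-- The space `𝔻 = L²(𝕋ⁿ) × {h ∈ L²(𝕋ⁿ; ℝⁿ) : h = √ρ₀ ∇w}`. -/
def acousticSpace {n : ℕ} (ρ₀ : Torus n → ℝ) : Submodule ℝ (L2State n) where
  carrier := {V | ∃ (w : L2Scalar n) (g : L2Field n), HasWeakGrad w g ∧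
    ∀ᵐ x, V.snd x = √(ρ₀ x) • g x}
  add_mem' := by
    rintro V W ⟨w₁, g₁, h₁, e₁⟩ ⟨w₂, g₂, h₂, e₂⟩
    refine ⟨w₁ + w₂, g₁ + g₂, h₁.add h₂, ?_⟩
    filter_upwards [e₁, e₂, Lp.coeFn_add V.snd W.snd, Lp.coeFn_add g₁ g₂] with x a b c d
    rw [WithLp.add_snd, c, d, Pi.add_apply, Pi.add_apply, a, b, smul_add]
  zero_mem' := by
    refine ⟨0, 0, HasWeakGrad.zero, ?_⟩
    filter_upwards [Lp.coeFn_zero (Vec n) 2 (volume : Measure (Torus n))] with x a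
    rw [WithLp.zero_snd, a, Pi.zero_apply, smul_zero]
  smul_mem' := by
    rintro c V ⟨w, g, h, e⟩
    refine ⟨c • w, c • g, h.smul c, ?_⟩
    filter_upwards [e, Lp.coeFn_smul c V.snd, Lp.coeFn_smul c g] with x a b d
    rw [WithLp.smul_snd, b, d, Pi.smul_apply, Pi.smul_apply, a, smul_comm]

/-- The graph of the wave operator `L (φ, h) = -(div (√ρ₀ h), √ρ₀ ∇φ)`, an unbounded operator
on `𝔻` with its maximal domain (`h = √ρ₀ ∇w`, so that `div (√ρ₀ h) = div (ρ₀ ∇w)`):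
`IsWaveOp ρ₀ V V'` says that `V` is in the domain of `L` and `V' = L V`. -/
def IsWaveOp {n : ℕ} (ρ₀ : Torus n → ℝ) (V V' : acousticSpace ρ₀) : Prop :=
  (∀ η : Torus n → ℝ, TorusContDiff ∞ η →
    ∫ x, V'.1.fst x * η x = ∫ x, √(ρ₀ x) * inner ℝ (V.1.snd x) (torusGrad η x)) ∧
  ∃ g : L2Field n, HasWeakGrad V.1.fst g ∧ ∀ᵐ x, V'.1.snd x = -(√(ρ₀ x) • g x)

/-- `U` is the strongly continuous group of bounded operators on `𝔻` generated by `L`: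
the derivative of `U t V` at `t = 0` exists exactly for `V` in the domain of `L`,
and is then `L V`. -/
structure IsWaveGroup {n : ℕ} (ρ₀ : Torus n → ℝ)
    (U : ℝ → acousticSpace ρ₀ →L[ℝ] acousticSpace ρ₀) : Prop where
  zero : U 0 = ContinuousLinearMap.id ℝ (acousticSpace ρ₀)
  add : ∀ s t, U (s + t) = (U s).comp (U t)
  continuous : ∀ V, Continuous (fun t => U t V)
  generator : ∀ V V', IsWaveOp ρ₀ V V' ↔ HasDerivAt (fun t => U t V) V' 0

open Classical in
/-- The wave group `𝓛(τ) = exp (τ L)` on `𝔻`. (A group is determined by its generator.) -/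
def waveGroup {n : ℕ} (ρ₀ : Torus n → ℝ) : ℝ → acousticSpace ρ₀ →L[ℝ] acousticSpace ρ₀ :=
  if h : ∃ U, IsWaveGroup ρ₀ U then h.choose else 0

/-- The distribution `B₁ = div (√ρ₀ u ⊗ h + √ρ₀ h ⊗ u)`, as a functional of smooth vector
fields `Φ`. It enters below with `h = 𝓛₂(s) V`. -/
def B1 {n : ℕ} (ρ₀ : Torus n → ℝ) (u h Φ : Torus n → Vec n) : ℝ :=
  -∫ x, ∑ i, ∑ j, (√(ρ₀ x) * u x i * h x j + √(ρ₀ x) * h x i * u x j) *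
    partialD j (fun y => Φ y i) x

/-- `P = ℍ^⊥_{ρ₀} f` for a vector-valued distribution `f`: `P = ρ₀ ∇Ψ` where `Ψ ∈ H¹` has mean
zero and `∫ ρ₀ ∇Ψ · ∇η dx = ⟨f, ∇η⟩` for all `η`, that is `div (ρ₀ ∇Ψ) = div f`. -/
def IsHelmholtzPerp {n : ℕ} (ρ₀ : Torus n → ℝ) (f : (Torus n → Vec n) → ℝ)
    (P : L2Field n) : Prop :=
  ∃ (Ψ : L2Scalar n) (g : L2Field n), HasWeakGrad Ψ g ∧ ∫ x, Ψ x = 0 ∧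
    (∀ᵐ x, P x = ρ₀ x • g x) ∧
    ∀ η : Torus n → ℝ, TorusContDiff ∞ η →
      ∫ x, inner ℝ (P x) (torusGrad η x) = f (torusGrad η)

/-- `F = (0, ρ₀^{-1/2} ℍ^⊥_{ρ₀} div (√ρ₀ u ⊗ h + √ρ₀ h ⊗ u))` where `h` is the second
component of `V`. -/
def IsSource {n : ℕ} (ρ₀ : Torus n → ℝ) (u : Torus n → Vec n) (V F : acousticSpace ρ₀) :
    Prop :=
  F.1.fst = 0 ∧ ∃ P : L2Field n, IsHelmholtzPerp ρ₀ (B1 ρ₀ u V.1.snd) P ∧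
    ∀ᵐ x, F.1.snd x = (√(ρ₀ x))⁻¹ • P x

open Classical in
/-- The element `F` of `𝔻` described by `IsSource` (it is unique when it exists). -/
def source {n : ℕ} (ρ₀ : Torus n → ℝ) (u : Torus n → Vec n) (V : acousticSpace ρ₀) :
    acousticSpace ρ₀ :=
  if h : ∃ F, IsSource ρ₀ u V F then h.choose else 0

/-- The time average
`(1/τ) ∫₀^τ 𝓛(-s) (0, ρ₀^{-1/2} ℍ^⊥_{ρ₀} B₁(u, V)) ds`, with `B₁` taken at time `s`. -/
def Q1Average {n : ℕ} (ρ₀ : Torus n → ℝ) (u : Torus n → Vec n) (V : acousticSpace ρ₀)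
    (τ : ℝ) : L2State n :=
  τ⁻¹ • ∫ s in (0 : ℝ)..τ,
    ((waveGroup ρ₀ (-s) (source ρ₀ u (waveGroup ρ₀ s V)) : acousticSpace ρ₀) : L2State n)

/-- The averaged linear term `𝓠₁(u, V)`, the limit of the time averages in `L²(𝕋ⁿ)`. -/
def Q1 {n : ℕ} (ρ₀ : Torus n → ℝ) (u : Torus n → Vec n) (V : acousticSpace ρ₀) : L2State n :=
  limUnder atTop (Q1Average ρ₀ u V)

/-- `V = (φ, h)` has components in `H^k(𝕋ⁿ)`. -/
def StateMemSobolev {n : ℕ} (k : ℕ) (V : L2State n) : Prop :=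
  MemSobolev k V.fst ∧ ∀ i, MemSobolev k (fun x => V.snd x i)

/-- The pointwise product `(V · W)(x)` of two elements of `L²(𝕋ⁿ) × L²(𝕋ⁿ; ℝⁿ)`. -/
def stateDot {n : ℕ} (V W : L2State n) (x : Torus n) : ℝ :=
  V.fst x * W.fst x + inner ℝ (V.snd x) (W.snd x)

end

/-! ### Classical calculus on the torus. -/

noncomputable section

open UnitAddTorus ComplexConjugate

/-! The proof diagonalizes the wave operator, makes the averaged integrand almost periodic, and
reduces both identities to the antisymmetry of `ρ₀ u · ∇` when `div (ρ₀ u) = 0`.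

Spectral picture. Put `T φ = √ρ₀ ∇ φ`. Its graph is a closed space whose projection `p` to the first
factor is compact by Rellich (`isCompactOperator_gradSpaceFst`), and `p p* = (1 + T* T)⁻¹` is
compact and symmetric. Its eigenvectors `ψ`, together with the normalized fields `T ψ / w`, give
complex coordinates on `𝔻` in which `L` is multiplication by `-i w` (`nonempty_waveBasis`,
`WaveBasis.isWaveOp_iff_gen`). The abstractly chosen `waveGroup` is then an explicit group of
isometries, because a group is determined by its generator (`WaveBasis.waveGroup_eq`). Elliptic
regularity identifies the states of class `H^k` with the range of the `k`-th power of the resolvent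
`R = (1 - L)⁻¹` (`WaveBasis.mem_range_resolvent_pow_iff`). As `R` commutes with the group, `H^k` is
invariant.

Existence of the limit. For a state in `H^k` with `h = √ρ₀ ∇ w`, the product `ρ₀ u · ∇ (∇ w)` is
square integrable: either `u` is bounded and `∇ w` is in `H¹`, or `k > n / 2 + 1` and the second
derivatives of `w` have absolutely convergent Fourier series. So the source exists, and by the
closed graph theorem `A = source ∘ R^k` is bounded (`exists_source_operator`). For `V = R^k Y` the
integrand becomes `𝓛(-s) A 𝓛(s) Y`, a uniform limit of trigonometric polynomials
(`SpectralCoords.almostPeriodic_conj`), and such functions have mean values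
(`AlmostPeriodic.exists_mean`).

Cancellation. Tested on gradients, `B₁` equals `2 ρ₀ u · ∇ (∇ w)`. The pairing of the source of `V`
with `V'` is therefore `2 ∫ (ρ₀ u · ∇ (∇ w)) · ∇ w'`, antisymmetric in `w` and `w'`
(`IsAdvection.integral_add`, `inner_source_add`). Since the adjoint of `𝓛(-s)` is `𝓛(s)`, the
symmetrized integrand vanishes for each `s`, hence so do its averages and their limit. -/

/-- The periodic lift of a function on the torus to `ℝⁿ`. -/
def torusLift {n : ℕ} (f : Torus n → ℝ) (y : Fin n → ℝ) : ℝ :=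
  f (fun i => (y i : UnitAddCircle))

theorem torusContDiff_iff {n : ℕ} {k : WithTop ℕ∞} {f : Torus n → ℝ} :
    TorusContDiff k f ↔ ContDiff ℝ k (torusLift f) := Iff.rfl

theorem Torus.exists_coe {n : ℕ} (x : Torus n) :
    ∃ y : Fin n → ℝ, (fun i => (y i : UnitAddCircle)) = x := by
  choose y hy using fun i => QuotientAddGroup.mk_surjective (x i)
  exact ⟨y, funext hy⟩

theorem Torus.coe_add_single {n : ℕ} (y : Fin n → ℝ) (i : Fin n) (t : ℝ) :
    (fun j => (y j : UnitAddCircle)) + Pi.single i (t : UnitAddCircle) =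
      fun j => (((y + t • Pi.single i (1 : ℝ) : Fin n → ℝ) j : ℝ) : UnitAddCircle) := by
  funext j
  by_cases hj : j = i
  · subst hj; simp
  · simp [hj]

namespace TorusContDiff

variable {n : ℕ} {k l : WithTop ℕ∞} {f g : Torus n → ℝ}

theorem mono (hf : TorusContDiff k f) (h : l ≤ k) : TorusContDiff l f := ContDiff.of_le hf h

theorem mul (hf : TorusContDiff k f) (hg : TorusContDiff k g) :
    TorusContDiff k (fun x => f x * g x) := ContDiff.mul hf hg

theorem inv (hf : TorusContDiff k f) (h0 : ∀ x, f x ≠ 0) :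
    TorusContDiff k (fun x => (f x)⁻¹) := ContDiff.inv hf fun _ => h0 _

theorem sqrt (hf : TorusContDiff k f) (h0 : ∀ x, 0 < f x) :
    TorusContDiff k (fun x => √(f x)) := ContDiff.sqrt hf fun _ => (h0 _).ne'

theorem sum {ι : Type*} {s : Finset ι} {F : ι → Torus n → ℝ}
    (h : ∀ i ∈ s, TorusContDiff k (F i)) : TorusContDiff k (fun x => ∑ i ∈ s, F i x) :=
  ContDiff.sum h

theorem memLp (hf : TorusContDiff k f) (p : ENNReal) : MemLp f p :=
  hf.continuous_fun.memLp_of_hasCompactSupport (HasCompactSupport.of_compactSpace f)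

theorem partialD_coe (hf : TorusContDiff 1 f) (i : Fin n) (y : Fin n → ℝ) :
    partialD i f (fun j => (y j : UnitAddCircle)) =
      fderiv ℝ (torusLift f) y (Pi.single i 1) := by
  have hd : DifferentiableAt ℝ (torusLift f) y := (ContDiff.differentiable hf (by simp)) y
  have h := hd.hasFDerivAt.hasLineDerivAt (Pi.single i (1 : ℝ))
  rw [← h.lineDeriv]
  unfold partialD lineDeriv
  congr 1
  funext t
  rw [Torus.coe_add_single]
  rfl

theorem hasDerivAt (hf : TorusContDiff 1 f) (i : Fin n) (x : Torus n) (t : ℝ) :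
    HasDerivAt (fun t : ℝ => f (x + Pi.single i (t : UnitAddCircle)))
      (partialD i f (x + Pi.single i (t : UnitAddCircle))) t := by
  obtain ⟨y, rfl⟩ := Torus.exists_coe x
  rw [Torus.coe_add_single, hf.partialD_coe]
  have hd : DifferentiableAt ℝ (torusLift f) (y + t • Pi.single i (1 : ℝ)) :=
    (ContDiff.differentiable hf (by simp)) _
  have h1 : HasDerivAt (fun t : ℝ => y + t • (Pi.single i (1 : ℝ) : Fin n → ℝ))
      (Pi.single i (1 : ℝ)) t := by
    simpa using ((hasDerivAt_id t).smul_const (Pi.single i (1 : ℝ) : Fin n → ℝ)).const_add y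
  refine (hd.hasFDerivAt.comp_hasDerivAt t h1).congr_of_eventuallyEq (.of_forall fun s => ?_)
  simp only [Torus.coe_add_single]
  rfl

theorem hasDerivAt_zero (hf : TorusContDiff 1 f) (i : Fin n) (x : Torus n) :
    HasDerivAt (fun t : ℝ => f (x + Pi.single i (t : UnitAddCircle))) (partialD i f x) 0 := by
  simpa using hf.hasDerivAt i x 0

theorem partialD {k : WithTop ℕ∞} (hf : TorusContDiff (k + 1) f) (i : Fin n) :
    TorusContDiff k (partialD i f) := by
  have h1 : ContDiff ℝ k (fderiv ℝ (torusLift f)) := ContDiff.fderiv_right hf le_rfl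
  have h2 : ContDiff ℝ k (fun y => fderiv ℝ (torusLift f) y (Pi.single i 1)) :=
    h1.clm_apply contDiff_const
  have e : torusLift (_root_.partialD i f) =
      fun y => fderiv ℝ (torusLift f) y (Pi.single i 1) :=
    funext fun y => (hf.mono (by simp)).partialD_coe i y
  rw [torusContDiff_iff, e]
  exact h2

theorem partialD_smooth (hf : TorusContDiff ∞ f) (i : Fin n) :
    TorusContDiff ∞ (_root_.partialD i f) := partialD (k := ∞) hf i

theorem continuous_partialD (hf : TorusContDiff 1 f) (i : Fin n) :
    Continuous (_root_.partialD i f) :=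
  (partialD (k := 0) (by simpa using hf) i).continuous_fun

theorem one_of_smooth (hf : TorusContDiff ∞ f) : TorusContDiff 1 f := hf.mono (by simp)

theorem one_of_nat {k : ℕ} (hf : TorusContDiff k f) (hk : 1 ≤ k) : TorusContDiff 1 f :=
  hf.mono (by exact_mod_cast hk)

theorem continuous_torusGrad (hf : TorusContDiff 1 f) : Continuous (torusGrad f) := by
  unfold torusGrad
  exact (PiLp.continuous_toLp 2 _).comp (continuous_pi fun i => hf.continuous_partialD i)

end TorusContDiff

section partialD

variable {n : ℕ} {f g : Torus n → ℝ}

theorem partialD_mul (hf : TorusContDiff 1 f) (hg : TorusContDiff 1 g) (i : Fin n) (x : Torus n) :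
    partialD i (fun x => f x * g x) x = partialD i f x * g x + f x * partialD i g x := by
  have := ((hf.hasDerivAt_zero i x).fun_mul (hg.hasDerivAt_zero i x)).deriv
  simpa [partialD] using this

theorem partialD_inv (hf : TorusContDiff 1 f) (h0 : ∀ x, f x ≠ 0) (i : Fin n) (x : Torus n) :
    partialD i (fun x => (f x)⁻¹) x = -partialD i f x / f x ^ 2 := by
  have := ((hf.hasDerivAt_zero i x).fun_inv (by simpa using h0 x)).deriv
  simpa [partialD] using this

theorem partialD_sum {ι : Type*} {s : Finset ι} {F : ι → Torus n → ℝ}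
    (h : ∀ j ∈ s, TorusContDiff 1 (F j)) (i : Fin n) (x : Torus n) :
    partialD i (fun x => ∑ j ∈ s, F j x) x = ∑ j ∈ s, partialD i (F j) x :=
  (HasDerivAt.fun_sum fun j hj => (h j hj).hasDerivAt_zero i x).deriv

theorem partialD_comm (hf : TorusContDiff 2 f) (i j : Fin n) (x : Torus n) :
    partialD i (partialD j f) x = partialD j (partialD i f) x := by
  obtain ⟨y, rfl⟩ := Torus.exists_coe x
  have h1 : TorusContDiff 1 f := hf.mono (by norm_num)
  have key : ∀ i j : Fin n, partialD i (partialD j f) (fun j => (y j : UnitAddCircle)) =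
      fderiv ℝ (fderiv ℝ (torusLift f)) y (Pi.single i 1) (Pi.single j 1) := by
    intro i j
    have hd : TorusContDiff 1 (partialD j f) :=
      TorusContDiff.partialD (k := 1) (by norm_num; exact hf) j
    rw [hd.partialD_coe]
    have e : torusLift (partialD j f) = fun y => fderiv ℝ (torusLift f) y (Pi.single j 1) :=
      funext fun y => h1.partialD_coe j y
    have h2 : DifferentiableAt ℝ (fderiv ℝ (torusLift f)) y :=
      (ContDiff.differentiable (n := 1) (ContDiff.fderiv_right hf (by norm_num)) (by simp)) y
    rw [e, fderiv_clm_apply h2 (differentiableAt_const _)]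
    simp
  rw [key, key]
  have := (ContDiff.contDiffAt hf (x := y)).isSymmSndFDerivAt (by simp)
  exact this.eq _ _

/-- By translation invariance the integral of `f (x + t eᵢ)` does not depend on `t`; differentiate
under the integral sign at `t = 0`. -/
theorem integral_partialD (hf : TorusContDiff 1 f) (i : Fin n) : ∫ x, partialD i f x = 0 := by
  have hc := hf.continuous_partialD i
  obtain ⟨C, hC⟩ := isCompact_univ.exists_bound_of_continuousOn (f := partialD i f) hc.continuousOn
  let F : ℝ → Torus n → ℝ := fun t x => f (x + Pi.single i (t : UnitAddCircle))
  let F' : ℝ → Torus n → ℝ := fun t x => partialD i f (x + Pi.single i (t : UnitAddCircle))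
  have meas : ∀ t : ℝ, AEStronglyMeasurable (F t) volume := fun t =>
    (hf.continuous_fun.comp (continuous_add_const _)).aestronglyMeasurable
  have meas' : AEStronglyMeasurable (F' 0) volume :=
    (hc.comp (continuous_add_const _)).aestronglyMeasurable
  have F0 : F 0 = f := by funext x; simp [F]
  have F0' : F' 0 = partialD i f := by funext x; simp [F']
  have hint : Integrable (F 0) := by
    rw [F0]
    exact memLp_one_iff_integrable.1 (hf.memLp 1)
  have hF : ∀ x t, HasDerivAt (fun t => F t x) (F' t x) t := fun x t => hf.hasDerivAt i x t
  have hb : ∀ x t, ‖F' t x‖ ≤ C := fun x t => hC _ (Set.mem_univ _)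
  have e : (fun t : ℝ => ∫ x, F t x) = fun _ => ∫ x, f x := by
    funext t
    exact integral_add_right_eq_self f _
  clear_value F F'
  have h := (hasDerivAt_integral_of_dominated_loc_of_deriv_le
    (μ := (volume : Measure (Torus n))) (s := Set.univ)
    (F := F) (F' := F') (x₀ := 0) (bound := fun _ => C) univ_mem (.of_forall meas) hint meas'
    (.of_forall fun x t _ => hb x t) (integrable_const C) (.of_forall fun x t _ => hF x t)).2
  rw [e, F0'] at h
  exact h.unique (hasDerivAt_const _ _)

theorem integral_mul_partialD (hf : TorusContDiff 1 f) (hg : TorusContDiff 1 g) (i : Fin n) :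
    ∫ x, f x * partialD i g x = -∫ x, partialD i f x * g x := by
  have h := integral_partialD (hf.mul hg) i
  simp_rw [partialD_mul hf hg] at h
  have int : ∀ {a : Torus n → ℝ}, Continuous a → Integrable a := fun ha =>
    memLp_one_iff_integrable.1
      (ha.memLp_of_hasCompactSupport (HasCompactSupport.of_compactSpace _))
  have h2 := integral_add (int ((hf.continuous_partialD i).mul hg.continuous_fun))
    (int (hf.continuous_fun.mul (hg.continuous_partialD i)))
  simp only [Pi.mul_apply] at h2
  linarith

theorem TorusContDiff.hasWeakPartial (hf : TorusContDiff 1 f) (i : Fin n) :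
    HasWeakPartial i f (_root_.partialD i f) :=
  fun _ hη => integral_mul_partialD hf hη.one_of_smooth i

theorem TorusContDiff.hasWeakGrad (hf : TorusContDiff 1 f) : HasWeakGrad f (torusGrad f) :=
  fun i => hf.hasWeakPartial i

end partialD

/-! ### Real trigonometric monomials. -/

/-- The real trigonometric monomial `Re (c e^{2πi m·x})`. -/
def trig {n : ℕ} (c : ℂ) (m : Fin n → ℤ) (x : Torus n) : ℝ :=
  (c * UnitAddTorus.mFourier m x).re

section trig

variable {n : ℕ}

theorem mFourier_coe (m : Fin n → ℤ) (y : Fin n → ℝ) :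
    UnitAddTorus.mFourier m (fun i => (y i : UnitAddCircle)) =
      Complex.exp (2 * Real.pi * Complex.I * ∑ i, (m i : ℂ) * (y i : ℂ)) := by
  simp only [UnitAddTorus.mFourier, ContinuousMap.coe_mk, fourier_coe_apply]
  rw [← Complex.exp_sum, Finset.mul_sum]
  congr 1
  refine Finset.sum_congr rfl fun i _ => ?_
  push_cast
  ring

theorem trig_smooth (c : ℂ) (m : Fin n → ℤ) : TorusContDiff ∞ (trig c m) := by
  rw [torusContDiff_iff]
  have e : torusLift (trig c m) = fun y => Complex.reCLM
      (c * Complex.exp (2 * Real.pi * Complex.I * ∑ i, (m i : ℂ) * Complex.ofRealCLM (y i))) := by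
    funext y
    simp only [torusLift, trig, mFourier_coe]
    rfl
  rw [e]
  refine Complex.reCLM.contDiff.comp (contDiff_const.mul (ContDiff.cexp
    (contDiff_const.mul (ContDiff.sum fun i _ => contDiff_const.mul
      (Complex.ofRealCLM.contDiff.comp (contDiff_apply ℝ ℝ i))))))

theorem partialD_trig (c : ℂ) (m : Fin n → ℤ) (i : Fin n) :
    partialD i (trig c m) = trig (2 * Real.pi * Complex.I * m i * c) m := by
  funext x
  obtain ⟨y, rfl⟩ := Torus.exists_coe x
  have e : (fun t : ℝ => trig c m ((fun j => (y j : UnitAddCircle)) +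
      Pi.single i (t : UnitAddCircle))) = fun t : ℝ =>
      (c * Complex.exp (2 * Real.pi * Complex.I * (∑ j, (m j : ℂ) * (y j : ℂ)) +
        2 * Real.pi * Complex.I * m i * (t : ℂ))).re := by
    funext t
    rw [Torus.coe_add_single]
    simp only [trig, mFourier_coe]
    congr 3
    have hs : ∑ j, (m j : ℂ) * (((y + t • Pi.single i (1 : ℝ) : Fin n → ℝ) j : ℝ) : ℂ) =
        (∑ j, (m j : ℂ) * (y j : ℂ)) + m i * (t : ℂ) := by
      simp only [Pi.add_apply, Pi.smul_apply, Pi.single_apply, smul_eq_mul, mul_ite, mul_one,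
        mul_zero, Complex.ofReal_add, mul_add, Finset.sum_add_distrib, apply_ite Complex.ofReal,
        Complex.ofReal_zero, Finset.sum_ite_eq', Finset.mem_univ, if_true]
    rw [hs]
    ring
  have h : HasDerivAt (fun t : ℝ => c * Complex.exp (2 * Real.pi * Complex.I *
      (∑ j, (m j : ℂ) * (y j : ℂ)) + 2 * Real.pi * Complex.I * m i * (t : ℂ)))
      (c * (Complex.exp (2 * Real.pi * Complex.I * (∑ j, (m j : ℂ) * (y j : ℂ)) +
        2 * Real.pi * Complex.I * m i * ((0 : ℝ) : ℂ)) * (2 * Real.pi * Complex.I * m i))) 0 := by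
    refine HasDerivAt.const_mul _ (HasDerivAt.cexp ?_)
    simpa using ((Complex.ofRealCLM.hasDerivAt (x := (0 : ℝ))).const_mul
      (2 * Real.pi * Complex.I * (m i : ℂ))).const_add (2 * Real.pi * Complex.I *
      (∑ j, (m j : ℂ) * y j))
  have h' := (Complex.reCLM.hasFDerivAt.comp_hasDerivAt (0 : ℝ) h).deriv
  unfold partialD
  rw [e]
  refine h'.trans ?_
  simp only [trig, mFourier_coe, Complex.reCLM_apply, Complex.ofReal_zero, mul_zero, add_zero]
  congr 1
  ring

theorem abs_trig_le (c : ℂ) (m : Fin n → ℤ) (x : Torus n) : |trig c m x| ≤ ‖c‖ := by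
  refine (Complex.abs_re_le_norm _).trans ?_
  rw [norm_mul]
  have : ‖UnitAddTorus.mFourier m x‖ ≤ 1 :=
    ((UnitAddTorus.mFourier m).norm_coe_le_norm x).trans UnitAddTorus.mFourier_norm.le
  nlinarith [norm_nonneg c]

end trig

/-! ### Fourier series of real square integrable functions. -/

section Fourier

variable {n : ℕ}

theorem integral_mFourier (m : Fin n → ℤ) :
    ∫ x : Torus n, mFourier m x = if m = 0 then 1 else 0 := by
  have h1 : ∀ k : ℤ, k ≠ 0 → ∫ x : UnitAddCircle, fourier k x = 0 := by
    intro k hk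
    have h := (orthonormal_iff_ite.mp (orthonormal_fourier (T := 1))) 0 k
    rw [if_neg hk.symm] at h
    rw [ContinuousMap.inner_toLp] at h
    have e : (volume : Measure UnitAddCircle) = AddCircle.haarAddCircle := by
      rw [AddCircle.volume_eq_smul_haarAddCircle]; simp
    rw [e, ← h]
    simp
  split_ifs with h
  · subst h
    simp only [mFourier_zero, ContinuousMap.one_apply, integral_const, measureReal_def, volume_pi,
      Measure.pi_univ, AddCircle.measure_univ]
    simp
  · simp only [mFourier, ContinuousMap.coe_mk]
    rw [MeasureTheory.integral_fintype_prod_volume_eq_prod]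
    obtain ⟨i, hi⟩ := Function.ne_iff.mp h
    exact Finset.prod_eq_zero (Finset.mem_univ i) (h1 _ hi)

/-- The monomial `e^{2πi m·x}` as an element of `L²(𝕋ⁿ; ℂ)`. -/
def expLp (m : Fin n → ℤ) : Lp ℂ 2 (volume : Measure (Torus n)) :=
  ContinuousMap.toLp (E := ℂ) 2 volume ℂ (mFourier m)

theorem coeFn_expLp (m : Fin n → ℤ) : expLp m =ᵐ[volume] mFourier m :=
  ContinuousMap.coeFn_toLp volume (mFourier m)

theorem orthonormal_expLp : Orthonormal ℂ (expLp (n := n)) := by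
  rw [orthonormal_iff_ite]
  intro m k
  simp only [expLp, ContinuousMap.inner_toLp, ← mFourier_neg, ← mFourier_add]
  rw [integral_mFourier]
  congr 1
  rw [add_neg_eq_zero]
  exact propext eq_comm

theorem span_expLp_closure :
    (Submodule.span ℂ (Set.range (expLp (n := n)))).topologicalClosure = ⊤ := by
  unfold expLp
  simpa only [Submodule.map_span, ContinuousLinearMap.coe_coe, ← Set.range_comp,
    Function.comp_def] using
    (ContinuousMap.toLp_denseRange ℂ (volume : Measure (Torus n)) ℂ
      (p := 2) (by simp)).topologicalClosure_map_submodule span_mFourier_closure_eq_top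

/-- The Fourier basis of `L²(𝕋ⁿ; ℂ)`. -/
def torusBasis (n : ℕ) : HilbertBasis (Fin n → ℤ) ℂ (Lp ℂ 2 (volume : Measure (Torus n))) :=
  HilbertBasis.mk orthonormal_expLp span_expLp_closure.ge

theorem coe_torusBasis : ⇑(torusBasis n) = expLp := HilbertBasis.coe_mk _ _

/-- The Fourier coefficients of a real function on the torus. -/
def fcoef (f : Torus n → ℝ) (m : Fin n → ℤ) : ℂ := ∫ x, mFourier (-m) x * f x

theorem fcoef_congr {f g : Torus n → ℝ} (h : f =ᵐ[volume] g) : fcoef f = fcoef g := by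
  funext m
  refine integral_congr_ae ?_
  filter_upwards [h] with x hx
  rw [hx]

theorem torusBasis_repr (f : Lp ℂ 2 (volume : Measure (Torus n))) (m : Fin n → ℤ) :
    (torusBasis n).repr f m = ∫ x, mFourier (-m) x * f x := by
  rw [HilbertBasis.repr_apply_apply, L2.inner_def, coe_torusBasis]
  refine integral_congr_ae ?_
  filter_upwards [coeFn_expLp m] with x hx
  rw [hx, mFourier_neg]
  simp [mul_comm]

/-- The inclusion `L²(𝕋ⁿ) → L²(𝕋ⁿ; ℂ)`. -/
def ofRealLp (n : ℕ) : L2Scalar n →L[ℝ] Lp ℂ 2 (volume : Measure (Torus n)) :=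
  Complex.ofRealCLM.compLpL 2 volume

/-- The real part `L²(𝕋ⁿ; ℂ) → L²(𝕋ⁿ)`. -/
def reLp (n : ℕ) : Lp ℂ 2 (volume : Measure (Torus n)) →L[ℝ] L2Scalar n :=
  Complex.reCLM.compLpL 2 volume

theorem coeFn_ofRealLp (f : L2Scalar n) : ofRealLp n f =ᵐ[volume] fun x => (f x : ℂ) :=
  ContinuousLinearMap.coeFn_compLp _ _

theorem coeFn_reLp (f : Lp ℂ 2 (volume : Measure (Torus n))) :
    reLp n f =ᵐ[volume] fun x => (f x).re :=
  ContinuousLinearMap.coeFn_compLp _ _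

theorem reLp_ofRealLp (f : L2Scalar n) : reLp n (ofRealLp n f) = f := by
  apply Lp.ext
  filter_upwards [coeFn_reLp (ofRealLp n f), coeFn_ofRealLp f] with x h1 h2
  rw [h1, h2, Complex.ofReal_re]

theorem torusBasis_repr_ofRealLp (f : L2Scalar n) (m : Fin n → ℤ) :
    (torusBasis n).repr (ofRealLp n f) m = fcoef f m := by
  rw [torusBasis_repr]
  refine integral_congr_ae ?_
  filter_upwards [coeFn_ofRealLp f] with x hx
  rw [hx]

theorem norm_reLp_le (f : Lp ℂ 2 (volume : Measure (Torus n))) : ‖reLp n f‖ ≤ ‖f‖ := by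
  refine Lp.norm_le_norm_of_ae_le ?_
  filter_upwards [coeFn_reLp f] with x hx
  rw [hx]
  exact Complex.abs_re_le_norm _

theorem L2Scalar.inner_eq (f g : L2Scalar n) : inner ℝ f g = ∫ x, f x * g x := by
  rw [L2.inner_def]
  refine integral_congr_ae (.of_forall fun x => ?_)
  simp [mul_comm]

theorem inner_ofRealLp (f g : L2Scalar n) :
    inner ℂ (ofRealLp n f) (ofRealLp n g) = ((inner ℝ f g : ℝ) : ℂ) := by
  rw [L2.inner_def, L2.inner_def, ← integral_complex_ofReal]
  refine integral_congr_ae ?_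
  filter_upwards [coeFn_ofRealLp f, coeFn_ofRealLp g] with x h1 h2
  rw [h1, h2]
  simp

theorem integrable_mFourier_mul {f : Torus n → ℝ} (hf : Integrable f) (m : Fin n → ℤ) :
    Integrable (fun x => mFourier m x * (f x : ℂ)) := by
  refine hf.ofReal.bdd_mul (c := 1) (mFourier m).continuous.aestronglyMeasurable
    (.of_forall fun x => ?_)
  exact ((mFourier m).norm_coe_le_norm x).trans mFourier_norm.le

theorem conj_fcoef (f : Torus n → ℝ) (m : Fin n → ℤ) :
    conj (fcoef f m) = ∫ x, mFourier m x * f x := by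
  rw [fcoef, ← integral_conj]
  refine integral_congr_ae (.of_forall fun x => ?_)
  simp [mFourier_neg]

theorem fcoef_neg (f : Torus n → ℝ) (m : Fin n → ℤ) : fcoef f (-m) = conj (fcoef f m) := by
  rw [conj_fcoef, fcoef, neg_neg]

theorem integral_mul_trig {f : Torus n → ℝ} (hf : Integrable f) (c : ℂ) (m : Fin n → ℤ) :
    ∫ x, f x * trig c m x = (c * conj (fcoef f m)).re := by
  rw [conj_fcoef, ← integral_const_mul]
  have h := (integrable_mFourier_mul hf m).const_mul c
  rw [← Complex.reCLM_apply, ← Complex.reCLM.integral_comp_comm h]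
  refine integral_congr_ae (.of_forall fun x => ?_)
  simp only [trig, Complex.reCLM_apply, Complex.mul_re, Complex.mul_im, Complex.ofReal_re,
    Complex.ofReal_im]
  ring

/-- Parseval's identity for real functions. Most weak identities below are obtained by comparing two
such series term by term, which replaces mollification. -/
theorem hasSum_inner_fcoef {f g : Torus n → ℝ} (hf : MemLp f 2) (hg : MemLp g 2) :
    HasSum (fun m => (fcoef g m * conj (fcoef f m)).re) (∫ x, f x * g x) := by
  have h := (torusBasis n).hasSum_inner_mul_inner (ofRealLp n (hf.toLp f))
    (ofRealLp n (hg.toLp g))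
  have h2 := Complex.hasSum_re h
  rw [inner_ofRealLp, Complex.ofReal_re, L2Scalar.inner_eq] at h2
  convert h2 using 1
  · funext m
    rw [← inner_conj_symm, ← HilbertBasis.repr_apply_apply, ← HilbertBasis.repr_apply_apply,
      torusBasis_repr_ofRealLp, torusBasis_repr_ofRealLp, fcoef_congr hf.coeFn_toLp,
      fcoef_congr hg.coeFn_toLp, mul_comm]
  · refine integral_congr_ae ?_
    filter_upwards [hf.coeFn_toLp, hg.coeFn_toLp] with x h1 h2
    rw [h1, h2]

/-- Parseval with each term written as a pairing with a smooth function: an identity known for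
smooth test functions can be summed to one for all of `L²` or `H¹`. -/
theorem hasSum_integral_mul_trig {f g : Torus n → ℝ} (hf : MemLp f 2) (hg : MemLp g 2) :
    HasSum (fun m => ∫ x, f x * trig (fcoef g m) m x) (∫ x, f x * g x) := by
  simp_rw [integral_mul_trig (hf.integrable (by simp))]
  exact hasSum_inner_fcoef hf hg

theorem hasSum_sq_fcoef {f : Torus n → ℝ} (hf : MemLp f 2) :
    HasSum (fun m => ‖fcoef f m‖ ^ 2) (∫ x, f x * f x) := by
  refine (hasSum_inner_fcoef hf hf).congr_fun fun m => ?_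
  rw [Complex.mul_conj, Complex.ofReal_re, Complex.normSq_eq_norm_sq]

theorem L2Scalar.hasSum_sq_fcoef (f : L2Scalar n) : HasSum (fun m => ‖fcoef f m‖ ^ 2) (‖f‖ ^ 2) := by
  rw [← real_inner_self_eq_norm_sq, L2Scalar.inner_eq]
  exact _root_.hasSum_sq_fcoef (Lp.memLp f)

theorem fcoef_sub {f g : Torus n → ℝ} (hf : Integrable f) (hg : Integrable g) (m : Fin n → ℤ) :
    fcoef (fun x => f x - g x) m = fcoef f m - fcoef g m := by
  rw [fcoef, fcoef, fcoef, ← integral_sub (integrable_mFourier_mul hf _)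
    (integrable_mFourier_mul hg _)]
  refine integral_congr_ae (.of_forall fun x => ?_)
  push_cast
  ring

theorem ae_eq_of_fcoef_eq {f g : Torus n → ℝ} (hf : MemLp f 2) (hg : MemLp g 2)
    (h : ∀ m, fcoef f m = fcoef g m) : f =ᵐ[volume] g := by
  have hs := hasSum_sq_fcoef (hf.sub hg)
  have e : fcoef (f - g) = 0 := by
    funext m
    have := fcoef_sub (hf.integrable (by simp)) (hg.integrable (by simp)) m
    rw [h, sub_self] at this
    exact this
  simp only [e, Pi.zero_apply, norm_zero, ne_eq, OfNat.ofNat_ne_zero, not_false_eq_true,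
    zero_pow] at hs
  have h0 := hs.unique hasSum_zero
  rw [integral_eq_zero_iff_of_nonneg (fun x => mul_self_nonneg _)
    ((hf.sub hg).integrable_mul (hf.sub hg))] at h0
  filter_upwards [h0] with x hx
  have : (f - g) x = 0 := by simpa using hx
  simpa [sub_eq_zero] using this

/-- The dictionary between weak derivatives and Fourier multipliers: one direction tests against
monomials, the other applies it to the smooth test function and sums by Parseval. -/
theorem hasWeakPartial_iff_fcoef {i : Fin n} {f g : Torus n → ℝ} (hf : MemLp f 2)
    (hg : MemLp g 2) :
    HasWeakPartial i f g ↔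
      ∀ m, fcoef g m = 2 * Real.pi * Complex.I * m i * fcoef f m := by
  have fwd : ∀ {f g : Torus n → ℝ}, MemLp f 2 → MemLp g 2 → HasWeakPartial i f g →
      ∀ m, fcoef g m = 2 * Real.pi * Complex.I * m i * fcoef f m := by
    intro f g hf hg h m
    -- The free complex amplitude `c` recovers a complex identity from real test functions: taking
    -- `c` conjugate to the bracket turns the real part into a squared modulus.
    have key : ∀ c : ℂ, (c * (2 * Real.pi * Complex.I * m i * conj (fcoef f m) +
        conj (fcoef g m))).re = 0 := by
      intro c
      have h1 := h (trig c m) (trig_smooth c m)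
      rw [partialD_trig, integral_mul_trig (hf.integrable (by simp)),
        integral_mul_trig (hg.integrable (by simp))] at h1
      rw [mul_add, Complex.add_re, ← sub_neg_eq_add, ← h1, sub_eq_zero]
      congr 1
      ring
    have h0 : 2 * Real.pi * Complex.I * m i * conj (fcoef f m) + conj (fcoef g m) = 0 := by
      set A := 2 * Real.pi * Complex.I * m i * conj (fcoef f m) + conj (fcoef g m)
      have := key (conj A)
      rw [mul_comm, Complex.mul_conj, Complex.ofReal_re] at this
      exact Complex.normSq_eq_zero.1 this
    have h2 := congrArg conj h0
    simp only [map_add, map_mul, map_ofNat, Complex.conj_ofReal, Complex.conj_I, Complex.conj_conj,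
      map_zero, map_intCast] at h2
    linear_combination h2
  refine ⟨fwd hf hg, fun h η hη => ?_⟩
  have h1 := hasSum_inner_fcoef hf (hη.partialD_smooth i |>.memLp 2)
  have h2 := (hasSum_inner_fcoef hg (hη.memLp 2)).neg
  refine h1.unique (h2.congr_fun fun m => ?_)
  rw [fwd (hη.memLp 2) ((hη.partialD_smooth i).memLp 2) (hη.one_of_smooth.hasWeakPartial i), h,
    ← Complex.neg_re]
  congr 1
  simp only [map_mul, map_ofNat, Complex.conj_ofReal, Complex.conj_I, map_intCast]
  ring

/-- Riesz–Fischer for real functions. The symmetry of `y` says that the complex function and its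
conjugate have the same coefficients, so taking the real part changes none of them. -/
theorem exists_L2Scalar_fcoef {y : (Fin n → ℤ) → ℂ} (hy : Summable fun m => ‖y m‖ ^ 2)
    (hc : ∀ m, y (-m) = conj (y m)) : ∃ f : L2Scalar n, ∀ m, fcoef f m = y m := by
  have hmem : Memℓp y 2 := memℓp_gen (by simpa using hy)
  let F := (torusBasis n).repr.symm ⟨y, hmem⟩
  have hF : ∀ m, ∫ x, mFourier (-m) x * F x = y m := by
    intro m
    rw [← torusBasis_repr]
    simp [F]
  refine ⟨reLp n F, fun m => ?_⟩
  have hFi : Integrable F := (Lp.memLp F).integrable (by simp)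
  have hi : ∀ k : Fin n → ℤ, Integrable (fun x => mFourier k x * F x) := fun k =>
    hFi.bdd_mul (c := 1) (mFourier k).continuous.aestronglyMeasurable
      (.of_forall fun x => ((mFourier k).norm_coe_le_norm x).trans mFourier_norm.le)
  have hconj : ∫ x, mFourier (-m) x * conj (F x) = y m := by
    have h1 : ∫ x, mFourier (-m) x * conj (F x) = conj (∫ x, mFourier m x * F x) := by
      rw [← integral_conj]
      refine integral_congr_ae (.of_forall fun x => ?_)
      simp [mFourier_neg]
    have h2 := hF (-m)
    rw [neg_neg] at h2
    rw [h1, h2, hc, Complex.conj_conj]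
  have hi2 : Integrable (fun x => mFourier (-m) x * conj (F x)) := by
    have : Integrable (fun x => conj (F x)) :=
      (Complex.conjCLE.toContinuousLinearMap.integrable_comp hFi)
    exact this.bdd_mul (c := 1) (mFourier (-m)).continuous.aestronglyMeasurable
      (.of_forall fun x => ((mFourier (-m)).norm_coe_le_norm x).trans mFourier_norm.le)
  have e : fcoef (reLp n F) m =
      ∫ x, (1 / 2 : ℂ) * (mFourier (-m) x * F x + mFourier (-m) x * conj (F x)) := by
    refine integral_congr_ae ?_
    filter_upwards [coeFn_reLp F] with x hx
    rw [hx, Complex.re_eq_add_conj]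
    ring
  rw [e, integral_const_mul, integral_add (hi _) hi2, hF, hconj]
  ring

end Fourier

/-! ### Weak gradients and the Poincaré inequality. -/

section WeakGradient

variable {n : ℕ}

theorem HasWeakPartial.congr {i : Fin n} {f f' g g' : Torus n → ℝ} (h : HasWeakPartial i f g)
    (hf : f =ᵐ[volume] f') (hg : g =ᵐ[volume] g') : HasWeakPartial i f' g' := by
  intro η hη
  have e1 : ∫ x, f' x * partialD i η x = ∫ x, f x * partialD i η x :=
    integral_congr_ae (by filter_upwards [hf] with x hx; rw [hx])
  have e2 : ∫ x, g' x * η x = ∫ x, g x * η x :=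
    integral_congr_ae (by filter_upwards [hg] with x hx; rw [hx])
  rw [e1, e2, h η hη]

theorem HasWeakGrad.congr {f f' : Torus n → ℝ} {g g' : Torus n → Vec n} (h : HasWeakGrad f g)
    (hf : f =ᵐ[volume] f') (hg : g =ᵐ[volume] g') : HasWeakGrad f' g' := fun i =>
  (h i).congr hf (by filter_upwards [hg] with x hx; rw [hx])

/-- Both sides are Parseval series with equal terms. This permits test functions that are only `H¹`,
in particular products with the `C¹` weight. -/
theorem HasWeakPartial.integral_mul_eq {i : Fin n} {f g ζ ζ' : Torus n → ℝ} (hf : MemLp f 2)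
    (hg : MemLp g 2) (hζ : MemLp ζ 2) (hζ' : MemLp ζ' 2) (h : HasWeakPartial i f g)
    (h' : HasWeakPartial i ζ ζ') : ∫ x, f x * ζ' x = -∫ x, g x * ζ x := by
  have h1 := hasSum_inner_fcoef hf hζ'
  have h2 := (hasSum_inner_fcoef hg hζ).neg
  refine h1.unique (h2.congr_fun fun m => ?_)
  rw [(hasWeakPartial_iff_fcoef hζ hζ').1 h', (hasWeakPartial_iff_fcoef hf hg).1 h,
    ← Complex.neg_re]
  congr 1
  simp only [map_mul, map_ofNat, Complex.conj_ofReal, Complex.conj_I, map_intCast]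
  ring

theorem Vec.inner_eq (x y : Vec n) : inner ℝ x y = ∑ i, x i * y i := by
  simp [PiLp.inner_apply, mul_comm]

theorem MeasureTheory.MemLp.coord {g : Torus n → Vec n} {p : ENNReal} (hg : MemLp g p)
    (i : Fin n) : MemLp (fun x => g x i) p :=
  (EuclideanSpace.proj i : Vec n →L[ℝ] ℝ).comp_memLp' hg

theorem memLp_field {g : Torus n → Vec n} {p : ENNReal} (hg : ∀ i, MemLp (fun x => g x i) p) :
    MemLp g p := by
  have h : MemLp (fun x => (fun i => g x i : Fin n → ℝ)) p := MemLp.of_eval hg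
  exact ((EuclideanSpace.equiv (Fin n) ℝ).symm.toContinuousLinearMap.comp_memLp' h)

theorem integral_inner_eq_sum {p q : Torus n → Vec n} (hp : MemLp p 2) (hq : MemLp q 2) :
    ∫ x, inner ℝ (p x) (q x) = ∑ i, ∫ x, p x i * q x i := by
  simp_rw [Vec.inner_eq]
  exact integral_finsetSum _ fun i _ => (hp.coord i).integrable_mul (hq.coord i)

theorem L2Field.inner_eq (p q : L2Field n) : inner ℝ p q = ∫ x, inner ℝ (p x) (q x) :=
  L2.inner_def p q

theorem L2Field.hasSum_sq_fcoef (g : L2Field n) :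
    HasSum (fun m => ∑ i, ‖fcoef (fun x => g x i) m‖ ^ 2) (‖g‖ ^ 2) := by
  rw [← real_inner_self_eq_norm_sq, L2Field.inner_eq,
    integral_inner_eq_sum (Lp.memLp g) (Lp.memLp g)]
  exact hasSum_sum fun i _ => _root_.hasSum_sq_fcoef ((Lp.memLp g).coord i)

theorem MeasureTheory.MemLp.torusGrad {η : Torus n → ℝ} (hη : TorusContDiff 1 η) (p : ENNReal) :
    MemLp (torusGrad η) p :=
  hη.continuous_torusGrad.memLp_of_hasCompactSupport (HasCompactSupport.of_compactSpace _)

/-- An identity `f = -div p` between square integrable `f` and `p`, tested against smooth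
functions, may be tested against `H¹`. -/
theorem integral_eq_of_forall_smooth {f : Torus n → ℝ} {p : Torus n → Vec n} (hf : MemLp f 2)
    (hp : MemLp p 2)
    (h : ∀ η : Torus n → ℝ, TorusContDiff ∞ η →
      ∫ x, f x * η x = ∫ x, inner ℝ (p x) (torusGrad η x))
    {w : Torus n → ℝ} {g : Torus n → Vec n} (hw : MemLp w 2) (hg : MemLp g 2)
    (hwg : HasWeakGrad w g) : ∫ x, f x * w x = ∫ x, inner ℝ (p x) (g x) := by
  have h1 := hasSum_integral_mul_trig hf hw
  rw [integral_inner_eq_sum hp hg]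
  refine h1.unique ((hasSum_sum fun i _ =>
    hasSum_integral_mul_trig (hp.coord i) (hg.coord i)).congr_fun fun m => ?_)
  rw [h _ (trig_smooth _ _), integral_inner_eq_sum hp
    (.torusGrad (trig_smooth _ _).one_of_smooth 2)]
  refine Finset.sum_congr rfl fun i _ => ?_
  rw [(hasWeakPartial_iff_fcoef hw (hg.coord i)).1 (hwg i) m, ← partialD_trig]
  rfl

theorem HasWeakGrad.unique {f : Torus n → ℝ} {g g' : Torus n → Vec n} (hf : MemLp f 2)
    (hg : MemLp g 2) (hg' : MemLp g' 2) (h : HasWeakGrad f g) (h' : HasWeakGrad f g') :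
    g =ᵐ[volume] g' := by
  have : ∀ i, ∀ᵐ x, g x i = g' x i := fun i =>
    ae_eq_of_fcoef_eq (hg.coord i) (hg'.coord i) fun m => by
      rw [(hasWeakPartial_iff_fcoef hf (hg.coord i)).1 (h i),
        (hasWeakPartial_iff_fcoef hf (hg'.coord i)).1 (h' i)]
  filter_upwards [ae_all_iff.2 this] with x hx
  ext i
  exact hx i

/-- The squared Euclidean length of a frequency. -/
def freqSq (m : Fin n → ℤ) : ℝ := ∑ i, (m i : ℝ) ^ 2

theorem freqSq_nonneg (m : Fin n → ℤ) : 0 ≤ freqSq m := Finset.sum_nonneg fun _ _ => sq_nonneg _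

theorem sq_le_freqSq (m : Fin n → ℤ) (i : Fin n) : (m i : ℝ) ^ 2 ≤ freqSq m :=
  Finset.single_le_sum (f := fun i => (m i : ℝ) ^ 2) (fun _ _ => sq_nonneg _) (Finset.mem_univ i)

theorem one_le_freqSq {m : Fin n → ℤ} (hm : m ≠ 0) : 1 ≤ freqSq m := by
  obtain ⟨i, hi⟩ := Function.ne_iff.mp hm
  refine le_trans ?_ (sq_le_freqSq m i)
  have : 1 ≤ (m i) ^ 2 := by
    have h0 : m i ≠ 0 := hi
    exact Order.one_le_iff_pos.2 (by positivity)
  exact_mod_cast this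

theorem norm_sq_deriv_coef (m : Fin n → ℤ) (i : Fin n) (c : ℂ) :
    ‖2 * Real.pi * Complex.I * m i * c‖ ^ 2 = 4 * Real.pi ^ 2 * (m i : ℝ) ^ 2 * ‖c‖ ^ 2 := by
  simp only [norm_mul, mul_pow, Complex.norm_I, Complex.norm_real, Complex.norm_intCast,
    Real.norm_eq_abs, sq_abs]
  norm_num

theorem HasWeakGrad.hasSum_sq {f : L2Scalar n} {g : L2Field n} (h : HasWeakGrad f g) :
    HasSum (fun m => 4 * Real.pi ^ 2 * freqSq m * ‖fcoef f m‖ ^ 2) (‖g‖ ^ 2) := by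
  refine (L2Field.hasSum_sq_fcoef g).congr_fun fun m => ?_
  rw [freqSq, Finset.mul_sum, Finset.sum_mul]
  refine Finset.sum_congr rfl fun i _ => ?_
  rw [(hasWeakPartial_iff_fcoef (Lp.memLp f) ((Lp.memLp g).coord i)).1 (h i),
    norm_sq_deriv_coef]

theorem fcoef_zero (f : Torus n → ℝ) : fcoef f 0 = ((∫ x, f x : ℝ) : ℂ) := by
  rw [← integral_complex_ofReal]
  simp [fcoef, mFourier_zero]

theorem one_le_four_pi_sq : 1 ≤ 4 * Real.pi ^ 2 := by nlinarith [Real.pi_gt_three]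

/-- The Poincaré inequality. -/
theorem HasWeakGrad.norm_le {f : L2Scalar n} {g : L2Field n} (h : HasWeakGrad f g)
    (h0 : ∫ x, f x = 0) : ‖f‖ ≤ ‖g‖ := by
  refine le_of_sq_le_sq ?_ (norm_nonneg g)
  refine hasSum_le (fun m => ?_) (L2Scalar.hasSum_sq_fcoef f) h.hasSum_sq
  by_cases hm : m = 0
  · subst hm
    simp [fcoef_zero, h0]
  · refine le_mul_of_one_le_left (sq_nonneg _) ?_
    nlinarith [one_le_freqSq hm, one_le_four_pi_sq]

end WeakGradient

/-! ### Sobolev spaces through Fourier coefficients. -/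

section Sobolev

variable {n : ℕ}

theorem MemSobolev.memLp {k : ℕ} {f : Torus n → ℝ} (h : MemSobolev k f) : MemLp f 2 := by
  cases k with
  | zero => exact h
  | succ k => exact h.1

theorem pow_le_one_add_pow {x : ℝ} (hx : 0 ≤ x) {j k : ℕ} (h : j ≤ k) : x ^ j ≤ 1 + x ^ k := by
  rcases le_total x 1 with h1 | h1
  · have := pow_le_one₀ (n := j) hx h1
    have := pow_nonneg hx k
    linarith
  · have := pow_le_pow_right₀ h1 h
    linarith

theorem summable_freqSq_mono {f : Torus n → ℝ} (hf : MemLp f 2) {j k : ℕ} (h : j ≤ k)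
    (hs : Summable fun m => freqSq m ^ k * ‖fcoef f m‖ ^ 2) :
    Summable fun m => freqSq m ^ j * ‖fcoef f m‖ ^ 2 := by
  refine .of_nonneg_of_le (fun m => mul_nonneg (pow_nonneg (freqSq_nonneg m) _) (sq_nonneg _))
    (fun m => ?_) ((hasSum_sq_fcoef hf).summable.add hs)
  have := mul_le_mul_of_nonneg_right (pow_le_one_add_pow (freqSq_nonneg m) h)
    (sq_nonneg ‖fcoef f m‖)
  linarith

theorem exists_weakPartial_of_summable {f : Torus n → ℝ} (hf : MemLp f 2) (i : Fin n)
    (hs : Summable fun m => freqSq m * ‖fcoef f m‖ ^ 2) :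
    ∃ g : Torus n → ℝ, MemLp g 2 ∧ HasWeakPartial i f g := by
  obtain ⟨g, hg⟩ := exists_L2Scalar_fcoef (n := n)
    (y := fun m => 2 * Real.pi * Complex.I * m i * fcoef f m) (by
      refine .of_nonneg_of_le (fun m => sq_nonneg _) (fun m => ?_)
        (hs.mul_left (4 * Real.pi ^ 2))
      rw [norm_sq_deriv_coef, ← mul_assoc]
      gcongr
      exact sq_le_freqSq m i) (fun m => by
      simp only [Pi.neg_apply, Int.cast_neg, fcoef_neg, map_mul, map_ofNat, Complex.conj_ofReal,
        Complex.conj_I, map_intCast]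
      ring)
  exact ⟨g, Lp.memLp g, (hasWeakPartial_iff_fcoef hf (Lp.memLp g)).2 hg⟩

/-- Each weak derivative multiplies the squared coefficient by `4 π² mᵢ²`, and summing over `i`
gives one factor `freqSq m`. The weight may vanish at `m = 0` because square integrability is kept
as a separate condition. -/
theorem memSobolev_iff {k : ℕ} {f : Torus n → ℝ} :
    MemSobolev k f ↔ MemLp f 2 ∧ Summable fun m => freqSq m ^ k * ‖fcoef f m‖ ^ 2 := by
  induction k generalizing f with
  | zero =>
    simp only [MemSobolev, pow_zero, one_mul]
    exact ⟨fun h => ⟨h, (hasSum_sq_fcoef h).summable⟩, And.left⟩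
  | succ k ih =>
    constructor
    · rintro ⟨hf, h⟩
      refine ⟨hf, ?_⟩
      choose g hg hgk using h
      have hs : Summable fun m => ∑ i, freqSq m ^ k * ‖fcoef (g i) m‖ ^ 2 :=
        summable_sum fun i _ => (ih.1 (hgk i)).2
      refine (hs.mul_left (4 * Real.pi ^ 2)⁻¹).congr fun m => ?_
      have e : ∀ i, ‖fcoef (g i) m‖ ^ 2 = 4 * Real.pi ^ 2 * (m i : ℝ) ^ 2 * ‖fcoef f m‖ ^ 2 :=
        fun i => by
          rw [(hasWeakPartial_iff_fcoef hf (hgk i).memLp).1 (hg i), norm_sq_deriv_coef]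
      simp_rw [e, pow_succ (freqSq m)]
      rw [← Finset.mul_sum, ← Finset.sum_mul, ← Finset.mul_sum]
      have : Real.pi ≠ 0 := Real.pi_ne_zero
      change _ = freqSq m ^ k * freqSq m * _
      rw [show ∑ i, (m i : ℝ) ^ 2 = freqSq m from rfl]
      field_simp
    · rintro ⟨hf, h⟩
      refine ⟨hf, fun i => ?_⟩
      obtain ⟨g, hg, hfg⟩ := exists_weakPartial_of_summable hf i
        (by simpa using summable_freqSq_mono hf (j := 1) (by omega) h)
      refine ⟨g, hfg, ih.2 ⟨hg, .of_nonneg_of_le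
        (fun m => mul_nonneg (pow_nonneg (freqSq_nonneg m) _) (sq_nonneg _)) (fun m => ?_)
        (h.mul_left (4 * Real.pi ^ 2))⟩⟩
      rw [(hasWeakPartial_iff_fcoef hf hg).1 hfg, norm_sq_deriv_coef, pow_succ (freqSq m)]
      have h1 := sq_le_freqSq m i
      have h2 := pow_nonneg (freqSq_nonneg m) k
      calc freqSq m ^ k * (4 * Real.pi ^ 2 * (m i : ℝ) ^ 2 * ‖fcoef f m‖ ^ 2)
          = 4 * Real.pi ^ 2 * (freqSq m ^ k * (m i : ℝ) ^ 2 * ‖fcoef f m‖ ^ 2) := by ring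
        _ ≤ 4 * Real.pi ^ 2 * (freqSq m ^ k * freqSq m * ‖fcoef f m‖ ^ 2) := by gcongr

theorem MemSobolev.congr {k : ℕ} {f g : Torus n → ℝ} (h : MemSobolev k f)
    (hfg : f =ᵐ[volume] g) : MemSobolev k g := by
  rw [memSobolev_iff] at h ⊢
  rw [← fcoef_congr hfg]
  exact ⟨h.1.ae_eq hfg, h.2⟩

theorem MemSobolev.mono {j k : ℕ} {f : Torus n → ℝ} (h : MemSobolev k f) (hjk : j ≤ k) :
    MemSobolev j f := by
  rw [memSobolev_iff] at h ⊢
  exact ⟨h.1, summable_freqSq_mono h.1 hjk h.2⟩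

theorem HasWeakPartial.add_fun {i : Fin n} {f f' g g' : Torus n → ℝ} (hf : MemLp f 2)
    (hf' : MemLp f' 2) (hg : MemLp g 2) (hg' : MemLp g' 2) (h : HasWeakPartial i f g)
    (h' : HasWeakPartial i f' g') :
    HasWeakPartial i (fun x => f x + f' x) (fun x => g x + g' x) := by
  intro η hη
  have hc := continuous_partialD i η hη
  have hc' := hη.continuous_fun
  simp only [add_mul]
  rw [integral_add (integrable_mul_continuous hf hc) (integrable_mul_continuous hf' hc),
    integral_add (integrable_mul_continuous hg hc') (integrable_mul_continuous hg' hc'),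
    h η hη, h' η hη]
  ring

theorem HasWeakPartial.neg_fun {i : Fin n} {f g : Torus n → ℝ} (h : HasWeakPartial i f g) :
    HasWeakPartial i (fun x => -f x) (fun x => -g x) := by
  intro η hη
  simp only [neg_mul, integral_neg, h η hη]

theorem MemSobolev.add {k : ℕ} {f g : Torus n → ℝ} (hf : MemSobolev k f) (hg : MemSobolev k g) :
    MemSobolev k (fun x => f x + g x) := by
  induction k generalizing f g with
  | zero => exact MemLp.add hf hg
  | succ k ih =>
    refine ⟨hf.1.add hg.1, fun i => ?_⟩
    obtain ⟨f', hf1, hf2⟩ := hf.2 i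
    obtain ⟨g', hg1, hg2⟩ := hg.2 i
    exact ⟨_, hf1.add_fun hf.1 hg.1 hf2.memLp hg2.memLp hg1, ih hf2 hg2⟩

theorem MemSobolev.neg {k : ℕ} {f : Torus n → ℝ} (hf : MemSobolev k f) :
    MemSobolev k (fun x => -f x) := by
  induction k generalizing f with
  | zero => exact MemLp.neg hf
  | succ k ih =>
    refine ⟨hf.1.neg, fun i => ?_⟩
    obtain ⟨f', hf1, hf2⟩ := hf.2 i
    exact ⟨_, hf1.neg_fun, ih hf2⟩

theorem MemSobolev.zero {k : ℕ} : MemSobolev k (fun _ : Torus n => (0 : ℝ)) := by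
  induction k with
  | zero => exact MemLp.zero'
  | succ k ih => exact ⟨MemLp.zero', fun i => ⟨_, fun η _ => by simp, ih⟩⟩

theorem MemSobolev.sum {k : ℕ} {ι : Type*} {s : Finset ι} {f : ι → Torus n → ℝ}
    (hf : ∀ i ∈ s, MemSobolev k (f i)) : MemSobolev k (fun x => ∑ i ∈ s, f i x) := by
  classical
  induction s using Finset.induction_on with
  | empty => simpa using MemSobolev.zero
  | insert a s ha ih =>
    simp_rw [Finset.sum_insert ha]
    exact (hf a (by simp)).add (ih fun i hi => hf i (by simp [hi]))

theorem MeasureTheory.MemLp.continuous_mul {a f : Torus n → ℝ} {p : ENNReal} (hf : MemLp f p)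
    (ha : Continuous a) : MemLp (fun x => a x * f x) p := by
  have h : MemLp a ⊤ := ha.memLp_of_hasCompactSupport (HasCompactSupport.of_compactSpace _)
  exact hf.mul h

/-- Test the derivative of `f` against `a η`, which is only `C¹`, and expand by the product rule. -/
theorem HasWeakPartial.mul_contDiff {i : Fin n} {a f g : Torus n → ℝ} (ha : TorusContDiff 1 a)
    (hf : MemLp f 2) (hg : MemLp g 2) (h : HasWeakPartial i f g) :
    HasWeakPartial i (fun x => a x * f x) (fun x => a x * g x + partialD i a x * f x) := by
  intro η hη
  have h1 := ha.mul hη.one_of_smooth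
  have key := h.integral_mul_eq hf hg (h1.memLp 2)
    ((h1.continuous_partialD i).memLp_of_hasCompactSupport
      (HasCompactSupport.of_compactSpace _)) (h1.hasWeakPartial i)
  have hc := (ha.continuous_partialD i)
  have i1 : Integrable (fun x => f x * (a x * partialD i η x)) := integrable_mul_continuous hf
    (ha.continuous_fun.mul (hη.one_of_smooth.continuous_partialD i))
  have i2 : Integrable (fun x => f x * (partialD i a x * η x)) := integrable_mul_continuous hf
    (hc.mul hη.continuous_fun)
  have i3 : Integrable (fun x => g x * (a x * η x)) := integrable_mul_continuous hg
    (ha.continuous_fun.mul hη.continuous_fun)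
  have e1 : ∫ x, f x * partialD i (fun x => a x * η x) x =
      (∫ x, f x * (a x * partialD i η x)) + ∫ x, f x * (partialD i a x * η x) := by
    rw [← integral_add i1 i2]
    refine integral_congr_ae (.of_forall fun x => ?_)
    simp only [partialD_mul ha hη.one_of_smooth]
    ring
  have e2 : ∫ x, (a x * g x + partialD i a x * f x) * η x =
      (∫ x, g x * (a x * η x)) + ∫ x, f x * (partialD i a x * η x) := by
    rw [← integral_add i3 i2]
    refine integral_congr_ae (.of_forall fun x => ?_)
    simp only
    ring
  have e3 : ∫ x, a x * f x * partialD i η x = ∫ x, f x * (a x * partialD i η x) :=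
    integral_congr_ae (.of_forall fun x => by simp only; ring)
  rw [e3, e2]
  linarith

theorem MemSobolev.mul_contDiff {k : ℕ} {a f : Torus n → ℝ} (hf : MemSobolev k f)
    (ha : TorusContDiff k a) : MemSobolev k (fun x => a x * f x) := by
  induction k generalizing a f with
  | zero => exact MemLp.continuous_mul hf ha.continuous_fun
  | succ k ih =>
    have ha1 : TorusContDiff 1 a := ha.one_of_nat (by omega)
    refine ⟨hf.1.continuous_mul ha.continuous_fun, fun i => ?_⟩
    obtain ⟨g, hg, hgk⟩ := hf.2 i
    refine ⟨_, hg.mul_contDiff ha1 hf.1 hgk.memLp, ?_⟩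
    exact (ih hgk (ha.mono (by exact_mod_cast Nat.le_succ k))).add
      (ih (hf.mono (Nat.le_succ k)) (TorusContDiff.partialD (k := k) (by exact_mod_cast ha) i))

end Sobolev

/-! ### The graph of the weighted gradient and Rellich's theorem. -/

section Rellich

variable {n : ℕ}

/-- The pairs `(f, h)` of square integrable `f`, `h` such that `b h` is the weak gradient
of `f`. -/
def gradSpace (b : Torus n → ℝ) (hb : Continuous b) : Submodule ℝ (L2State n) :=
  ⨅ (i : Fin n) (η : Torus n → ℝ) (hη : TorusContDiff ∞ η),
    (innerSL ℝ (((hη.partialD_smooth i).memLp 2).toLp (partialD i η)) ∘L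
        WithLp.fstL 2 ℝ (L2Scalar n) (L2Field n) +
      innerSL ℝ ((((hη.memLp 2).continuous_mul hb)).toLp (fun x => b x * η x)) ∘L
        (EuclideanSpace.proj i : Vec n →L[ℝ] ℝ).compLpL 2 volume ∘L
        WithLp.sndL 2 ℝ (L2Scalar n) (L2Field n)).ker

/-- Each test function imposes one continuous linear condition, so the space is an intersection of
closed kernels. -/
theorem isClosed_gradSpace (b : Torus n → ℝ) (hb : Continuous b) :
    IsClosed (gradSpace b hb : Set (L2State n)) := by
  simp only [gradSpace, Submodule.coe_iInf]
  exact isClosed_iInter fun i => isClosed_iInter fun η => isClosed_iInter fun hη =>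
    ContinuousLinearMap.isClosed_ker _

theorem mem_gradSpace {b : Torus n → ℝ} {hb : Continuous b} {X : L2State n} :
    X ∈ gradSpace b hb ↔ HasWeakGrad X.fst (fun x => b x • X.snd x) := by
  simp only [gradSpace, Submodule.mem_iInf, LinearMap.mem_ker, HasWeakGrad, HasWeakPartial]
  refine forall_congr' fun i => forall_congr' fun η => forall_congr' fun hη => ?_
  have e1 : inner ℝ (((hη.partialD_smooth i).memLp 2).toLp (partialD i η)) X.fst =
      ∫ x, X.fst x * partialD i η x := by
    rw [L2Scalar.inner_eq]
    refine integral_congr_ae ?_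
    filter_upwards [((hη.partialD_smooth i).memLp 2).coeFn_toLp] with x hx
    rw [hx, mul_comm]
  have e2 : inner ℝ ((((hη.memLp 2).continuous_mul hb)).toLp (fun x => b x * η x))
      ((EuclideanSpace.proj i : Vec n →L[ℝ] ℝ).compLpL 2 volume X.snd) =
      ∫ x, (b x • X.snd x) i * η x := by
    rw [L2Scalar.inner_eq]
    refine integral_congr_ae ?_
    filter_upwards [((hη.memLp 2).continuous_mul hb).coeFn_toLp,
      (EuclideanSpace.proj i : Vec n →L[ℝ] ℝ).coeFn_compLpL (p := 2) (μ := volume) X.snd]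
      with x hx hx'
    rw [hx, hx']
    simp
    ring
  change inner ℝ (((hη.partialD_smooth i).memLp 2).toLp (partialD i η)) X.fst +
    inner ℝ ((((hη.memLp 2).continuous_mul hb)).toLp (fun x => b x * η x))
      ((EuclideanSpace.proj i : Vec n →L[ℝ] ℝ).compLpL 2 volume X.snd) = 0 ↔ _
  rw [e1, e2, add_eq_zero_iff_eq_neg]

instance completeSpace_gradSpace (b : Torus n → ℝ) (hb : Continuous b) :
    CompleteSpace (gradSpace b hb) :=
  (isClosed_gradSpace b hb).completeSpace_coe

/-- The projection `(f, h) ↦ f`. -/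
def gradSpaceFst (b : Torus n → ℝ) (hb : Continuous b) : gradSpace b hb →L[ℝ] L2Scalar n :=
  WithLp.fstL 2 ℝ (L2Scalar n) (L2Field n) ∘L (gradSpace b hb).subtypeL

/-- The Fourier partial sum over the frequencies in `S`. -/
def fourierSum (S : Finset (Fin n → ℤ)) : Lp ℂ 2 (volume : Measure (Torus n)) →L[ℝ]
    Lp ℂ 2 (volume : Measure (Torus n)) :=
  ∑ m ∈ S, (ContinuousLinearMap.toSpanSingleton ℂ (expLp m)).restrictScalars ℝ ∘L
    (innerSL ℂ (expLp m)).restrictScalars ℝ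

theorem repr_sub_fourierSum (S : Finset (Fin n → ℤ)) (F : Lp ℂ 2 (volume : Measure (Torus n)))
    (k : Fin n → ℤ) : (torusBasis n).repr (F - fourierSum S F) k =
      if k ∈ S then 0 else (torusBasis n).repr F k := by
  rw [HilbertBasis.repr_apply_apply, HilbertBasis.repr_apply_apply, inner_sub_right, fourierSum,
    sum_apply, inner_sum]
  have e : ∀ m ∈ S, inner ℂ (torusBasis n k)
      (((ContinuousLinearMap.toSpanSingleton ℂ (expLp m)).restrictScalars ℝ ∘L
        (innerSL ℂ (expLp m)).restrictScalars ℝ) F) =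
      if k = m then inner ℂ (torusBasis n m) F else 0 := by
    intro m _
    change inner ℂ (torusBasis n k) ((inner ℂ (expLp m) F : ℂ) • expLp m) = _
    rw [inner_smul_right, coe_torusBasis, orthonormal_iff_ite.1 orthonormal_expLp]
    split_ifs <;> simp
  rw [Finset.sum_congr rfl e, Finset.sum_ite_eq]
  split_ifs <;> simp

theorem torusBasis_hasSum_sq (F : Lp ℂ 2 (volume : Measure (Torus n))) :
    HasSum (fun m => ‖(torusBasis n).repr F m‖ ^ 2) (‖F‖ ^ 2) := by
  have h := lp.hasSum_norm (p := 2) (by simp) ((torusBasis n).repr F)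
  simpa using h

/-- A frequency outside the box of size `N` satisfies `freqSq m ≥ (N + 1)²`, so the tail is
controlled by the gradient with a gain `1 / (N + 1)`. Hence the inclusion of `H¹` in `L²` is a norm
limit of finite rank operators. -/
theorem norm_sub_fourierSum_le {f : L2Scalar n} {g : L2Field n} (h : HasWeakGrad f g) (N : ℕ) :
    ((N : ℝ) + 1) * ‖f - reLp n (fourierSum (Finset.Icc (fun _ => -(N : ℤ)) fun _ => (N : ℤ))
      (ofRealLp n f))‖ ≤ ‖g‖ := by
  set S : Finset (Fin n → ℤ) := Finset.Icc (fun _ => -(N : ℤ)) fun _ => (N : ℤ)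
  set F := ofRealLp n f
  have h1 : ‖f - reLp n (fourierSum S F)‖ ≤ ‖F - fourierSum S F‖ := by
    conv_lhs => rw [← reLp_ofRealLp f, ← map_sub]
    exact norm_reLp_le _
  have h2 : ((N : ℝ) + 1) * ‖F - fourierSum S F‖ ≤ ‖g‖ := by
    refine le_of_sq_le_sq ?_ (norm_nonneg g)
    rw [mul_pow]
    refine hasSum_le (fun m => ?_) ((torusBasis_hasSum_sq _).mul_left _) h.hasSum_sq
    rw [repr_sub_fourierSum]
    split_ifs with hm
    · have := freqSq_nonneg m
      rw [norm_zero, zero_pow two_ne_zero, mul_zero]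
      positivity
    · rw [torusBasis_repr_ofRealLp]
      gcongr
      have hN : ((N : ℝ) + 1) ^ 2 ≤ freqSq m := by
        simp only [S, Finset.mem_Icc, Pi.le_def, not_and_or, not_forall, not_le] at hm
        obtain ⟨i, hi⟩ : ∃ i, ((N : ℤ) + 1) ≤ |m i| := by
          rcases hm with ⟨i, hi⟩ | ⟨i, hi⟩
          · exact ⟨i, by rw [le_abs]; omega⟩
          · exact ⟨i, by rw [le_abs]; omega⟩
        refine le_trans ?_ (sq_le_freqSq m i)
        rw [← sq_abs (m i : ℝ)]
        have : ((N : ℝ) + 1) ≤ |(m i : ℝ)| := by exact_mod_cast hi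
        gcongr
      nlinarith [one_le_four_pi_sq, sq_nonneg ((N : ℝ) + 1)]
  exact (mul_le_mul_of_nonneg_left h1 (by positivity)).trans h2

theorem isCompactOperator_fourierSum (S : Finset (Fin n → ℤ)) :
    IsCompactOperator (fourierSum S) := by
  have h : ∀ T : Finset (Fin n → ℤ), fourierSum T ∈
      compactOperator (RingHom.id ℝ) (Lp ℂ 2 (volume : Measure (Torus n)))
        (Lp ℂ 2 (volume : Measure (Torus n))) := by
    intro T
    refine Submodule.sum_mem _ fun m _ => ?_
    exact (isCompactOperator_of_locallyCompactSpace_dom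
      ((innerSL ℂ (expLp m)).restrictScalars ℝ)).clm_comp
      ((ContinuousLinearMap.toSpanSingleton ℂ (expLp m)).restrictScalars ℝ)
  exact h S

/-- **Rellich's theorem** on the torus. -/
theorem isCompactOperator_gradSpaceFst (b : Torus n → ℝ) (hb : Continuous b) :
    IsCompactOperator (gradSpaceFst b hb) := by
  obtain ⟨C, hC⟩ := isCompact_univ.exists_bound_of_continuousOn (f := b) hb.continuousOn
  let S : ℕ → Finset (Fin n → ℤ) := fun N => Finset.Icc (fun _ => -(N : ℤ)) fun _ => (N : ℤ)
  let P : ℕ → gradSpace b hb →L[ℝ] L2Scalar n := fun N =>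
    reLp n ∘L fourierSum (S N) ∘L ofRealLp n ∘L gradSpaceFst b hb
  have hP : ∀ N, ‖P N - gradSpaceFst b hb‖ ≤ |C| / ((N : ℝ) + 1) := by
    intro N
    refine ContinuousLinearMap.opNorm_le_bound _ (by positivity) fun X => ?_
    have hX := mem_gradSpace.1 X.2
    have hm : MemLp (fun x => b x • X.1.snd x) 2 := by
      refine memLp_field fun i => ?_
      simpa using (((Lp.memLp X.1.snd).coord i).continuous_mul hb)
    have hg : HasWeakGrad X.1.fst (hm.toLp _) := hX.congr ae_eq_rfl hm.coeFn_toLp.symm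
    have h1 := norm_sub_fourierSum_le hg N
    have h2 : ‖hm.toLp _‖ ≤ |C| * ‖X.1.snd‖ := by
      refine Lp.norm_le_mul_norm_of_ae_le_mul ?_
      filter_upwards [hm.coeFn_toLp] with x hx
      rw [hx, norm_smul]
      gcongr
      exact (hC x (Set.mem_univ _)).trans (le_abs_self _)
    have h3 : ‖X.1.snd‖ ≤ ‖X‖ := WithLp.norm_snd_le (L2Scalar n) X.1
    change ‖_ - X.1.fst‖ ≤ _
    rw [norm_sub_rev, div_mul_eq_mul_div, le_div_iff₀ (by positivity), mul_comm]
    exact h1.trans (h2.trans (by gcongr))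
  have hlim : Tendsto (fun N => ‖P N - gradSpaceFst b hb‖) atTop (𝓝 0) := by
    refine squeeze_zero (fun N => norm_nonneg (P N - gradSpaceFst b hb)) hP ?_
    refine ((tendsto_const_div_atTop_nhds_zero_nat |C|).comp (tendsto_add_atTop_nat 1)).congr
      fun N => ?_
    simp
  have hlim' : Tendsto P atTop (𝓝 (gradSpaceFst b hb)) :=
    (tendsto_iff_norm_sub_tendsto_zero (f := P) (b := gradSpaceFst b hb)).2 hlim
  refine isCompactOperator_of_tendsto hlim' (.of_forall fun N => ?_)
  exact ((isCompactOperator_fourierSum (S N)).comp_clm _).clm_comp (reLp n)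

end Rellich

/-! ### Almost periodic functions and their mean values. -/

section AlmostPeriodic

variable {E F : Type*} [NormedAddCommGroup E] [NormedSpace ℝ E] [NormedAddCommGroup F]
  [NormedSpace ℝ F]

/-- Uniform limits of trigonometric polynomials with values in `E`. -/
inductive AlmostPeriodic : (ℝ → E) → Prop
  | wave (θ α : ℝ) (x : E) : AlmostPeriodic fun s => Real.cos (θ * s + α) • x
  | add {f g : ℝ → E} (hf : AlmostPeriodic f) (hg : AlmostPeriodic g) :
      AlmostPeriodic fun s => f s + g s
  | lim {f : ℝ → E} (g : ℕ → ℝ → E) (hg : ∀ k, AlmostPeriodic (g k))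
      (h : TendstoUniformly g f atTop) : AlmostPeriodic f

namespace AlmostPeriodic

theorem of_approx {f : ℝ → E}
    (h : ∀ ε > 0, ∃ g : ℝ → E, AlmostPeriodic g ∧ ∀ s, ‖f s - g s‖ ≤ ε) : AlmostPeriodic f := by
  choose g hg hfg using fun k : ℕ => h (1 / ((k : ℝ) + 1)) (by positivity)
  refine .lim g hg (Metric.tendstoUniformly_iff.2 fun ε hε => ?_)
  filter_upwards [(tendsto_one_div_add_atTop_nhds_zero_nat (𝕜 := ℝ)).eventually_lt_const hε]
    with k hk s
  rw [dist_eq_norm]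
  exact (hfg k s).trans_lt hk

theorem zero : AlmostPeriodic fun _ : ℝ => (0 : E) := by
  simpa using wave 0 0 (0 : E)

theorem sum {ι : Type*} {S : Finset ι} {f : ι → ℝ → E} (h : ∀ i ∈ S, AlmostPeriodic (f i)) :
    AlmostPeriodic fun s => ∑ i ∈ S, f i s := by
  classical
  induction S using Finset.induction_on with
  | empty => simpa using zero
  | insert a S ha ih =>
    simp_rw [Finset.sum_insert ha]
    exact (h a (by simp)).add (ih fun i hi => h i (by simp [hi]))

theorem continuous {f : ℝ → E} (hf : AlmostPeriodic f) : Continuous f := by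
  induction hf with
  | wave θ α x => fun_prop
  | add _ _ hf hg => exact hf.add hg
  | lim g _ h ih => exact h.continuous (Eventually.of_forall ih).frequently

theorem map (T : E →L[ℝ] F) {f : ℝ → E} (hf : AlmostPeriodic f) :
    AlmostPeriodic fun s => T (f s) := by
  induction hf with
  | wave θ α x => simpa using wave θ α (T x)
  | add _ _ hf hg => simpa using hf.add hg
  | lim g _ h ih => exact .lim _ ih (T.uniformContinuous.comp_tendstoUniformly h)

/-- On a single wave this is the product-to-sum formula; since `|cos| ≤ 1`, it survives uniform
limits. -/
theorem cos_smul (θ α : ℝ) {f : ℝ → E} (hf : AlmostPeriodic f) :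
    AlmostPeriodic fun s => Real.cos (θ * s + α) • f s := by
  induction hf with
  | wave θ' α' x =>
    have e : (fun s : ℝ => Real.cos (θ * s + α) • Real.cos (θ' * s + α') • x) =
        fun s => Real.cos ((θ + θ') * s + (α + α')) • ((1 / 2 : ℝ) • x) +
          Real.cos ((θ - θ') * s + (α - α')) • ((1 / 2 : ℝ) • x) := by
      funext s
      rw [← add_smul, smul_smul, smul_smul]
      congr 1
      rw [show (θ + θ') * s + (α + α') = (θ * s + α) + (θ' * s + α') by ring,
        show (θ - θ') * s + (α - α') = (θ * s + α) - (θ' * s + α') by ring]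
      generalize θ * s + α = A
      generalize θ' * s + α' = B
      rw [Real.cos_add, Real.cos_sub]
      ring
    rw [e]
    exact (wave _ _ _).add (wave _ _ _)
  | add _ _ hf hg => simpa using hf.add hg
  | @lim f g _ h ih =>
    refine .lim _ ih (Metric.tendstoUniformly_iff.2 fun ε hε => ?_)
    filter_upwards [Metric.tendstoUniformly_iff.1 h ε hε] with k hk s
    rw [dist_eq_norm, ← smul_sub, norm_smul]
    have h1 := hk s
    rw [dist_eq_norm] at h1
    refine lt_of_le_of_lt (mul_le_of_le_one_left (norm_nonneg _) ?_) h1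
    exact Real.abs_cos_le_one _

theorem sin_smul (θ : ℝ) {f : ℝ → E} (hf : AlmostPeriodic f) :
    AlmostPeriodic fun s => Real.sin (θ * s) • f s := by
  have := hf.cos_smul θ (-(Real.pi / 2))
  simpa [← sub_eq_add_neg, Real.cos_sub_pi_div_two] using this

/-- At nonzero frequency the integral stays below `2 / |θ|`, so the mean is `0`; at frequency zero
the integrand is constant. -/
theorem tendsto_wave_mean (θ α : ℝ) :
    ∃ l : ℝ, Tendsto (fun τ : ℝ => τ⁻¹ * ∫ s in (0 : ℝ)..τ, Real.cos (θ * s + α)) atTop (𝓝 l) := by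
  by_cases hθ : θ = 0
  · refine ⟨Real.cos α, tendsto_const_nhds.congr' ?_⟩
    filter_upwards [eventually_gt_atTop 0] with τ hτ
    simp [hθ, hτ.ne']
  · refine ⟨0, ?_⟩
    have hb : ∀ τ : ℝ, |∫ s in (0 : ℝ)..τ, Real.cos (θ * s + α)| ≤ 2 / |θ| := by
      intro τ
      rw [intervalIntegral.integral_comp_mul_add (fun s => Real.cos s) hθ, integral_cos,
        smul_eq_mul, abs_mul, abs_inv, inv_mul_eq_div]
      gcongr
      have h1 := Real.abs_sin_le_one (θ * τ + α)
      have h2 := Real.abs_sin_le_one (θ * 0 + α)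
      exact (abs_sub _ _).trans (by linarith)
    refine squeeze_zero_norm' ?_ ((tendsto_inv_atTop_zero (𝕜 := ℝ)).mul_const (2 / |θ|)
      |>.trans_eq (by simp))
    filter_upwards [eventually_gt_atTop 0] with τ hτ
    rw [norm_mul, norm_inv, Real.norm_of_nonneg hτ.le]
    exact mul_le_mul_of_nonneg_left (hb τ) (by positivity)

/-- An almost periodic function has a mean value. -/
theorem exists_mean [CompleteSpace E] {f : ℝ → E} (hf : AlmostPeriodic f) :
    ∃ l : E, Tendsto (fun τ : ℝ => τ⁻¹ • ∫ s in (0 : ℝ)..τ, f s) atTop (𝓝 l) := by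
  induction hf with
  | wave θ α x =>
    obtain ⟨l, hl⟩ := tendsto_wave_mean θ α
    refine ⟨l • x, (hl.smul_const x).congr fun τ => ?_⟩
    rw [intervalIntegral.integral_smul_const, smul_smul]
  | add hf hg ihf ihg =>
    obtain ⟨l, hl⟩ := ihf
    obtain ⟨l', hl'⟩ := ihg
    refine ⟨l + l', (hl.add hl').congr fun τ => ?_⟩
    rw [intervalIntegral.integral_add (hf.continuous.intervalIntegrable _ _)
      (hg.continuous.intervalIntegrable _ _), smul_add]
  | @lim f g hg h ih =>
    have hfc : Continuous f := (AlmostPeriodic.lim g hg h).continuous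
    -- No candidate limit is available, so the averages are shown to be Cauchy. Those of `f` and `g
    -- k` differ by at most `ε / 4`, and those of `g k` are eventually within `ε / 4` of `l`; all
    -- averages of `f` thus end up in a ball of radius `ε / 2`.
    refine cauchy_map_iff_exists_tendsto.1 (Metric.cauchy_iff.2 ⟨inferInstance, fun ε hε => ?_⟩)
    obtain ⟨k, hk⟩ := (Metric.tendstoUniformly_iff.1 h (ε / 4) (by positivity)).exists
    obtain ⟨l, hl⟩ := ih k
    refine ⟨Metric.ball l (ε / 2), ?_, fun x hx y hy => ?_⟩
    · rw [mem_map]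
      filter_upwards [Metric.tendsto_nhds.1 hl (ε / 4) (by positivity), eventually_gt_atTop 0]
        with τ hτ hτ0
      have h1 : dist (τ⁻¹ • ∫ s in (0 : ℝ)..τ, f s) (τ⁻¹ • ∫ s in (0 : ℝ)..τ, g k s) ≤ ε / 4 := by
        rw [dist_eq_norm, ← smul_sub, ← intervalIntegral.integral_sub
          (hfc.intervalIntegrable _ _) ((hg k).continuous.intervalIntegrable _ _), norm_smul,
          norm_inv, Real.norm_of_nonneg hτ0.le, inv_mul_le_iff₀ hτ0, mul_comm]
        have := intervalIntegral.norm_integral_le_of_norm_le_const (a := 0) (b := τ)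
          (f := fun s => f s - g k s) (C := ε / 4) fun s _ => by
            rw [← dist_eq_norm]; exact (hk s).le
        simpa [abs_of_pos hτ0] using this
      have := dist_triangle (τ⁻¹ • ∫ s in (0 : ℝ)..τ, f s) (τ⁻¹ • ∫ s in (0 : ℝ)..τ, g k s) l
      rw [Set.mem_preimage, Metric.mem_ball]
      linarith
    · have := dist_triangle_right x y l
      rw [Metric.mem_ball] at hx hy
      linarith

end AlmostPeriodic

end AlmostPeriodic

/-! ### Skew-adjoint operators with pure point spectrum. -/

open ComplexConjugate

/-- Coordinates of a real Hilbert space in which a skew-adjoint operator with pure point spectrum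
acts as multiplication by `-i freq`. The coordinates of frequency zero are real. -/
structure SpectralCoords (H ι : Type*) [NormedAddCommGroup H] [InnerProductSpace ℝ H] where
  /-- The frequencies. -/
  freq : ι → ℝ
  /-- The coordinates. -/
  z : ι → H →L[ℝ] ℂ
  hasSum_sq : ∀ V, HasSum (fun a => ‖z a V‖ ^ 2) (‖V‖ ^ 2)
  im_eq_zero : ∀ a, freq a = 0 → ∀ V, (z a V).im = 0
  exists_coord : ∀ y : ι → ℂ, (Summable fun a => ‖y a‖ ^ 2) → (∀ a, freq a = 0 → (y a).im = 0) →
    ∃ V, ∀ a, z a V = y a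

namespace SpectralCoords

variable {H ι : Type*} [NormedAddCommGroup H] [InnerProductSpace ℝ H] (c : SpectralCoords H ι)

theorem ext_coord {V W : H} (h : ∀ a, c.z a V = c.z a W) : V = W := by
  have h1 := c.hasSum_sq (V - W)
  simp only [map_sub, h, sub_self, norm_zero, ne_eq, OfNat.ofNat_ne_zero, not_false_eq_true,
    zero_pow] at h1
  have h2 := h1.unique hasSum_zero
  rw [sq_eq_zero_iff, norm_eq_zero, sub_eq_zero] at h2
  exact h2

theorem inner_eq_polar (V W : H) : inner ℝ V W = (‖V + W‖ ^ 2 - ‖V - W‖ ^ 2) / 4 := by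
  rw [norm_add_sq_real, norm_sub_sq_real]
  ring

/-- Dominated convergence in `ℓ²`, transported by the isometry `hasSum_sq`. -/
theorem tendsto_of_dominated {α : Type*} {l : Filter α} {F : α → H} {V : H} {b : ι → ℝ}
    (hb : Summable fun a => b a ^ 2) (h : ∀ a, Tendsto (fun t => c.z a (F t)) l (𝓝 (c.z a V)))
    (hle : ∀ᶠ t in l, ∀ a, ‖c.z a (F t) - c.z a V‖ ≤ b a) : Tendsto F l (𝓝 V) := by
  have h1 : Tendsto (fun t => ∑' a, ‖c.z a (F t - V)‖ ^ 2) l (𝓝 (∑' _ : ι, (0 : ℝ))) := by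
    refine tendsto_tsum_of_dominated_convergence (bound := fun a => b a ^ 2) hb (fun a => ?_) ?_
    · have : Tendsto (fun t => ‖c.z a (F t) - c.z a V‖ ^ 2) l (𝓝 (‖c.z a V - c.z a V‖ ^ 2)) :=
        (((h a).sub_const _).norm).pow 2
      simpa using this
    · filter_upwards [hle] with t ht a
      rw [Real.norm_of_nonneg (by positivity), map_sub]
      gcongr
      exact ht a
  simp only [(c.hasSum_sq _).tsum_eq, tsum_zero] at h1
  rw [tendsto_iff_norm_sub_tendsto_zero]
  have h2 := h1.sqrt
  simpa [Real.sqrt_sq] using h2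

/-- Bounded multipliers preserving the reality of the coordinates of frequency zero. -/
def Admissible (m : ι → ℂ) : Prop :=
  (∃ C, ∀ a, ‖m a‖ ≤ C) ∧ ∀ a, c.freq a = 0 → (m a).im = 0

/-- Boundedness keeps the new coordinates square summable, and reality at frequency zero keeps them
in the range allowed by `exists_coord`. -/
theorem exists_multiplier {m : ι → ℂ} (hm : c.Admissible m) :
    ∃ M : H →L[ℝ] H, ∀ V a, c.z a (M V) = m a * c.z a V := by
  obtain ⟨⟨C, hC⟩, hr⟩ := hm
  have hle : ∀ (V : H) (a : ι), ‖m a * c.z a V‖ ^ 2 ≤ C ^ 2 * ‖c.z a V‖ ^ 2 := fun V a => by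
    rw [norm_mul, mul_pow]
    gcongr
    exact hC a
  choose M hM using fun V => c.exists_coord (fun a => m a * c.z a V)
    (.of_nonneg_of_le (fun a => sq_nonneg _) (hle V) ((c.hasSum_sq V).summable.mul_left _))
    (fun a ha => by simp [Complex.mul_im, hr a ha, c.im_eq_zero a ha V])
  let L : H →ₗ[ℝ] H :=
    { toFun := M
      map_add' := fun V W => c.ext_coord fun a => by simp [hM, mul_add]
      map_smul' := fun r V => c.ext_coord fun a => by simp [hM]; ring }
  refine ⟨L.mkContinuous |C| fun V => ?_, hM⟩
  refine le_of_sq_le_sq ?_ (by positivity)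
  rw [mul_pow, sq_abs]
  refine hasSum_le (fun a => ?_) (c.hasSum_sq _) ((c.hasSum_sq V).mul_left (C ^ 2))
  change ‖c.z a (M V)‖ ^ 2 ≤ _
  rw [hM]
  exact hle V a

open Classical in
/-- The operator multiplying the coordinates by `m`. -/
def mult (m : ι → ℂ) : H →L[ℝ] H :=
  if hm : c.Admissible m then (c.exists_multiplier hm).choose else 0

theorem z_mult {m : ι → ℂ} (hm : c.Admissible m) (V : H) (a : ι) :
    c.z a (c.mult m V) = m a * c.z a V := by
  rw [mult, dif_pos hm]
  exact (c.exists_multiplier hm).choose_spec V a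

/-- The generator: multiplication by `-i freq` on its maximal domain. -/
def Gen (V V' : H) : Prop := ∀ a, c.z a V' = -(Complex.I * c.freq a) * c.z a V

/-- The unitary group generated by `Gen`. -/
def group (t : ℝ) : H →L[ℝ] H := c.mult fun a => Complex.exp (Complex.I * ((-(c.freq a * t) : ℝ) : ℂ))

theorem norm_exp_I (x : ℝ) : ‖Complex.exp (Complex.I * (x : ℂ))‖ = 1 := by
  rw [mul_comm, Complex.norm_exp_ofReal_mul_I]

theorem admissible_exp (t : ℝ) :
    c.Admissible fun a => Complex.exp (Complex.I * ((-(c.freq a * t) : ℝ) : ℂ)) :=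
  ⟨⟨1, fun a => (norm_exp_I _).le⟩, fun a ha => by simp [ha]⟩

theorem z_group (t : ℝ) (V : H) (a : ι) : c.z a (c.group t V) =
    Complex.exp (Complex.I * ((-(c.freq a * t) : ℝ) : ℂ)) * c.z a V :=
  c.z_mult (c.admissible_exp t) V a

theorem norm_group (t : ℝ) (V : H) : ‖c.group t V‖ = ‖V‖ := by
  have h := c.hasSum_sq (c.group t V)
  simp only [z_group, norm_mul, norm_exp_I, one_mul] at h
  exact (pow_left_inj₀ (norm_nonneg _) (norm_nonneg _) two_ne_zero).1 (h.unique (c.hasSum_sq V))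

theorem group_zero : c.group 0 = ContinuousLinearMap.id ℝ H := by
  ext V
  exact c.ext_coord fun a => by simp [z_group]

theorem group_add (s t : ℝ) : c.group (s + t) = (c.group s).comp (c.group t) := by
  ext V
  refine c.ext_coord fun a => ?_
  simp only [z_group, ContinuousLinearMap.comp_apply]
  rw [← mul_assoc, ← Complex.exp_add]
  congr 2
  push_cast
  ring

theorem continuous_group (V : H) : Continuous fun t => c.group t V := by
  rw [continuous_iff_continuousAt]
  intro t
  refine c.tendsto_of_dominated (b := fun a => 2 * ‖c.z a V‖) ?_ (fun a => ?_)
    (.of_forall fun s a => ?_)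
  · simp_rw [mul_pow]
    exact (c.hasSum_sq V).summable.mul_left _
  · simp only [z_group]
    exact Continuous.tendsto (by fun_prop) t
  · rw [z_group, z_group, ← sub_mul, norm_mul]
    gcongr
    refine (norm_sub_le _ _).trans ?_
    rw [norm_exp_I, norm_exp_I]
    norm_num

theorem hasDerivAt_coord (w : ℝ) (y : ℂ) (t : ℝ) :
    HasDerivAt (fun t : ℝ => Complex.exp (Complex.I * ((-(w * t) : ℝ) : ℂ)) * y)
      (-(Complex.I * w) * (Complex.exp (Complex.I * ((-(w * t) : ℝ) : ℂ)) * y)) t := by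
  have h1 : HasDerivAt (fun t : ℝ => Complex.I * ((-(w * t) : ℝ) : ℂ)) (-(Complex.I * w)) t := by
    have h2 : HasDerivAt (fun t : ℝ => ((-(w * t) : ℝ) : ℂ)) (-(w : ℂ)) t := by
      have := (((hasDerivAt_id t).const_mul w).neg).ofReal_comp
      simpa using! this
    simpa using! h2.const_mul Complex.I
  exact (h1.cexp.mul_const y).congr_deriv (by ring)

/-- If `V` is in the maximal domain, `|e^{ix} - 1| ≤ |x|` bounds the coordinates of the difference
quotients by those of `V'`, and dominated convergence applies. Conversely, a derivative in norm is a
derivative in each coordinate. -/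
theorem gen_iff_hasDerivAt (V V' : H) :
    c.Gen V V' ↔ HasDerivAt (fun t => c.group t V) V' 0 := by
  have hz : ∀ a, HasDerivAt (fun t => c.z a (c.group t V)) (-(Complex.I * c.freq a) * c.z a V) 0 :=
    fun a => by
      simp only [z_group]
      simpa using hasDerivAt_coord (c.freq a) (c.z a V) 0
  constructor
  · intro h
    rw [hasDerivAt_iff_tendsto_slope_zero]
    refine c.tendsto_of_dominated (b := fun a => 2 * ‖c.z a V'‖) ?_ (fun a => ?_) ?_
    · simp_rw [mul_pow]
      exact (c.hasSum_sq V').summable.mul_left _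
    · rw [h a]
      simpa using hasDerivAt_iff_tendsto_slope_zero.1 (hz a)
    · filter_upwards [self_mem_nhdsWithin] with t ht a
      have ht : t ≠ 0 := ht
      refine (norm_sub_le _ _).trans ?_
      rw [two_mul]
      gcongr
      rw [map_smul, map_sub, zero_add, c.group_zero, z_group, norm_smul, norm_inv, h a,
        ContinuousLinearMap.id_apply, ← sub_one_mul, norm_mul, norm_mul, norm_neg, norm_mul,
        Complex.norm_I, one_mul, Complex.norm_real]
      have h1 := Real.norm_exp_I_mul_ofReal_sub_one_le (x := -(c.freq a * t))
      rw [norm_neg, norm_mul] at h1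
      rw [inv_mul_le_iff₀ (by positivity)]
      calc _ ≤ ‖c.freq a‖ * ‖t‖ * ‖c.z a V‖ := by gcongr
        _ = _ := by ring
  · intro h a
    exact ((c.z a).hasFDerivAt.comp_hasDerivAt 0 h).unique (hz a)

open Classical in
/-- The truncation of `V` to the coordinates in `S`. -/
def trunc (S : Finset ι) : H →L[ℝ] H := c.mult fun a => if a ∈ S then 1 else 0

theorem z_trunc (S : Finset ι) (V : H) (a : ι) [Decidable (a ∈ S)] :
    c.z a (c.trunc S V) = if a ∈ S then c.z a V else 0 := by
  rw [trunc, z_mult]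
  · split_ifs <;> simp
  · exact ⟨⟨1, fun a => by dsimp only; split_ifs <;> simp⟩,
      fun a _ => by dsimp only; split_ifs <;> simp⟩

theorem tendsto_trunc (V : H) : Tendsto (fun S => c.trunc S V) atTop (𝓝 V) := by
  classical
  refine c.tendsto_of_dominated (b := fun a => ‖c.z a V‖) (c.hasSum_sq V).summable (fun a => ?_)
    (.of_forall fun S a => ?_)
  · refine tendsto_const_nhds.congr' ?_
    filter_upwards [eventually_ge_atTop {a}] with S hS
    rw [z_trunc, if_pos (hS (Finset.mem_singleton_self a))]
  · rw [z_trunc]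
    split_ifs <;> simp

theorem exists_gen_trunc (S : Finset ι) (V : H) : ∃ V', c.Gen (c.trunc S V) V' := by
  classical
  refine c.exists_coord (fun a => -(Complex.I * c.freq a) * c.z a (c.trunc S V)) ?_ fun a ha => ?_
  · refine summable_of_ne_finset_zero (s := S) fun a ha => ?_
    rw [z_trunc, if_neg ha]
    simp
  · simp [ha]

/-- The group is determined by its generator. -/
theorem eq_group {U : ℝ → H →L[ℝ] H} (h0 : U 0 = ContinuousLinearMap.id ℝ H)
    (hadd : ∀ s t, U (s + t) = (U s).comp (U t))
    (hgen : ∀ V V', c.Gen V V' ↔ HasDerivAt (fun t => U t V) V' 0) : U = c.group := by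
  have key : ∀ V V', c.Gen V V' → ∀ t, U t V = c.group t V := by
    intro V V' hV t
    have hd := (hgen V V').1 hV
    have hcomm : ∀ s t W, U s (U t W) = U t (U s W) := fun s t W => by
      have h := hadd s t
      rw [add_comm, hadd] at h
      exact (DFunLike.congr_fun h W).symm
    have hG : ∀ t, c.Gen (U t V) (U t V') := fun t => by
      rw [hgen]
      refine ((U t).hasFDerivAt.comp_hasDerivAt 0 hd).congr_of_eventuallyEq
        (.of_forall fun s => ?_)
      exact hcomm s t V
    have hD : ∀ t, HasDerivAt (fun s => U s V) (U t V') t := fun t => by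
      have h1 : HasDerivAt (fun s => U t (U s V)) (U t V') (t - t) := by
        rw [sub_self]
        exact (U t).hasFDerivAt.comp_hasDerivAt 0 hd
      refine (HasDerivAt.comp_sub_const t t h1).congr_of_eventuallyEq (.of_forall fun s => ?_)
      change U s V = ((U t).comp (U (s - t))) V
      rw [← hadd, add_sub_cancel]
    refine c.ext_coord fun a => ?_
    rw [z_group]
    have hz : ∀ t, HasDerivAt (fun s => c.z a (U s V))
        (-(Complex.I * c.freq a) * c.z a (U t V)) t := fun t => by
      have := (c.z a).hasFDerivAt.comp_hasDerivAt t (hD t)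
      rwa [hG t a] at this
    have he : ∀ t : ℝ, HasDerivAt (fun s : ℝ => Complex.exp (Complex.I * ((-(-c.freq a * s) : ℝ) : ℂ)))
        (Complex.I * c.freq a * Complex.exp (Complex.I * ((-(-c.freq a * t) : ℝ) : ℂ))) t := fun t => by
      simpa using hasDerivAt_coord (-c.freq a) 1 t
    -- Undoing the phase: `exp (i freq s)` times the coordinate of `U s V` has zero derivative, so
    -- the coordinate of `U t V` is the one given by the spectral group.
    have hc := is_const_of_deriv_eq_zero
      (f := fun s : ℝ => Complex.exp (Complex.I * ((-(-c.freq a * s) : ℝ) : ℂ)) * c.z a (U s V))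
      (fun t => ((he t).mul (hz t)).differentiableAt)
      (fun t => by rw [((he t).fun_mul (hz t)).deriv]; ring) t 0
    simp only [h0, mul_zero, neg_zero, Complex.ofReal_zero, Complex.exp_zero, one_mul,
      ContinuousLinearMap.id_apply] at hc
    rw [← hc, ← mul_assoc, ← Complex.exp_add]
    simp
  funext t
  ext V
  -- Truncations lie in the domain of the generator and converge to `V`, so continuity of both
  -- operators extends the equality from the domain to all states.
  have h1 : Tendsto (fun S => U t (c.trunc S V)) atTop (𝓝 (U t V)) :=
    ((U t).continuous.tendsto V).comp (c.tendsto_trunc V)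
  have h2 : Tendsto (fun S => c.group t (c.trunc S V)) atTop (𝓝 (c.group t V)) :=
    ((c.group t).continuous.tendsto V).comp (c.tendsto_trunc V)
  refine tendsto_nhds_unique h1 (h2.congr fun S => ?_)
  obtain ⟨V', hV'⟩ := c.exists_gen_trunc S V
  exact (key _ _ hV' t).symm

/-- The group is isometric, hence preserves inner products by polarization; its inverse is therefore
its adjoint. -/
theorem inner_group_neg (s : ℝ) (V W : H) :
    inner ℝ (c.group (-s) V) W = inner ℝ V (c.group s W) := by
  have h1 : c.group s (c.group (-s) V) = V := by
    have := DFunLike.congr_fun (c.group_add s (-s)) V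
    rw [add_neg_cancel, c.group_zero] at this
    exact this.symm
  have h2 : ∀ X Y, inner ℝ (c.group s X) (c.group s Y) = inner ℝ X Y := fun X Y => by
    rw [inner_eq_polar, inner_eq_polar, ← map_add, ← map_sub, c.norm_group, c.norm_group]
  rw [← h2, h1]

/-- Euler's formula in one coordinate, with `W` the quarter turn of the truncated vector. It splits
the orbit into real waves with fixed vectors, the form required by `AlmostPeriodic`. -/
theorem exists_group_trunc_singleton (a : ι) (V : H) : ∃ W, ∀ s,
    c.group s (c.trunc {a} V) =
      Real.cos (c.freq a * s) • c.trunc {a} V + Real.sin (c.freq a * s) • W := by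
  classical
  by_cases ha : c.freq a = 0
  -- At frequency zero the quarter turn would leave the real coordinates, but the sine vanishes and
  -- `W = 0` serves.
  · refine ⟨0, fun s => c.ext_coord fun b => ?_⟩
    simp only [z_group, z_trunc, ha, Finset.mem_singleton]
    by_cases hb : b = a
    · subst hb
      simp [ha, z_trunc]
    · simp [hb, z_trunc]
  · obtain ⟨W, hW⟩ := c.exists_coord (fun b => if b = a then -Complex.I * c.z a V else 0)
      (summable_of_ne_finset_zero (s := {a}) fun b hb => by
        rw [if_neg (by simpa using hb)]; simp)
      (fun b hb => by
        have : b ≠ a := fun h => ha (h ▸ hb)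
        simp [this])
    refine ⟨W, fun s => c.ext_coord fun b => ?_⟩
    rw [z_group, map_add, map_smul, map_smul, z_trunc, hW]
    by_cases hb : b = a
    · subst hb
      simp only [Finset.mem_singleton, if_true, Complex.real_smul]
      rw [mul_comm Complex.I, Complex.exp_mul_I]
      push_cast
      rw [Complex.cos_neg, Complex.sin_neg]
      ring
    · simp [hb]

theorem trunc_eq_sum (S : Finset ι) (V : H) : c.trunc S V = ∑ a ∈ S, c.trunc {a} V := by
  classical
  refine c.ext_coord fun b => ?_
  rw [z_trunc, map_sum]
  simp_rw [z_trunc, Finset.mem_singleton]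
  rw [Finset.sum_ite_eq]

theorem exists_norm_sub_trunc_le (V : H) {ε : ℝ} (hε : 0 < ε) : ∃ S, ‖V - c.trunc S V‖ ≤ ε := by
  obtain ⟨S, hS⟩ := (Metric.tendsto_nhds.1 (c.tendsto_trunc V) ε hε).exists
  exact ⟨S, by rw [← dist_eq_norm, dist_comm]; exact hS.le⟩

theorem almostPeriodic_group (V : H) : AlmostPeriodic fun s => c.group s V := by
  refine .of_approx fun ε hε => ?_
  obtain ⟨S, hS⟩ := c.exists_norm_sub_trunc_le V hε
  refine ⟨fun s => c.group s (c.trunc S V), ?_, fun s => by rwa [← map_sub, c.norm_group]⟩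
  simp_rw [c.trunc_eq_sum S, map_sum]
  refine .sum fun a _ => ?_
  obtain ⟨W, hW⟩ := c.exists_group_trunc_singleton a V
  simp_rw [hW]
  refine .add ?_ ?_
  · simpa using AlmostPeriodic.wave (c.freq a) 0 (c.trunc {a} V)
  · simpa [← sub_eq_add_neg, Real.cos_sub_pi_div_two] using
      AlmostPeriodic.wave (c.freq a) (-(Real.pi / 2)) W

theorem almostPeriodic_group_neg (V : H) : AlmostPeriodic fun s => c.group (-s) V := by
  have h : ∀ f : ℝ → H, AlmostPeriodic f → AlmostPeriodic fun s => f (-s) := by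
    intro f hf
    induction hf with
    | wave θ α x => simpa using AlmostPeriodic.wave (-θ) α x
    | add _ _ hf hg => exact hf.add hg
    | lim g _ h ih =>
      exact .lim _ ih (h.comp Neg.neg)
  exact h _ (c.almostPeriodic_group V)

/-- Conjugating a bounded operator by the group gives almost periodic orbits. -/
theorem almostPeriodic_conj (A : H →L[ℝ] H) (V : H) :
    AlmostPeriodic fun s => c.group (-s) (A (c.group s V)) := by
  refine .of_approx fun ε hε => ?_
  -- The group being isometric, truncating `V` changes the orbit by at most `‖A‖` times the
  -- truncation error, uniformly in `s`. The `+ 1` avoids division by zero when `A = 0`.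
  obtain ⟨S, hS⟩ := c.exists_norm_sub_trunc_le V (ε := ε / (‖A‖ + 1)) (by positivity)
  refine ⟨fun s => c.group (-s) (A (c.group s (c.trunc S V))), ?_, fun s => ?_⟩
  · simp_rw [c.trunc_eq_sum S, map_sum]
    refine .sum fun a _ => ?_
    obtain ⟨W, hW⟩ := c.exists_group_trunc_singleton a V
    simp_rw [hW, map_add, map_smul]
    refine .add ?_ ((c.almostPeriodic_group_neg _).sin_smul _)
    simpa using (c.almostPeriodic_group_neg (A (c.trunc {a} V))).cos_smul (c.freq a) 0
  · rw [← map_sub, c.norm_group, ← map_sub, ← map_sub]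
    refine (A.le_opNorm _).trans ?_
    rw [c.norm_group]
    calc ‖A‖ * ‖V - c.trunc S V‖ ≤ (‖A‖ + 1) * (ε / (‖A‖ + 1)) := by
          gcongr
          linarith
      _ = ε := by field_simp

/-- The resolvent `(1 - L)⁻¹` of the generator. -/
def resolvent : H →L[ℝ] H := c.mult fun a => (1 + Complex.I * c.freq a)⁻¹

theorem one_add_ne_zero (x : ℝ) : (1 + Complex.I * (x : ℂ)) ≠ 0 := by
  intro h
  have := congrArg Complex.re h
  simp at this

theorem z_resolvent (V : H) (a : ι) :
    c.z a (c.resolvent V) = (1 + Complex.I * c.freq a)⁻¹ * c.z a V := by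
  refine c.z_mult ⟨⟨1, fun a => ?_⟩, fun a ha => by simp [ha]⟩ V a
  rw [norm_inv]
  refine inv_le_one_of_one_le₀ ?_
  have := Complex.abs_re_le_norm (1 + Complex.I * c.freq a)
  simpa using this

/-- This is `L R = R - 1`, with `R = (1 - L)⁻¹`. -/
theorem gen_resolvent (V : H) : c.Gen (c.resolvent V) (c.resolvent V - V) := fun a => by
  rw [map_sub, z_resolvent]
  have := one_add_ne_zero (c.freq a)
  field_simp
  ring

theorem Gen.eq_resolvent {c : SpectralCoords H ι} {V V' : H} (h : c.Gen V V') :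
    c.resolvent (V - V') = V := by
  refine c.ext_coord fun a => ?_
  rw [z_resolvent, map_sub, h a]
  have := one_add_ne_zero (c.freq a)
  field_simp
  ring

theorem resolvent_group (t : ℝ) (V : H) :
    c.resolvent (c.group t V) = c.group t (c.resolvent V) :=
  c.ext_coord fun a => by simp only [z_resolvent, z_group]; ring

/-- Both operators are multipliers in the same coordinates. This is what makes the range of
`resolvent ^ k`, later identified with `H^k`, invariant under the group. -/
theorem resolvent_pow_group (k : ℕ) (t : ℝ) (V : H) :
    (c.resolvent ^ k) (c.group t V) = c.group t ((c.resolvent ^ k) V) := by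
  induction k with
  | zero => simp
  | succ k ih => rw [pow_succ', mul_apply_eq_comp, ih, resolvent_group,
      mul_apply_eq_comp]

end SpectralCoords

/-- The eigenspaces of a compact symmetric operator are mutually orthogonal and nothing is
orthogonal to all of them. Collecting a Hilbert basis of each, over all real `μ`, gives a Hilbert
basis of the whole space. -/
theorem exists_hilbertBasis_eigenvectors {E : Type} [NormedAddCommGroup E]
    [InnerProductSpace ℝ E] [CompleteSpace E] (T : E →L[ℝ] E) (hT : IsCompactOperator T)
    (hs : T.IsSymmetric) :
    ∃ (ι : Type) (b : HilbertBasis ι ℝ E) (κ : ι → ℝ), ∀ a, T (b a) = κ a • b a := by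
  let Es : ℝ → Submodule ℝ E := fun μ => Module.End.eigenspace (T : Module.End ℝ E) μ
  have hcl : ∀ μ, IsClosed (Es μ : Set E) := fun μ => by
    have e : (Es μ : Set E) = {x | T x = μ • x} := by
      ext x
      exact Module.End.mem_eigenspace_iff
    rw [e]
    exact isClosed_eq T.continuous (continuous_const_smul μ)
  have : ∀ μ, CompleteSpace (Es μ) := fun μ => (hcl μ).completeSpace_coe
  choose s B hB using fun μ => exists_hilbertBasis ℝ (Es μ)
  let v : (Σ μ, s μ) → E := fun a => (B a.1 a.2 : Es a.1)
  have hv : Orthonormal ℝ v :=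
    (hs.orthogonalFamily_eigenspaces).orthonormal_sigma_orthonormal fun μ => (B μ).orthonormal
  have hsp : (Submodule.span ℝ (Set.range v))ᗮ = ⊥ := by
    rw [Submodule.eq_bot_iff]
    intro x hx
    have h0 : ∀ a, inner ℝ (v a) x = 0 := fun a =>
      (Submodule.mem_orthogonal _ _).1 hx _ (Submodule.subset_span ⟨a, rfl⟩)
    have hx' : x ∈ (⨆ μ, Es μ)ᗮ := by
      rw [← Submodule.iInf_orthogonal, Submodule.mem_iInf]
      intro μ
      rw [Submodule.mem_orthogonal']
      intro y hy
      have h1 := (B μ).hasSum_repr ⟨y, hy⟩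
      have h2 := ((innerSL ℝ x) ∘L (Es μ).subtypeL).hasSum h1
      refine (h2.unique ?_ : inner ℝ x y = 0)
      refine hasSum_zero.congr_fun fun a => ?_
      rw [map_smul]
      have h3 : inner ℝ x (v ⟨μ, a⟩) = 0 := by rw [real_inner_comm]; exact h0 _
      change _ • inner ℝ x (v ⟨μ, a⟩) = 0
      rw [h3, smul_zero]
    rw [ContinuousLinearMap.orthogonalComplement_iSup_eigenspaces_eq_bot hT hs] at hx'
    exact hx'
  refine ⟨_, HilbertBasis.mkOfOrthogonalEqBot hv hsp, fun a => a.1, fun a => ?_⟩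
  rw [HilbertBasis.coe_mkOfOrthogonalEqBot]
  exact Module.End.mem_eigenspace_iff.1 (B a.1 a.2).2

/-! ### Potential fields and the eigenvalue problem for the weighted Laplacian. -/

section Spectral

variable {n : ℕ}

theorem toLp_mem_gradSpace {b : Torus n → ℝ} {hb : Continuous b} {f : L2Scalar n}
    {h : L2Field n} : WithLp.toLp 2 (f, h) ∈ gradSpace b hb ↔
      HasWeakGrad f (fun x => b x • h x) := mem_gradSpace

theorem MeasureTheory.MemLp.continuous_smul {a : Torus n → ℝ} {g : Torus n → Vec n}
    {p : ENNReal} (hg : MemLp g p) (ha : Continuous a) : MemLp (fun x => a x • g x) p :=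
  memLp_field fun i => by simpa using (hg.coord i).continuous_mul ha

theorem exists_norm_fst_le (b : Torus n → ℝ) (hb : Continuous b) :
    ∃ C, ∀ X ∈ gradSpace b hb, ∫ x, X.fst x = 0 → ‖X.fst‖ ≤ C * ‖X.snd‖ := by
  obtain ⟨C, hC⟩ := isCompact_univ.exists_bound_of_continuousOn (f := b) hb.continuousOn
  refine ⟨C, fun X hX h0 => ?_⟩
  have hm : MemLp (fun x => b x • X.snd x) 2 := (Lp.memLp X.snd).continuous_smul hb
  have hg : HasWeakGrad X.fst (hm.toLp _) :=
    (mem_gradSpace.1 hX).congr ae_eq_rfl hm.coeFn_toLp.symm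
  refine (hg.norm_le h0).trans (Lp.norm_le_mul_norm_of_ae_le_mul ?_)
  filter_upwards [hm.coeFn_toLp] with x hx
  rw [hx, norm_smul]
  gcongr
  exact hC x (Set.mem_univ _)

/-- The second components of `gradSpace b`: the fields `h` such that `b h` is a gradient. -/
def potentialFields (b : Torus n → ℝ) (hb : Continuous b) : Submodule ℝ (L2Field n) :=
  (gradSpace b hb).map (WithLp.sndL 2 ℝ (L2Scalar n) (L2Field n)).toLinearMap

theorem mem_potentialFields {b : Torus n → ℝ} {hb : Continuous b} {h : L2Field n} :
    h ∈ potentialFields b hb ↔ ∃ w : L2Scalar n, WithLp.toLp 2 (w, h) ∈ gradSpace b hb := by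
  constructor
  · rintro ⟨X, hX, rfl⟩
    exact ⟨X.fst, hX⟩
  · rintro ⟨w, hw⟩
    exact ⟨_, hw, rfl⟩

/-- A constant may be subtracted from the potential. This provides both the normalization of `Ψ` in
the Helmholtz projection and the one needed for Poincaré. -/
theorem exists_mean_zero_potential {b : Torus n → ℝ} {hb : Continuous b} {w : L2Scalar n}
    {h : L2Field n} (hw : WithLp.toLp 2 (w, h) ∈ gradSpace b hb) :
    ∃ w' : L2Scalar n, WithLp.toLp 2 (w', h) ∈ gradSpace b hb ∧ ∫ x, w' x = 0 := by
  set c := ∫ x, w x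
  have hprob : volume.real (Set.univ : Set (Torus n)) = 1 := by
    simp [measureReal_def, volume_pi, Measure.pi_univ, AddCircle.measure_univ]
  have hm : MemLp (fun x => w x - c) 2 := (Lp.memLp w).sub (memLp_const c)
  refine ⟨hm.toLp _, ?_, ?_⟩
  · rw [toLp_mem_gradSpace] at hw ⊢
    refine HasWeakGrad.congr (f := fun x => w x - c) (fun i η hη => ?_) hm.coeFn_toLp.symm ae_eq_rfl
    have hc := (hη.partialD_smooth i).continuous_fun
    simp only [sub_mul]
    rw [integral_sub (integrable_mul_continuous (Lp.memLp w) hc)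
      (integrable_mul_continuous (memLp_const c) hc), integral_const_mul,
      integral_partialD hη.one_of_smooth, mul_zero, sub_zero, hw i η hη]
  · rw [integral_congr_ae hm.coeFn_toLp, integral_sub ((Lp.memLp w).integrable (by simp))
      (integrable_const c), integral_const, hprob]
    simp [c]

/-- With potentials normalized to mean zero, the Poincaré inequality makes the potentials of a
convergent sequence of fields Cauchy; closedness of the graph then supplies a potential for the
limit. -/
theorem isClosed_potentialFields (b : Torus n → ℝ) (hb : Continuous b) :
    IsClosed (potentialFields b hb : Set (L2Field n)) := by
  obtain ⟨C, hC⟩ := exists_norm_fst_le b hb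
  refine isClosed_of_closure_subset fun h hh => ?_
  obtain ⟨u, hu, hlim⟩ := mem_closure_iff_seq_limit.1 hh
  choose w0 hw0 using fun k => mem_potentialFields.1 (hu k)
  choose w hw hmean using fun k => exists_mean_zero_potential (hw0 k)
  have hle : ∀ k l, ‖w k - w l‖ ≤ C * ‖u k - u l‖ := fun k l => by
    refine hC (WithLp.toLp 2 (w k - w l, u k - u l))
      ((gradSpace b hb).sub_mem (hw k) (hw l)) ?_
    change ∫ x, (w k - w l : L2Scalar n) x = 0
    rw [integral_congr_ae (Lp.coeFn_sub (w k) (w l))]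
    simp only [Pi.sub_apply]
    rw [integral_sub ((Lp.memLp _).integrable (by simp)) ((Lp.memLp _).integrable (by simp)),
      hmean, hmean, sub_zero]
  have hcau : CauchySeq w := by
    have hu' := hlim.cauchySeq
    rw [Metric.cauchySeq_iff] at hu' ⊢
    intro ε hε
    obtain ⟨N, hN⟩ := hu' (ε / (|C| + 1)) (by positivity)
    refine ⟨N, fun k hk l hl => ?_⟩
    have h1 := hN k hk l hl
    rw [dist_eq_norm, lt_div_iff₀ (by positivity)] at h1
    rw [dist_eq_norm]
    refine (hle k l).trans_lt (lt_of_le_of_lt ?_ h1)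
    rw [mul_comm]
    gcongr
    linarith [le_abs_self C]
  obtain ⟨w', hw'⟩ := cauchySeq_tendsto_of_complete hcau
  refine mem_potentialFields.2 ⟨w', (isClosed_gradSpace b hb).mem_of_tendsto
    (b := atTop) (f := fun k => WithLp.toLp 2 (w k, u k)) ?_ (.of_forall hw)⟩
  exact ((WithLp.prod_continuous_toLp 2 _ _).tendsto _).comp (hw'.prodMk_nhds hlim)

instance completeSpace_potentialFields (b : Torus n → ℝ) (hb : Continuous b) :
    CompleteSpace (potentialFields b hb) :=
  (isClosed_potentialFields b hb).completeSpace_coe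

/-- A function with its gradient as an element of `gradSpace`. -/
theorem TorusContDiff.exists_mem_gradSpace {b b' : Torus n → ℝ} (hb : Continuous b)
    (hb' : Continuous b') (hbb : ∀ x, b x * b' x = 1) {η : Torus n → ℝ} (hη : TorusContDiff 1 η) :
    WithLp.toLp 2 ((hη.memLp 2).toLp η,
      ((MemLp.torusGrad hη 2).continuous_smul hb').toLp (fun x => b' x • torusGrad η x)) ∈
        gradSpace b hb := by
  rw [toLp_mem_gradSpace]
  refine hη.hasWeakGrad.congr (MemLp.coeFn_toLp _).symm ?_
  filter_upwards [((MemLp.torusGrad hη 2).continuous_smul hb').coeFn_toLp] with x hx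
  rw [hx, smul_smul, hbb, one_smul]

theorem eq_zero_of_forall_smooth_inner {f : L2Scalar n}
    (h : ∀ η : Torus n → ℝ, TorusContDiff ∞ η → ∫ x, f x * η x = 0) : f = 0 := by
  have h0 : ∀ m, fcoef f m = 0 := fun m => by
    have h1 := h _ (trig_smooth (fcoef f m) m)
    rw [integral_mul_trig ((Lp.memLp f).integrable (by simp)), Complex.mul_conj,
      Complex.ofReal_re] at h1
    exact Complex.normSq_eq_zero.1 h1
  have h2 := L2Scalar.hasSum_sq_fcoef f
  simp only [h0, norm_zero, ne_eq, OfNat.ofNat_ne_zero, not_false_eq_true, zero_pow] at h2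
  have h3 := h2.unique hasSum_zero
  simpa using h3

/-- An orthonormal basis `ψ` of `L²` of eigenfunctions of the operator `φ ↦ -div (b⁻² ∇ φ)`, with
eigenvalues `w ^ 2`; the fields `e` are their gradients divided by `b`. -/
structure WaveBasis (b : Torus n → ℝ) (hb : Continuous b) where
  /-- The index set. -/
  ι : Type
  /-- The eigenfunctions. -/
  ψ : HilbertBasis ι ℝ (L2Scalar n)
  /-- Their rescaled gradients. -/
  e : ι → L2Field n
  /-- The frequencies. -/
  w : ι → ℝ
  ne_zero : ∀ x, b x ≠ 0
  mem : ∀ a, WithLp.toLp 2 (ψ a, e a) ∈ gradSpace b hb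
  inner_e : ∀ a, ∀ Y ∈ gradSpace b hb, inner ℝ (e a) Y.snd = w a ^ 2 * inner ℝ (ψ a) Y.fst

/-- With `T φ = b⁻¹ ∇ φ` and `p` the projection of its graph to the first factor, `p p* = (1 + T*
T)⁻¹` is compact and symmetric. An eigenvalue `κ` of it corresponds to the eigenvalue `κ⁻¹ - 1` of
`T* T`, which is `w ^ 2`. -/
theorem nonempty_waveBasis {b b' : Torus n → ℝ} (hb : Continuous b) (hb' : Continuous b')
    (hbb : ∀ x, b x * b' x = 1) : Nonempty (WaveBasis b hb) := by
  let p := gradSpaceFst b hb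
  let q := ContinuousLinearMap.adjoint p
  have hpq : ∀ f Y, inner ℝ (q f) Y = inner ℝ f (p Y) := fun f Y =>
    ContinuousLinearMap.adjoint_inner_left p Y f
  have hcomp : IsCompactOperator (p ∘L q) := (isCompactOperator_gradSpaceFst b hb).comp_clm q
  have hsymm : (p ∘L q).IsSymmetric := fun f g => by
    change inner ℝ (p (q f)) g = inner ℝ f (p (q g))
    rw [← hpq, real_inner_comm, ← hpq, real_inner_comm]
  obtain ⟨ι, ψ, κ, hκ⟩ := exists_hilbertBasis_eigenvectors (p ∘L q) hcomp hsymm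
  have hκ' : ∀ a, p (q (ψ a)) = κ a • ψ a := hκ
  have hκq : ∀ a, κ a = ‖q (ψ a)‖ ^ 2 := fun a => by
    rw [← real_inner_self_eq_norm_sq, hpq, hκ', real_inner_smul_right,
      real_inner_self_eq_norm_sq, ψ.orthonormal.1 a]
    simp
  have hκ0 : ∀ a, 0 < κ a := fun a => by
    rw [hκq]
    -- A kernel vector of `p*` is orthogonal to the range of `p`, which contains all smooth
    -- functions; so it vanishes.
    have hne : q (ψ a) ≠ 0 := fun h0 => by
      have h1 : ψ a = 0 := eq_zero_of_forall_smooth_inner fun η hη => by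
        have h2 := hpq (ψ a) ⟨_, hη.one_of_smooth.exists_mem_gradSpace hb hb' hbb⟩
        rw [h0, inner_zero_left] at h2
        have h3 : inner ℝ (ψ a) ((hη.one_of_smooth.memLp 2).toLp η) = 0 := h2.symm
        rw [L2Scalar.inner_eq] at h3
        rw [← h3]
        refine integral_congr_ae ?_
        filter_upwards [(hη.one_of_smooth.memLp 2).coeFn_toLp] with x hx
        rw [hx]
      exact ψ.orthonormal.ne_zero a h1
    positivity
  let e : ι → L2Field n := fun a => (κ a)⁻¹ • (q (ψ a)).1.snd
  have hfst : ∀ a, (q (ψ a)).1.fst = κ a • ψ a := hκ'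
  have hmem : ∀ a, WithLp.toLp 2 (ψ a, e a) ∈ gradSpace b hb := fun a => by
    have h1 := (gradSpace b hb).smul_mem (κ a)⁻¹ (q (ψ a)).2
    have h2 : WithLp.toLp 2 (ψ a, e a) = (κ a)⁻¹ • (q (ψ a)).1 := by
      refine WithLp.ofLp_injective 2 (Prod.ext ?_ rfl)
      change ψ a = (κ a)⁻¹ • (q (ψ a)).1.fst
      rw [hfst, smul_smul, inv_mul_cancel₀ (hκ0 a).ne', one_smul]
    rwa [h2]
  have hin : ∀ a, ∀ Y ∈ gradSpace b hb,
      inner ℝ (e a) Y.snd = ((κ a)⁻¹ - 1) * inner ℝ (ψ a) Y.fst := fun a Y hY => by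
    have h1 := hpq (ψ a) ⟨Y, hY⟩
    change inner ℝ (q (ψ a)).1 Y = inner ℝ (ψ a) Y.fst at h1
    rw [WithLp.prod_inner_apply] at h1
    change inner ℝ (q (ψ a)).1.fst Y.fst + inner ℝ (q (ψ a)).1.snd Y.snd = _ at h1
    rw [hfst, real_inner_smul_left] at h1
    have h2 : inner ℝ (q (ψ a)).1.snd Y.snd = (1 - κ a) * inner ℝ (ψ a) Y.fst := by linarith
    rw [real_inner_smul_left, h2]
    have := (hκ0 a).ne'
    field_simp
  -- Taking `Y = (ψ, e)` shows that `κ⁻¹ - 1 = ‖e‖²`, so its square root is a legitimate frequency.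
  have hμ : ∀ a, 0 ≤ (κ a)⁻¹ - 1 := fun a => by
    have h1 := hin a _ (hmem a)
    change inner ℝ (e a) (e a) = ((κ a)⁻¹ - 1) * inner ℝ (ψ a) (ψ a) at h1
    rw [real_inner_self_eq_norm_sq, real_inner_self_eq_norm_sq, ψ.orthonormal.1 a] at h1
    nlinarith [sq_nonneg ‖e a‖]
  exact ⟨⟨ι, ψ, e, fun a => √((κ a)⁻¹ - 1),
    fun x => left_ne_zero_of_mul_eq_one (hbb x), hmem, fun a Y hY => by
    rw [Real.sq_sqrt (hμ a), hin a Y hY]⟩⟩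

end Spectral

/-! ### The basis of potential fields built from the eigenfunctions. -/

namespace WaveBasis

variable {n : ℕ} {b : Torus n → ℝ} {hb : Continuous b} (B : WaveBasis b hb)

/-- The normalized fields `e / w`. -/
def f (a : B.ι) : L2Field n := (B.w a)⁻¹ • B.e a

theorem norm_sq_e (a : B.ι) : ‖B.e a‖ ^ 2 = B.w a ^ 2 := by
  have h := B.inner_e a _ (B.mem a)
  change inner ℝ (B.e a) (B.e a) = B.w a ^ 2 * inner ℝ (B.ψ a) (B.ψ a) at h
  rw [real_inner_self_eq_norm_sq, real_inner_self_eq_norm_sq, B.ψ.orthonormal.1 a] at h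
  linarith

theorem e_eq (a : B.ι) : B.e a = B.w a • B.f a := by
  by_cases h : B.w a = 0
  · have h1 := B.norm_sq_e a
    rw [h] at h1
    have h2 : B.e a = 0 := by simpa using h1
    rw [h2, h, zero_smul]
  · rw [f, smul_smul, mul_inv_cancel₀ h, one_smul]

/-- A consequence of the convention `0⁻¹ = 0`. Zero-frequency indices contribute no field component,
so sums over nonzero frequencies may be taken over all indices, and the corresponding complex
coordinates are real. -/
theorem f_eq_zero {a : B.ι} (h : B.w a = 0) : B.f a = 0 := by
  rw [f, h, inv_zero, zero_smul]

theorem inner_f (a : B.ι) {Y : L2State n} (hY : Y ∈ gradSpace b hb) :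
    inner ℝ (B.f a) Y.snd = B.w a * inner ℝ (B.ψ a) Y.fst := by
  rw [f, real_inner_smul_left, B.inner_e a Y hY]
  by_cases h : B.w a = 0
  · simp [h]
  · field_simp

theorem f_mem (a : B.ι) : B.f a ∈ potentialFields b hb :=
  (potentialFields b hb).smul_mem _ (mem_potentialFields.2 ⟨_, B.mem a⟩)

/-- Such a `v` is a limit of combinations of the `ψ a` with `w a = 0`, whose fields `e a` vanish;
the graph is closed. -/
theorem mem_gradSpace_zero {v : L2Scalar n} (hv : ∀ a, B.w a ≠ 0 → inner ℝ (B.ψ a) v = 0) :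
    WithLp.toLp 2 (v, (0 : L2Field n)) ∈ gradSpace b hb := by
  have h1 := B.ψ.hasSum_repr v
  have h2 : Tendsto (fun S : Finset B.ι => WithLp.toLp 2 (∑ a ∈ S, B.ψ.repr v a • B.ψ a,
      (0 : L2Field n))) atTop (𝓝 (WithLp.toLp 2 (v, (0 : L2Field n)))) :=
    ((WithLp.prod_continuous_toLp 2 _ _).tendsto _).comp (h1.prodMk_nhds tendsto_const_nhds)
  refine (isClosed_gradSpace b hb).mem_of_tendsto h2 (.of_forall fun S => ?_)
  have h3 : WithLp.toLp 2 (∑ a ∈ S, B.ψ.repr v a • B.ψ a, (0 : L2Field n)) =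
      ∑ a ∈ S, B.ψ.repr v a • WithLp.toLp 2 (B.ψ a, B.e a) := by
    refine WithLp.ofLp_injective 2 (Prod.ext ?_ ?_)
    · change _ = (WithLp.fstL 2 ℝ (L2Scalar n) (L2Field n)) _
      rw [map_sum]
      rfl
    · change _ = (WithLp.sndL 2 ℝ (L2Scalar n) (L2Field n)) _
      rw [map_sum]
      refine (Finset.sum_eq_zero fun a _ => ?_).symm
      change B.ψ.repr v a • B.e a = 0
      by_cases h : B.w a = 0
      · rw [B.e_eq, h, zero_smul, smul_zero]
      · rw [HilbertBasis.repr_apply_apply, hv a h, zero_smul]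
  rw [h3]
  exact Submodule.sum_mem _ fun a _ => Submodule.smul_mem _ _ (B.mem a)

theorem orthonormal_f : Orthonormal ℝ fun a : {a // B.w a ≠ 0} => B.f a := by
  classical
  rw [orthonormal_iff_ite]
  intro a a'
  have h := B.inner_f a.1 (B.mem a'.1)
  change inner ℝ (B.f a) (B.e a') = _ * inner ℝ (B.ψ a) (B.ψ a') at h
  rw [B.e_eq, real_inner_smul_right, orthonormal_iff_ite.1 B.ψ.orthonormal] at h
  have h0 := a.2
  have h0' := a'.2
  by_cases haa : a = a'
  · subst haa
    rw [if_pos rfl] at h ⊢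
    exact mul_left_cancel₀ h0 (by linarith)
  · rw [if_neg (fun h => haa (Subtype.ext h)), mul_zero] at h
    rw [if_neg haa]
    exact (mul_eq_zero.1 h).resolve_left h0'

theorem eq_zero_of_mem (B : WaveBasis b hb) {h : L2Field n}
    (hh : WithLp.toLp 2 ((0 : L2Scalar n), h) ∈ gradSpace b hb) : h = 0 := by
  rw [toLp_mem_gradSpace] at hh
  have h1 := hh.unique (Lp.memLp 0) ((Lp.memLp h).continuous_smul hb) (Lp.memLp 0)
    HasWeakGrad.zero
  apply Lp.ext
  filter_upwards [h1, Lp.coeFn_zero (Vec n) 2 (volume : Measure (Torus n))] with x hx hx0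
  rw [hx0, Pi.zero_apply] at hx
  rw [hx0, Pi.zero_apply]
  exact (smul_eq_zero.1 hx).resolve_left (B.ne_zero x)

/-- Orthogonality of `h` to all `f a` forces its potential into the zero-frequency part, where the
gradient is zero. This is the completeness of the `f a` among potential fields. -/
theorem eq_zero_of_inner_f {h : L2Field n} (hh : h ∈ potentialFields b hb)
    (h0 : ∀ a, B.w a ≠ 0 → inner ℝ (B.f a) h = 0) : h = 0 := by
  obtain ⟨v, hv⟩ := mem_potentialFields.1 hh
  have h1 : WithLp.toLp 2 (v, (0 : L2Field n)) ∈ gradSpace b hb :=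
    B.mem_gradSpace_zero fun a ha => by
      have h2 := B.inner_f a hv
      change inner ℝ (B.f a) h = B.w a * inner ℝ (B.ψ a) v at h2
      rw [h0 a ha] at h2
      exact (mul_eq_zero.1 h2.symm).resolve_left ha
  refine B.eq_zero_of_mem ?_
  have h3 := (gradSpace b hb).sub_mem hv h1
  have h4 : WithLp.toLp 2 (v, h) - WithLp.toLp 2 (v, (0 : L2Field n)) =
      WithLp.toLp 2 ((0 : L2Scalar n), h) :=
    WithLp.ofLp_injective 2 (Prod.ext (sub_self v) (sub_zero h))
  rwa [h4] at h3

/-- The normalized gradients of the eigenfunctions form a basis of the potential fields. -/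
def fieldBasis : HilbertBasis {a // B.w a ≠ 0} ℝ (potentialFields b hb) :=
  HilbertBasis.mkOfOrthogonalEqBot (v := fun a => (⟨B.f a, B.f_mem a⟩ : potentialFields b hb))
    (by
      classical
      have h := B.orthonormal_f
      rw [orthonormal_iff_ite] at h ⊢
      exact fun a a' => (Submodule.coe_inner _ _ _).trans ((h a a').trans (by congr)))
    (by
      rw [Submodule.eq_bot_iff]
      rintro ⟨h, hh⟩ hx
      exact Subtype.ext (B.eq_zero_of_inner_f hh fun a ha =>
        (Submodule.mem_orthogonal _ _).1 hx _ (Submodule.subset_span ⟨⟨a, ha⟩, rfl⟩)))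

theorem coe_fieldBasis (a : {a // B.w a ≠ 0}) : (B.fieldBasis a : L2Field n) = B.f a := by
  rw [fieldBasis, HilbertBasis.coe_mkOfOrthogonalEqBot]

theorem hasSum_inner_f {h k : L2Field n} (hh : h ∈ potentialFields b hb)
    (hk : k ∈ potentialFields b hb) :
    HasSum (fun a => inner ℝ (B.f a) h * inner ℝ (B.f a) k) (inner ℝ h k) := by
  have h1 := B.fieldBasis.hasSum_inner_mul_inner ⟨h, hh⟩ ⟨k, hk⟩
  have h2 : HasSum ((fun a => inner ℝ (B.f a) h * inner ℝ (B.f a) k) ∘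
      ((↑) : {a // B.w a ≠ 0} → B.ι)) (inner ℝ h k) := by
    refine h1.congr_fun fun a => ?_
    change _ = inner ℝ h (B.fieldBasis a : L2Field n) * inner ℝ (B.fieldBasis a : L2Field n) k
    rw [coe_fieldBasis, real_inner_comm]
    rfl
  refine (hasSum_subtype_iff_of_support_subset fun a ha => ?_).1 h2
  intro h0
  rw [Function.mem_support, B.f_eq_zero h0] at ha
  simp at ha

theorem exists_inner_f (y : B.ι → ℝ) (hy : Summable fun a => y a ^ 2)
    (h0 : ∀ a, B.w a = 0 → y a = 0) :
    ∃ h ∈ potentialFields b hb, ∀ a, inner ℝ (B.f a) h = y a := by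
  have hmem : Memℓp (fun a : {a // B.w a ≠ 0} => y a) 2 :=
    memℓp_gen ((hy.comp_injective Subtype.val_injective).congr fun a => by simp)
  refine ⟨(B.fieldBasis.repr.symm ⟨_, hmem⟩ : potentialFields b hb), Subtype.coe_prop _,
    fun a => ?_⟩
  by_cases ha : B.w a = 0
  · rw [B.f_eq_zero ha, inner_zero_left, h0 a ha]
  · have h1 := B.fieldBasis.repr_apply_apply (B.fieldBasis.repr.symm ⟨_, hmem⟩) ⟨a, ha⟩
    rw [LinearIsometryEquiv.apply_symm_apply] at h1
    change y a = inner ℝ (B.fieldBasis ⟨a, ha⟩ : L2Field n) _ at h1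
    rw [coe_fieldBasis] at h1
    exact h1.symm

end WaveBasis

/-! ### The wave operator in spectral coordinates. -/

section Acoustic

variable {n : ℕ} {ρ₀ : Torus n → ℝ}

/-- The weight `ρ₀^{-1/2}`. -/
def invSqrt (ρ₀ : Torus n → ℝ) (x : Torus n) : ℝ := (√(ρ₀ x))⁻¹

theorem invSqrt_mul_sqrt (hpos : ∀ x, 0 < ρ₀ x) (x : Torus n) : invSqrt ρ₀ x * √(ρ₀ x) = 1 :=
  inv_mul_cancel₀ (Real.sqrt_pos.2 (hpos x)).ne'

theorem continuous_invSqrt (hc : Continuous ρ₀) (hpos : ∀ x, 0 < ρ₀ x) :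
    Continuous (invSqrt ρ₀) :=
  hc.sqrt.inv₀ fun x => (Real.sqrt_pos.2 (hpos x)).ne'

theorem continuous_of_invSqrt (hb : Continuous (invSqrt ρ₀)) (hpos : ∀ x, 0 < ρ₀ x) :
    Continuous fun x => √(ρ₀ x) := by
  have h := hb.inv₀ fun x => left_ne_zero_of_mul_eq_one (invSqrt_mul_sqrt hpos x)
  exact h.congr fun x => inv_inv _

theorem mem_acousticSpace_iff (hpos : ∀ x, 0 < ρ₀ x) (hb : Continuous (invSqrt ρ₀))
    {V : L2State n} : V ∈ acousticSpace ρ₀ ↔ V.snd ∈ potentialFields (invSqrt ρ₀) hb := by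
  rw [mem_potentialFields]
  refine exists_congr fun w => ?_
  rw [toLp_mem_gradSpace]
  constructor
  · rintro ⟨g, hg, he⟩
    refine hg.congr ae_eq_rfl ?_
    filter_upwards [he] with x hx
    rw [hx, smul_smul, invSqrt_mul_sqrt hpos, one_smul]
  · intro h
    have hm := (Lp.memLp V.snd).continuous_smul hb
    refine ⟨hm.toLp _, h.congr ae_eq_rfl hm.coeFn_toLp.symm, ?_⟩
    filter_upwards [hm.coeFn_toLp] with x hx
    rw [hx, smul_smul, mul_comm, invSqrt_mul_sqrt hpos, one_smul]

theorem completeSpace_acousticSpace (hpos : ∀ x, 0 < ρ₀ x) (hb : Continuous (invSqrt ρ₀)) :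
    CompleteSpace (acousticSpace ρ₀) := by
  have h : IsClosed (acousticSpace ρ₀ : Set (L2State n)) := by
    have e : (acousticSpace ρ₀ : Set (L2State n)) =
        (WithLp.sndL 2 ℝ (L2Scalar n) (L2Field n)) ⁻¹' potentialFields (invSqrt ρ₀) hb := by
      ext V
      exact mem_acousticSpace_iff hpos hb
    rw [e]
    exact (isClosed_potentialFields _ hb).preimage (ContinuousLinearMap.continuous _)
  exact h.completeSpace_coe

/-- Rewrites both components of `L` through the graph of `T = √ρ₀ ∇`: the first becomes the adjoint
relation of `V'.fst` to `V.snd`, tested on the whole graph instead of smooth functions; the second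
says that `-V'.snd` is `T` of `V.fst`. -/
theorem isWaveOp_iff (hpos : ∀ x, 0 < ρ₀ x) (hb : Continuous (invSqrt ρ₀))
    {V V' : acousticSpace ρ₀} : IsWaveOp ρ₀ V V' ↔
      (∀ Y ∈ gradSpace (invSqrt ρ₀) hb, inner ℝ V'.1.fst Y.fst = inner ℝ V.1.snd Y.snd) ∧
        WithLp.toLp 2 (V.1.fst, -V'.1.snd) ∈ gradSpace (invSqrt ρ₀) hb := by
  have hb' := continuous_of_invSqrt hb hpos
  refine and_congr ⟨fun h Y hY => ?_, fun h η hη => ?_⟩ ?_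
  · have hp := (Lp.memLp V.1.snd).continuous_smul hb'
    have h1 := integral_eq_of_forall_smooth (Lp.memLp V'.1.fst) hp
      (fun η hη => by simpa only [real_inner_smul_left] using h η hη) (Lp.memLp Y.fst)
      ((Lp.memLp Y.snd).continuous_smul hb) (mem_gradSpace.1 hY)
    rw [L2Scalar.inner_eq, L2Field.inner_eq, h1]
    refine integral_congr_ae (.of_forall fun x => ?_)
    simp only [real_inner_smul_left, real_inner_smul_right]
    rw [← mul_assoc, invSqrt_mul_sqrt hpos, one_mul]
  · have h1 := h _ (hη.one_of_smooth.exists_mem_gradSpace hb hb' (invSqrt_mul_sqrt hpos))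
    change inner ℝ V'.1.fst ((hη.one_of_smooth.memLp 2).toLp η) =
      inner ℝ V.1.snd (((MemLp.torusGrad hη.one_of_smooth 2).continuous_smul hb').toLp _) at h1
    rw [L2Scalar.inner_eq, L2Field.inner_eq] at h1
    have e1 : ∫ x, V'.1.fst x * ((hη.one_of_smooth.memLp 2).toLp η) x =
        ∫ x, V'.1.fst x * η x := by
      refine integral_congr_ae ?_
      filter_upwards [(hη.one_of_smooth.memLp 2).coeFn_toLp] with x hx
      rw [hx]
    rw [← e1, h1]
    refine integral_congr_ae ?_
    filter_upwards [((MemLp.torusGrad hη.one_of_smooth 2).continuous_smul hb').coeFn_toLp]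
      with x hx
    rw [hx, real_inner_smul_right]
  · rw [toLp_mem_gradSpace]
    constructor
    · rintro ⟨g, hg, he⟩
      refine hg.congr ae_eq_rfl ?_
      filter_upwards [he, Lp.coeFn_neg V'.1.snd] with x hx hn
      rw [hn, Pi.neg_apply, hx, neg_neg, smul_smul, invSqrt_mul_sqrt hpos, one_smul]
    · intro h
      have hm := (Lp.memLp (-V'.1.snd)).continuous_smul hb
      refine ⟨hm.toLp _, h.congr ae_eq_rfl hm.coeFn_toLp.symm, ?_⟩
      filter_upwards [hm.coeFn_toLp, Lp.coeFn_neg V'.1.snd] with x hx hn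
      rw [hx, hn, Pi.neg_apply, smul_smul, mul_comm, invSqrt_mul_sqrt hpos, one_smul, neg_neg]

namespace WaveBasis

variable {hb : Continuous (invSqrt ρ₀)} (B : WaveBasis (invSqrt ρ₀) hb)

/-- The complex coordinate combining the components along `(ψ, 0)` and `(0, f)`. -/
def coord (a : B.ι) : acousticSpace ρ₀ →L[ℝ] ℂ :=
  Complex.equivRealProdCLM.symm.toContinuousLinearMap ∘L
    ((innerSL ℝ (B.ψ a) ∘L WithLp.fstL 2 ℝ (L2Scalar n) (L2Field n)).prod
      (innerSL ℝ (B.f a) ∘L WithLp.sndL 2 ℝ (L2Scalar n) (L2Field n))) ∘L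
    (acousticSpace ρ₀).subtypeL

theorem coord_apply (a : B.ι) (V : acousticSpace ρ₀) :
    B.coord a V = ⟨inner ℝ (B.ψ a) V.1.fst, inner ℝ (B.f a) V.1.snd⟩ := rfl

/-- The spectral coordinates of the wave operator. -/
def coords (hpos : ∀ x, 0 < ρ₀ x) : SpectralCoords (acousticSpace ρ₀) B.ι where
  freq := B.w
  z := B.coord
  hasSum_sq V := by
    have h1 := B.ψ.hasSum_inner_mul_inner V.1.fst V.1.fst
    have hV := (mem_acousticSpace_iff hpos hb).1 V.2
    have h2 := h1.add (B.hasSum_inner_f hV hV)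
    rw [real_inner_self_eq_norm_sq, real_inner_self_eq_norm_sq,
      ← WithLp.prod_norm_sq_eq_of_L2] at h2
    refine h2.congr_fun fun a => ?_
    rw [coord_apply, ← Complex.normSq_eq_norm_sq, Complex.normSq_mk, real_inner_comm]
  im_eq_zero a ha V := by
    rw [coord_apply, B.f_eq_zero ha, inner_zero_left]
  exists_coord y hy h0 := by
    have hre : Summable fun a => (y a).re ^ 2 :=
      .of_nonneg_of_le (fun _ => sq_nonneg _) (fun a => by
        rw [← Complex.normSq_eq_norm_sq, Complex.normSq_apply]
        nlinarith [mul_self_nonneg (y a).im]) hy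
    have him : Summable fun a => (y a).im ^ 2 :=
      .of_nonneg_of_le (fun _ => sq_nonneg _) (fun a => by
        rw [← Complex.normSq_eq_norm_sq, Complex.normSq_apply]
        nlinarith [mul_self_nonneg (y a).re]) hy
    have hmem : Memℓp (fun a => (y a).re) 2 := memℓp_gen (by simpa using hre)
    obtain ⟨h, hh, hy'⟩ := B.exists_inner_f (fun a => (y a).im) him h0
    refine ⟨⟨WithLp.toLp 2 (B.ψ.repr.symm ⟨_, hmem⟩, h),
      (mem_acousticSpace_iff hpos hb).2 hh⟩, fun a => ?_⟩
    rw [coord_apply]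
    refine Complex.ext ?_ (hy' a)
    change inner ℝ (B.ψ a) (B.ψ.repr.symm ⟨_, hmem⟩) = _
    rw [← B.ψ.repr_apply_apply, LinearIsometryEquiv.apply_symm_apply]

theorem gen_iff (hpos : ∀ x, 0 < ρ₀ x) {V V' : acousticSpace ρ₀} :
    (B.coords hpos).Gen V V' ↔ ∀ a,
      inner ℝ (B.ψ a) V'.1.fst = B.w a * inner ℝ (B.f a) V.1.snd ∧
        inner ℝ (B.f a) V'.1.snd = -(B.w a * inner ℝ (B.ψ a) V.1.fst) := by
  refine forall_congr' fun a => ?_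
  change B.coord a V' = -(Complex.I * B.w a) * B.coord a V ↔ _
  rw [coord_apply, coord_apply, Complex.ext_iff]
  simp

/-- Pairing the weak equations with the basis gives the coordinate relations. Conversely, Parseval
reassembles the adjoint relation from its coordinates; for the gradient relation one compares
`-V.1.fst` with a potential of `V'.snd`. -/
theorem isWaveOp_iff_gen (hpos : ∀ x, 0 < ρ₀ x) {V V' : acousticSpace ρ₀} :
    IsWaveOp ρ₀ V V' ↔ (B.coords hpos).Gen V V' := by
  rw [isWaveOp_iff hpos hb, B.gen_iff hpos]
  have hV := (mem_acousticSpace_iff hpos hb).1 V.2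
  have hV' := (mem_acousticSpace_iff hpos hb).1 V'.2
  constructor
  · rintro ⟨h1, h2⟩ a
    constructor
    · have h3 := h1 _ (B.mem a)
      change inner ℝ V'.1.fst (B.ψ a) = inner ℝ V.1.snd (B.e a) at h3
      rw [real_inner_comm, h3, B.e_eq, real_inner_smul_right, real_inner_comm]
    · have h3 := B.inner_f a h2
      change inner ℝ (B.f a) (-V'.1.snd) = B.w a * inner ℝ (B.ψ a) V.1.fst at h3
      rw [inner_neg_right] at h3
      linarith
  · intro h
    constructor
    · intro Y hY
      have h1 := B.ψ.hasSum_inner_mul_inner V'.1.fst Y.fst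
      have hk : Y.snd ∈ potentialFields (invSqrt ρ₀) hb := mem_potentialFields.2 ⟨Y.fst, hY⟩
      have h2 := B.hasSum_inner_f hV hk
      refine h1.unique (h2.congr_fun fun a => ?_)
      rw [B.inner_f a hY, real_inner_comm, (h a).1]
      ring
    · obtain ⟨v, hv⟩ := mem_potentialFields.1 hV'
      -- The potential `v` of `V'.snd` agrees with `-V.1.fst` at all nonzero frequencies, so their
      -- difference has zero gradient.
      have h1 : WithLp.toLp 2 (v + V.1.fst, (0 : L2Field n)) ∈ gradSpace (invSqrt ρ₀) hb :=
        B.mem_gradSpace_zero fun a ha => by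
          have h2 := B.inner_f a hv
          change inner ℝ (B.f a) V'.1.snd = B.w a * inner ℝ (B.ψ a) v at h2
          rw [(h a).2] at h2
          rw [inner_add_right]
          refine mul_left_cancel₀ ha ?_
          linarith
      have h3 := (gradSpace (invSqrt ρ₀) hb).sub_mem h1 hv
      have h4 : WithLp.toLp 2 (v + V.1.fst, (0 : L2Field n)) - WithLp.toLp 2 (v, V'.1.snd) =
          WithLp.toLp 2 (V.1.fst, -V'.1.snd) :=
        WithLp.ofLp_injective 2 (Prod.ext (add_sub_cancel_left _ _) (zero_sub _))
      rwa [h4] at h3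

theorem isWaveGroup (hpos : ∀ x, 0 < ρ₀ x) : IsWaveGroup ρ₀ (B.coords hpos).group where
  zero := (B.coords hpos).group_zero
  add := (B.coords hpos).group_add
  continuous := (B.coords hpos).continuous_group
  generator V V' := by rw [B.isWaveOp_iff_gen hpos, SpectralCoords.gen_iff_hasDerivAt]

/-- `waveGroup` is some group satisfying `IsWaveGroup`. The spectral group shows that one exists,
and uniqueness from the generator identifies the choice. -/
theorem waveGroup_eq (hpos : ∀ x, 0 < ρ₀ x) : waveGroup ρ₀ = (B.coords hpos).group := by
  have hex : ∃ U, IsWaveGroup ρ₀ U := ⟨_, B.isWaveGroup hpos⟩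
  rw [waveGroup, dif_pos hex]
  have h := hex.choose_spec
  exact (B.coords hpos).eq_group h.zero h.add fun V V' => by
    rw [← B.isWaveOp_iff_gen hpos, h.generator]

end WaveBasis

end Acoustic

/-! ### Elliptic regularity: `H^k` is the domain of `L^k`. -/

section Regularity

variable {n : ℕ}

theorem StateMemSobolev.sub {k : ℕ} {V W : L2State n} (hV : StateMemSobolev k V)
    (hW : StateMemSobolev k W) : StateMemSobolev k (V - W) := by
  refine ⟨(hV.1.add hW.1.neg).congr ?_, fun i => ((hV.2 i).add (hW.2 i).neg).congr ?_⟩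
  · filter_upwards [Lp.coeFn_sub V.fst W.fst] with x hx
    rw [WithLp.sub_fst, hx, Pi.sub_apply, sub_eq_add_neg]
  · filter_upwards [Lp.coeFn_sub V.snd W.snd] with x hx
    rw [WithLp.sub_snd, hx, Pi.sub_apply, PiLp.sub_apply, sub_eq_add_neg]

theorem stateMemSobolev_zero (V : L2State n) : StateMemSobolev 0 V :=
  ⟨Lp.memLp V.fst, fun i => (Lp.memLp V.snd).coord i⟩

/-- Elliptic regularity: if `-Δ w = q` then `∇ w` has one derivative more than `q`. -/
theorem MemSobolev.of_laplace {k : ℕ} {w q : Torus n → ℝ} {g : Torus n → Vec n}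
    (hw : MemLp w 2) (hg : MemLp g 2) (hwg : HasWeakGrad w g) (hq : MemSobolev k q)
    (h : ∀ ζ : Torus n → ℝ, TorusContDiff ∞ ζ →
      ∫ x, inner ℝ (g x) (torusGrad ζ x) = ∫ x, q x * ζ x) (l : Fin n) :
    MemSobolev (k + 1) (fun x => g x l) := by
  have hgf : ∀ i m, fcoef (fun x => g x i) m = 2 * Real.pi * Complex.I * m i * fcoef w m :=
    fun i => (hasWeakPartial_iff_fcoef hw (hg.coord i)).1 (hwg i)
  have hqf : ∀ m, fcoef q m = ((4 * Real.pi ^ 2 * freqSq m : ℝ) : ℂ) * fcoef w m := by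
    intro m
    -- Testing against monomials turns the equation into multiplication of the coefficients of `w`
    -- by `4 π² |m|²`; as before, the free amplitude `c` recovers the complex identity.
    have key : ∀ c : ℂ, (c * conj (((4 * Real.pi ^ 2 * freqSq m : ℝ) : ℂ) * fcoef w m)).re =
        (c * conj (fcoef q m)).re := by
      intro c
      have h1 := h _ (trig_smooth c m)
      rw [integral_mul_trig (hq.memLp.integrable (by simp)),
        integral_inner_eq_sum hg (.torusGrad (trig_smooth _ _).one_of_smooth 2)] at h1
      rw [← h1, freqSq]
      push_cast
      rw [Finset.mul_sum, Finset.sum_mul, map_sum, Finset.mul_sum, Complex.re_sum]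
      refine Finset.sum_congr rfl fun i _ => ?_
      have h2 : ∫ x, g x i * torusGrad (trig c m) x i =
          ∫ x, g x i * trig (2 * Real.pi * Complex.I * m i * c) m x := by
        rw [← partialD_trig]
        rfl
      rw [h2, integral_mul_trig ((hg.coord i).integrable (by simp)), hgf]
      congr 1
      simp only [map_mul, map_ofNat, map_pow, Complex.conj_ofReal, Complex.conj_I, map_intCast]
      linear_combination (4 * (Real.pi : ℂ) ^ 2 * (m i : ℂ) ^ 2 * c * conj (fcoef w m)) *
        Complex.I_sq
    have h3 := key (fcoef q m - ((4 * Real.pi ^ 2 * freqSq m : ℝ) : ℂ) * fcoef w m)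
    have h4 : ((fcoef q m - ((4 * Real.pi ^ 2 * freqSq m : ℝ) : ℂ) * fcoef w m) *
        conj (fcoef q m - ((4 * Real.pi ^ 2 * freqSq m : ℝ) : ℂ) * fcoef w m)).re = 0 := by
      rw [map_sub, mul_sub, Complex.sub_re, h3, sub_self]
    rw [Complex.mul_conj, Complex.ofReal_re, Complex.normSq_eq_zero] at h4
    exact sub_eq_zero.1 h4
  rw [memSobolev_iff] at hq ⊢
  refine ⟨hg.coord l, .of_nonneg_of_le
    (fun m => mul_nonneg (pow_nonneg (freqSq_nonneg m) _) (sq_nonneg _)) (fun m => ?_) hq.2⟩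
  rw [hgf, norm_sq_deriv_coef, hqf, norm_mul, mul_pow, Complex.norm_real, Real.norm_eq_abs,
    sq_abs]
  have h1 := sq_le_freqSq m l
  have h2 := pow_nonneg (freqSq_nonneg m) (k + 1)
  have h3 := one_le_four_pi_sq
  calc freqSq m ^ (k + 1) * (4 * Real.pi ^ 2 * (m l : ℝ) ^ 2 * ‖fcoef w m‖ ^ 2)
      ≤ freqSq m ^ (k + 1) * (4 * Real.pi ^ 2 * freqSq m * ‖fcoef w m‖ ^ 2) := by gcongr
    _ = 1 * (freqSq m ^ (k + 1) * (4 * Real.pi ^ 2 * freqSq m * ‖fcoef w m‖ ^ 2)) :=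
        (one_mul _).symm
    _ ≤ (4 * Real.pi ^ 2) *
        (freqSq m ^ (k + 1) * (4 * Real.pi ^ 2 * freqSq m * ‖fcoef w m‖ ^ 2)) := by
        gcongr
        exact mul_nonneg h2 (mul_nonneg (mul_nonneg (by positivity) (freqSq_nonneg m))
          (sq_nonneg _))
    _ = freqSq m ^ k * ((4 * Real.pi ^ 2 * freqSq m) ^ 2 * ‖fcoef w m‖ ^ 2) := by ring

variable {ρ₀ : Torus n → ℝ}

theorem TorusContDiff.invSqrt {k : WithTop ℕ∞} (hρ : TorusContDiff k ρ₀) (hpos : ∀ x, 0 < ρ₀ x) :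
    TorusContDiff k (invSqrt ρ₀) :=
  (hρ.sqrt hpos).inv fun x => (Real.sqrt_pos.2 (hpos x)).ne'

/-- The equation `-div (ρ₀ g) = f` in nondivergence form. -/
theorem integral_inner_torusGrad_eq (hρ : TorusContDiff 1 ρ₀) (hpos : ∀ x, 0 < ρ₀ x)
    {f : Torus n → ℝ} {g : Torus n → Vec n} (hf : MemLp f 2) (hg : MemLp g 2)
    (h : ∀ η : Torus n → ℝ, TorusContDiff ∞ η →
      ∫ x, f x * η x = ∫ x, ρ₀ x * inner ℝ (g x) (torusGrad η x))
    {ζ : Torus n → ℝ} (hζ : TorusContDiff ∞ ζ) :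
    ∫ x, inner ℝ (g x) (torusGrad ζ x) =
      ∫ x, ((ρ₀ x)⁻¹ * (f x + ∑ i, partialD i ρ₀ x * g x i)) * ζ x := by
  have hr : TorusContDiff 1 fun x => (ρ₀ x)⁻¹ := hρ.inv fun x => (hpos x).ne'
  -- The test function is `ζ / ρ₀`, which cancels the leading weight and leaves `∇ ρ₀` in a lower
  -- order term. It is only `C¹`, so the equation is first extended to `H¹` test functions.
  have hη : TorusContDiff 1 fun x => (ρ₀ x)⁻¹ * ζ x := hr.mul hζ.one_of_smooth
  have hp : MemLp (fun x => ρ₀ x • g x) 2 := hg.continuous_smul hρ.continuous_fun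
  have h1 := integral_eq_of_forall_smooth hf hp
    (fun η hη => by simpa only [real_inner_smul_left] using h η hη) (hη.memLp 2)
    (.torusGrad hη 2) hη.hasWeakGrad
  have e : ∀ x, inner ℝ (ρ₀ x • g x) (torusGrad (fun x => (ρ₀ x)⁻¹ * ζ x) x) =
      inner ℝ (g x) (torusGrad ζ x) - ∑ i, (ρ₀ x)⁻¹ * (partialD i ρ₀ x * g x i) * ζ x := by
    intro x
    rw [Vec.inner_eq, Vec.inner_eq, ← Finset.sum_sub_distrib]
    refine Finset.sum_congr rfl fun i _ => ?_
    have := (hpos x).ne'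
    simp only [torusGrad, PiLp.smul_apply, smul_eq_mul]
    rw [partialD_mul hr hζ.one_of_smooth, partialD_inv hρ fun x => (hpos x).ne']
    field_simp
    ring
  have i1 : Integrable fun x => inner ℝ (g x) (torusGrad ζ x) := by
    simp_rw [Vec.inner_eq]
    exact integrable_finsetSum _ fun i _ =>
      integrable_mul_continuous (hg.coord i) (hζ.one_of_smooth.continuous_partialD i)
  have i2 : Integrable fun x => ∑ i, (ρ₀ x)⁻¹ * (partialD i ρ₀ x * g x i) * ζ x :=
    integrable_finsetSum _ fun i _ => integrable_mul_continuous
      (((hg.coord i).continuous_mul (hρ.continuous_partialD i)).continuous_mul hr.continuous_fun)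
      hζ.continuous_fun
  simp_rw [e] at h1
  rw [integral_sub i1 i2] at h1
  have i3 : Integrable fun x => f x * ((ρ₀ x)⁻¹ * ζ x) :=
    integrable_mul_continuous hf hη.continuous_fun
  rw [sub_eq_iff_eq_add.1 h1.symm, ← integral_add i3 i2]
  refine integral_congr_ae (.of_forall fun x => ?_)
  simp only [← Finset.sum_mul, ← Finset.mul_sum]
  ring

/-- The relation `∇ φ = -ρ₀^{-1/2} h'` gains a derivative for `φ` directly. For `h = √ρ₀ ∇ w` the
equation `-div (ρ₀ ∇ w) = φ'` is elliptic and its regularity is bootstrapped. -/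
theorem IsWaveOp.stateMemSobolev {k : ℕ} (hρ : TorusContDiff (k + 1 : ℕ) ρ₀)
    (hpos : ∀ x, 0 < ρ₀ x) {V V' : acousticSpace ρ₀} (h : IsWaveOp ρ₀ V V')
    (hV' : StateMemSobolev k V'.1) : StateMemSobolev (k + 1) V.1 := by
  have hρ1 : TorusContDiff 1 ρ₀ := hρ.one_of_nat (by omega)
  obtain ⟨h1, g, hg, he⟩ := h
  constructor
  · refine ⟨Lp.memLp _, fun i => ⟨_, hg i, ?_⟩⟩
    refine (((hV'.2 i).mul_contDiff
      ((hρ.invSqrt hpos).mono (by exact_mod_cast Nat.le_succ k))).neg).congr ?_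
    filter_upwards [he] with x hx
    rw [hx, PiLp.neg_apply, PiLp.smul_apply, smul_eq_mul, mul_neg, neg_neg, ← mul_assoc,
      invSqrt_mul_sqrt hpos, one_mul]
  · obtain ⟨w, p, hwp, hp⟩ := V.2
    have h2 : ∀ η : Torus n → ℝ, TorusContDiff ∞ η →
        ∫ x, V'.1.fst x * η x = ∫ x, ρ₀ x * inner ℝ (p x) (torusGrad η x) := fun η hη => by
      rw [h1 η hη]
      refine integral_congr_ae ?_
      filter_upwards [hp] with x hx
      rw [hx, real_inner_smul_left, ← mul_assoc, Real.mul_self_sqrt (hpos x).le]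
    -- Bootstrap on `-Δ w = ρ₀⁻¹ (φ' + ∇ ρ₀ · ∇ w)`: if `∇ w` is in `H^j` with `j ≤ k`, so is the
    -- right side, and hence `∇ w` is in `H^{j+1}`. Only `j + 1` derivatives of `ρ₀` are used.
    have key : ∀ j ≤ k + 1, ∀ i, MemSobolev j fun x => p x i := by
      intro j
      induction j with
      | zero => exact fun _ i => (Lp.memLp p).coord i
      | succ j ih =>
        intro hj i
        have hρj : TorusContDiff ((j : WithTop ℕ∞) + 1) ρ₀ := hρ.mono (by exact_mod_cast hj)
        refine MemSobolev.of_laplace (Lp.memLp w) (Lp.memLp p) hwp ?_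
          (fun ζ hζ => integral_inner_torusGrad_eq hρ1 hpos (Lp.memLp V'.1.fst) (Lp.memLp p)
            h2 hζ) i
        refine MemSobolev.mul_contDiff ?_ ((hρj.mono (by simp)).inv fun x => (hpos x).ne')
        exact (hV'.1.mono (by omega)).add (.sum fun l _ =>
          (ih (by omega) l).mul_contDiff (hρj.partialD l))
    intro i
    refine ((key _ le_rfl i).mul_contDiff (hρ.sqrt hpos)).congr ?_
    filter_upwards [hp] with x hx
    rw [hx, PiLp.smul_apply, smul_eq_mul]

theorem exists_isWaveOp {k : ℕ} (hρ : TorusContDiff (k + 1 : ℕ) ρ₀)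
    (hpos : ∀ x, 0 < ρ₀ x) {V : acousticSpace ρ₀} (hV : StateMemSobolev (k + 1) V.1) :
    ∃ V', IsWaveOp ρ₀ V V' ∧ StateMemSobolev k V'.1 := by
  have hsq := hρ.sqrt hpos
  have hsqk : TorusContDiff k fun x => √(ρ₀ x) := hsq.mono (by exact_mod_cast Nat.le_succ k)
  choose g hg hgk using hV.1.2
  choose d hd hdk using fun i => ((hV.2 i).mul_contDiff hsq).2 i
  have hgm : MemLp (fun x => (WithLp.toLp 2 fun i => g i x : Vec n)) 2 :=
    memLp_field fun i => (hgk i).memLp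
  have hgw : HasWeakGrad V.1.fst (hgm.toLp _) :=
    HasWeakGrad.congr (g := fun x => WithLp.toLp 2 fun i => g i x) hg ae_eq_rfl
      hgm.coeFn_toLp.symm
  have hsm : MemLp (fun x => √(ρ₀ x) • (-hgm.toLp _ : L2Field n) x) 2 :=
    (Lp.memLp _).continuous_smul hsq.continuous_fun
  have hdm : MemSobolev k fun x => -∑ i, d i x := (MemSobolev.sum fun i _ => hdk i).neg
  refine ⟨⟨WithLp.toLp 2 (hdm.memLp.toLp _, hsm.toLp _), ⟨-V.1.fst, -hgm.toLp _, ?_,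
    hsm.coeFn_toLp⟩⟩, ⟨fun η hη => ?_, hgm.toLp _, hgw, ?_⟩, ?_, fun i => ?_⟩
  · simpa using hgw.smul (-1)
  · have e1 : ∫ x, hdm.memLp.toLp _ x * η x = ∫ x, (-∑ i, d i x) * η x :=
      integral_congr_ae (by
        filter_upwards [hdm.memLp.coeFn_toLp] with x hx
        rw [hx])
    refine e1.trans ?_
    have e2 : ∀ x, √(ρ₀ x) * inner ℝ (V.1.snd x) (torusGrad η x) =
        ∑ i, (√(ρ₀ x) * V.1.snd x i) * partialD i η x := fun x => by
      rw [Vec.inner_eq, Finset.mul_sum]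
      simp only [torusGrad, mul_assoc]
    simp_rw [e2, neg_mul, Finset.sum_mul]
    rw [integral_neg, integral_finsetSum _ fun i _ => integrable_mul_continuous (hdk i).memLp
        hη.continuous_fun, integral_finsetSum _ fun i _ => integrable_mul_continuous
        (((Lp.memLp V.1.snd).coord i).continuous_mul hsq.continuous_fun)
        (hη.one_of_smooth.continuous_partialD i), ← Finset.sum_neg_distrib]
    exact Finset.sum_congr rfl fun i _ => (hd i η hη).symm
  · filter_upwards [hsm.coeFn_toLp, Lp.coeFn_neg (hgm.toLp _)] with x hx hn
    refine hx.trans ?_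
    rw [hn, Pi.neg_apply, smul_neg]
  · exact hdm.congr hdm.memLp.coeFn_toLp.symm
  · refine ((hgk i).mul_contDiff hsqk).neg.congr ?_
    filter_upwards [hsm.coeFn_toLp, Lp.coeFn_neg (hgm.toLp _), hgm.coeFn_toLp] with x hx hn hy
    symm
    refine (congrArg (fun v : Vec n => v i) hx).trans ?_
    rw [hn, Pi.neg_apply, hy, smul_neg]
    rfl

/-- The domain of the `k`-th power of the wave operator is the Sobolev space of order `k`. -/
theorem WaveBasis.mem_range_resolvent_pow_iff {hb : Continuous (invSqrt ρ₀)}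
    (B : WaveBasis (invSqrt ρ₀) hb) (hpos : ∀ x, 0 < ρ₀ x) {k : ℕ} (hρ : TorusContDiff k ρ₀)
    {V : acousticSpace ρ₀} :
    (∃ Y, ((B.coords hpos).resolvent ^ k) Y = V) ↔ StateMemSobolev k V.1 := by
  induction k generalizing V with
  | zero => exact ⟨fun _ => stateMemSobolev_zero _, fun _ => ⟨V, rfl⟩⟩
  | succ k ih =>
    have ih' := fun W => @ih (hρ.mono (by exact_mod_cast Nat.le_succ k)) W
    constructor
    · rintro ⟨Y, rfl⟩
      -- With `W = R^{k+1} Y` one has `L W = W - R^k Y`. Both terms are in `H^k` by induction, so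
      -- elliptic regularity puts `W` in `H^{k+1}`.
      have h0 := (B.coords hpos).gen_resolvent (((B.coords hpos).resolvent ^ k) Y)
      rw [← mul_apply_eq_comp, ← pow_succ'] at h0
      refine IsWaveOp.stateMemSobolev hρ hpos ((B.isWaveOp_iff_gen hpos).2 h0) ?_
      exact ((ih' _).1 ⟨(B.coords hpos).resolvent Y, by rw [pow_succ]; rfl⟩).sub ((ih' _).1 ⟨Y, rfl⟩)
    · intro hV
      obtain ⟨V', h1, h2⟩ := exists_isWaveOp hρ hpos hV
      have hVk : StateMemSobolev k V.1 := ⟨hV.1.mono k.le_succ, fun i => (hV.2 i).mono k.le_succ⟩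
      -- `V - L V` loses one derivative, so it is `R^k Y` by induction; applying `R` returns `V`.
      obtain ⟨Y, hY⟩ := (ih' (V - V')).2 (hVk.sub h2)
      refine ⟨Y, ?_⟩
      rw [pow_succ', mul_apply_eq_comp, hY]
      exact ((B.isWaveOp_iff_gen hpos).1 h1).eq_resolvent

end Regularity

/-! ### Absolutely convergent trigonometric series. -/

section TrigSeries

variable {n : ℕ}

theorem norm_sq_le_freqSq (m : Fin n → ℤ) : ‖fun i => (m i : ℝ)‖ ^ 2 ≤ freqSq m := by
  refine (sq_le_sq₀ (norm_nonneg _) (Real.sqrt_nonneg _)).2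
    ((pi_norm_le_iff_of_nonneg (Real.sqrt_nonneg (freqSq m))).2 fun i => ?_) |>.trans_eq
    (Real.sq_sqrt (freqSq_nonneg m))
  rw [Real.norm_eq_abs]
  exact Real.abs_le_sqrt (sq_le_freqSq m i)

/-- Comparison with the lattice sum of `‖m‖^{-2j}` in the supremum norm, which converges when `2 j`
exceeds the dimension. The term `m = 0` is zero by convention. -/
theorem summable_freqSq_inv_pow {j : ℕ} (hj : n < 2 * j) :
    Summable fun m : Fin n → ℤ => (freqSq m)⁻¹ ^ j := by
  let b := Pi.basisFun ℝ (Fin n)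
  let L := Submodule.span ℤ (Set.range b)
  have hrank : Module.finrank ℤ L = n := by
    rw [ZLattice.rank ℝ L]
    simp
  have hs := ZLattice.summable_norm_pow_inv L (2 * j) (by omega)
  let φ : (Fin n → ℤ) → L := fun m => ⟨fun i => (m i : ℝ), by
    rw [b.mem_span_iff_repr_mem ℤ]
    exact fun i => ⟨m i, by simp [b]⟩⟩
  have hφ : Function.Injective φ := fun m m' h => by
    funext i
    have h1 : (m i : ℝ) = m' i := congrFun (congrArg Subtype.val h) i
    exact_mod_cast h1
  refine .of_nonneg_of_le (fun m => pow_nonneg (inv_nonneg.2 (freqSq_nonneg m)) _) (fun m => ?_)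
    (hs.comp_injective hφ)
  change _ ≤ ‖fun i => (m i : ℝ)‖⁻¹ ^ (2 * j)
  rw [pow_mul]
  by_cases hm : m = 0
  · subst hm
    have : freqSq (0 : Fin n → ℤ) = 0 := by simp [freqSq]
    rw [this, inv_zero, zero_pow (by omega)]
    positivity
  · refine pow_le_pow_left₀ (inv_nonneg.2 (freqSq_nonneg m)) ?_ j
    rw [inv_pow]
    refine inv_anti₀ ?_ (norm_sq_le_freqSq m)
    have : (fun i => (m i : ℝ)) ≠ 0 := fun h => hm (funext fun i => by
      have h1 : (m i : ℝ) = 0 := congrFun h i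
      exact_mod_cast h1)
    positivity

/-- The first derivatives of `H^k` functions have absolutely convergent Fourier series
if `k > n / 2 + 1`. -/
theorem MemSobolev.summable_norm_deriv {k : ℕ} (hk : n + 2 < 2 * k) {f : Torus n → ℝ}
    (hf : MemSobolev k f) (i : Fin n) :
    Summable fun m => ‖2 * Real.pi * Complex.I * m i * fcoef f m‖ := by
  obtain ⟨j, rfl⟩ : ∃ j, k = j + 1 := ⟨k - 1, by omega⟩
  refine .of_nonneg_of_le (fun m => norm_nonneg _) (fun m => ?_)
    (((memSobolev_iff.1 hf).2.mul_left (4 * Real.pi ^ 2)).add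
      (summable_freqSq_inv_pow (n := n) (j := j) (by omega)))
  by_cases hm : m = 0
  · subst hm
    have : freqSq (0 : Fin n → ℤ) = 0 := by simp [freqSq]
    simp only [Pi.zero_apply, Int.cast_zero, mul_zero, zero_mul, norm_zero, this]
    positivity
  · have hX : 1 ≤ freqSq m ^ j := one_le_pow₀ (one_le_freqSq hm)
    have h1 := norm_sq_deriv_coef m i (fcoef f m)
    set a := ‖2 * Real.pi * Complex.I * m i * fcoef f m‖
    have h2 : a ^ 2 * freqSq m ^ j ≤ 4 * Real.pi ^ 2 * (freqSq m ^ (j + 1) * ‖fcoef f m‖ ^ 2) := by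
      have h3 := sq_le_freqSq m i
      rw [h1]
      calc 4 * Real.pi ^ 2 * (m i : ℝ) ^ 2 * ‖fcoef f m‖ ^ 2 * freqSq m ^ j
          ≤ 4 * Real.pi ^ 2 * freqSq m * ‖fcoef f m‖ ^ 2 * freqSq m ^ j := by gcongr
        _ = _ := by ring
    rw [inv_pow]
    set X := freqSq m ^ j
    have hX0 : 0 < X := by linarith
    -- The Young inequality behind the Sobolev embedding: `a` is the product of `a √X` and `1 / √X`,
    -- and the squares of both are summable in `m`.
    have h4 : a ≤ a ^ 2 * X + X⁻¹ := by
      rw [← sub_nonneg]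
      have : a ^ 2 * X + X⁻¹ - a = ((a * X - 1 / 2) ^ 2 + 3 / 4) / X := by
        field_simp
        ring
      rw [this]
      positivity
    linarith

theorem continuous_trig (c : ℂ) (m : Fin n → ℤ) : Continuous (trig c m) :=
  (trig_smooth c m).continuous_fun

theorem continuous_tsum_trig {d : (Fin n → ℤ) → ℂ} (hd : Summable fun m => ‖d m‖) :
    Continuous fun x => ∑' m, trig (d m) m x :=
  continuous_tsum (fun m => continuous_trig _ m) hd fun m x => abs_trig_le _ m x

/-- Only integrability of `f` is required, because absolute convergence is uniform in `x`. In the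
use below `f` is a product of two square integrable functions, where Parseval is unavailable. -/
theorem hasSum_integral_mul_trig_of_summable {f : Torus n → ℝ} (hf : Integrable f)
    {d : (Fin n → ℤ) → ℂ} (hd : Summable fun m => ‖d m‖) :
    HasSum (fun m => ∫ x, f x * trig (d m) m x) (∫ x, f x * ∑' m, trig (d m) m x) := by
  have hint : ∀ m, Integrable fun x => f x * trig (d m) m x := fun m =>
    hf.mul_bdd (c := ‖d m‖) (continuous_trig _ m).aestronglyMeasurable
      (.of_forall fun x => abs_trig_le _ m x)
  have h := hasSum_integral_of_summable_integral_norm hint (by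
    refine .of_nonneg_of_le (fun m => integral_nonneg fun x => norm_nonneg _) (fun m => ?_)
      (hd.mul_left (∫ x, ‖f x‖))
    rw [← integral_mul_const]
    refine integral_mono (hint m).norm (hf.norm.mul_const _) fun x => ?_
    rw [norm_mul]
    exact mul_le_mul_of_nonneg_left (abs_trig_le _ m x) (norm_nonneg _))
  simpa only [tsum_mul_left] using h

end TrigSeries

/-! ### The antisymmetric operator `a u · ∇` on gradients. -/

section Advection

variable {n : ℕ}

/-- The field with components `∑ i, a uᵢ ∂ᵢ ∂ⱼ η`. -/
def hessField (a : Torus n → ℝ) (u : Torus n → Vec n) (η : Torus n → ℝ) (x : Torus n) : Vec n :=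
  WithLp.toLp 2 fun j => ∑ i, a x * u x i * partialD i (partialD j η) x

theorem hessField_apply (a : Torus n → ℝ) (u : Torus n → Vec n) (η : Torus n → ℝ) (x : Torus n)
    (j : Fin n) : hessField a u η x j = ∑ i, a x * u x i * partialD i (partialD j η) x := rfl

theorem memLp_hessField {a : Torus n → ℝ} (ha : Continuous a) {u : Torus n → Vec n}
    (hu : MemLp u 2) {η : Torus n → ℝ} (hη : TorusContDiff ∞ η) : MemLp (hessField a u η) 2 := by
  refine memLp_field fun j => ?_
  simp only [hessField_apply]
  refine memLp_finsetSum _ fun i _ => ?_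
  have := ((hu.coord i).continuous_mul ha).continuous_mul
    (((hη.partialD_smooth j).partialD_smooth i).continuous_fun)
  simpa only [mul_comm] using this

/-- `G = a u · ∇ (∇ w)`, understood through the Fourier series of `w`. -/
def IsAdvection (a : Torus n → ℝ) (u : Torus n → Vec n) (w : Torus n → ℝ)
    (G : Torus n → Vec n) : Prop :=
  MemLp G 2 ∧ ∀ p : Torus n → Vec n, MemLp p 2 →
    HasSum (fun m => ∫ x, inner ℝ (p x) (hessField a u (trig (fcoef w m) m) x))
      (∫ x, inner ℝ (p x) (G x))

theorem hessField_trig (a : Torus n → ℝ) (u : Torus n → Vec n) {w : Torus n → ℝ}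
    {g : Torus n → Vec n} (hw : MemLp w 2) (hg : MemLp g 2) (hwg : HasWeakGrad w g)
    (m : Fin n → ℤ) (x : Torus n) (j : Fin n) : hessField a u (trig (fcoef w m) m) x j =
      ∑ i, a x * u x i * trig (2 * Real.pi * Complex.I * m i * fcoef (fun x => g x j) m) m x := by
  simp only [hessField_apply, partialD_trig,
    (hasWeakPartial_iff_fcoef hw (hg.coord j)).1 (hwg j) m]

theorem isAdvection_of_hasSum {a : Torus n → ℝ} (ha : Continuous a) {u : Torus n → Vec n}
    (hu : MemLp u 2) {w : Torus n → ℝ} {g : Torus n → Vec n} (hw : MemLp w 2) (hg : MemLp g 2)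
    (hwg : HasWeakGrad w g) (H : Fin n → Fin n → Torus n → ℝ)
    (hH : ∀ i j, MemLp (fun x => a x * u x i * H i j x) 2)
    (hs : ∀ i j (p : Torus n → ℝ), MemLp p 2 → HasSum
      (fun m => ∫ x, (p x * (a x * u x i)) *
        trig (2 * Real.pi * Complex.I * m i * fcoef (fun x => g x j) m) m x)
      (∫ x, (p x * (a x * u x i)) * H i j x)) :
    IsAdvection a u w fun x => WithLp.toLp 2 fun j => ∑ i, a x * u x i * H i j x := by
  have hG : MemLp (fun x => (WithLp.toLp 2 fun j => ∑ i, a x * u x i * H i j x : Vec n)) 2 :=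
    memLp_field fun j => memLp_finsetSum Finset.univ fun i _ => hH i j
  refine ⟨hG, fun p hp => ?_⟩
  have key := hasSum_sum (s := Finset.univ) fun j (_ : j ∈ Finset.univ) =>
    hasSum_sum (s := Finset.univ) fun i (_ : i ∈ Finset.univ) => hs i j _ (hp.coord j)
  have e1 : ∫ x, inner ℝ (p x) (WithLp.toLp 2 fun j => ∑ i, a x * u x i * H i j x : Vec n) =
      ∑ j, ∑ i, ∫ x, (p x j * (a x * u x i)) * H i j x := by
    rw [integral_inner_eq_sum hp hG]
    refine Finset.sum_congr rfl fun j _ => ?_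
    simp only [Finset.mul_sum]
    rw [integral_finsetSum]
    · simp only [mul_assoc]
    · exact fun i _ => (hp.coord j).integrable_mul (hH i j)
  rw [e1]
  refine key.congr_fun fun m => ?_
  rw [integral_inner_eq_sum hp (memLp_hessField ha hu (trig_smooth _ _))]
  refine Finset.sum_congr rfl fun j _ => ?_
  simp only [hessField_trig a u hw hg hwg, Finset.mul_sum]
  rw [integral_finsetSum]
  · simp only [mul_assoc]
  · intro i _
    have h1 := ((hu.coord i).continuous_mul ha).continuous_mul (continuous_trig
      (2 * Real.pi * Complex.I * m i * fcoef (fun x => g x j) m) m)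
    have h2 := (hp.coord j).integrable_mul h1
    refine h2.congr (.of_forall fun x => ?_)
    simp only [Pi.mul_apply]
    ring

/-- When `u` is bounded, `p a u` is square integrable and pairs by Parseval with the weak second
derivatives of `w`, which are in `L²`. -/
theorem exists_isAdvection_of_bounded {a : Torus n → ℝ} (ha : Continuous a) {u : Torus n → Vec n}
    (hu : MemLp u ⊤) {w : Torus n → ℝ} {g : Torus n → Vec n} (hw : MemLp w 2) (hg : MemLp g 2)
    (hwg : HasWeakGrad w g) (hg1 : ∀ j, MemSobolev 1 fun x => g x j) :
    ∃ G, IsAdvection a u w G := by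
  choose H hH hHm using fun i j => (hg1 j).2 i
  have hHm' : ∀ i j, MemLp (H i j) 2 := hHm
  have hb : ∀ i, MemLp (fun x => a x * u x i) ⊤ := fun i => (hu.coord i).continuous_mul ha
  refine ⟨_, isAdvection_of_hasSum ha (hu.mono_exponent le_top) hw hg hwg H
    (fun i j => (hHm' i j).mul (hb i)) fun i j p hp => ?_⟩
  have hpb : MemLp (fun x => p x * (a x * u x i)) 2 := (hb i).mul hp
  refine (hasSum_integral_mul_trig hpb (hHm' i j)).congr_fun fun m => ?_
  rw [(hasWeakPartial_iff_fcoef (hg.coord j) (hHm' i j)).1 (hH i j) m]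

/-- When `u` is only in `L²`, `p a u` is merely integrable. Above the Sobolev threshold the second
derivatives of `w` have absolutely convergent Fourier series, so their continuous sums replace `H`.
-/
theorem exists_isAdvection_of_sobolev {a : Torus n → ℝ} (ha : Continuous a) {u : Torus n → Vec n}
    (hu : MemLp u 2) {w : Torus n → ℝ} {g : Torus n → Vec n} (hw : MemLp w 2) (hg : MemLp g 2)
    (hwg : HasWeakGrad w g) {k : ℕ} (hk : n + 2 < 2 * k)
    (hgk : ∀ j, MemSobolev k fun x => g x j) : ∃ G, IsAdvection a u w G := by
  have hd := fun i j => (hgk j).summable_norm_deriv hk i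
  refine ⟨_, isAdvection_of_hasSum ha hu hw hg hwg
    (fun i j x => ∑' m, trig (2 * Real.pi * Complex.I * m i * fcoef (fun x => g x j) m) m x)
    (fun i j => ?_) fun i j p hp => hasSum_integral_mul_trig_of_summable
      (hp.integrable_mul ((hu.coord i).continuous_mul ha)) (hd i j)⟩
  have := ((hu.coord i).continuous_mul ha).continuous_mul (continuous_tsum_trig (hd i j))
  simpa only [mul_comm] using this

variable {a : Torus n → ℝ} {u : Torus n → Vec n}

theorem hasSum_integral_inner_torusGrad {w : Torus n → ℝ} {g q : Torus n → Vec n}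
    (hw : MemLp w 2) (hg : MemLp g 2) (hwg : HasWeakGrad w g) (hq : MemLp q 2) :
    HasSum (fun m => ∫ x, inner ℝ (q x) (torusGrad (trig (fcoef w m) m) x))
      (∫ x, inner ℝ (q x) (g x)) := by
  rw [integral_inner_eq_sum hq hg]
  refine (hasSum_sum fun i _ => hasSum_integral_mul_trig (hq.coord i) (hg.coord i)).congr_fun
    fun m => ?_
  rw [integral_inner_eq_sum hq (.torusGrad (trig_smooth _ _).one_of_smooth 2)]
  refine Finset.sum_congr rfl fun i _ => ?_
  rw [(hasWeakPartial_iff_fcoef hw (hg.coord i)).1 (hwg i) m, ← partialD_trig]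
  rfl

theorem integrable_inner {p q : Torus n → Vec n} (hp : MemLp p 2) (hq : MemLp q 2) :
    Integrable fun x => inner ℝ (p x) (q x) := by
  simp_rw [Vec.inner_eq]
  exact integrable_finsetSum _ fun i _ => (hp.coord i).integrable_mul (hq.coord i)

/-- If `div (a u) = 0`, the operator `a u · ∇` is antisymmetric; here on smooth gradients. -/
theorem integral_hessField_add (ha : Continuous a) (hu : MemLp u 2)
    (hdiv : ∀ η : Torus n → ℝ, TorusContDiff ∞ η →
      ∫ x, a x * inner ℝ (u x) (torusGrad η x) = 0) {ξ η : Torus n → ℝ}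
    (hξ : TorusContDiff ∞ ξ) (hη : TorusContDiff ∞ η) :
    (∫ x, inner ℝ (torusGrad η x) (hessField a u ξ x)) +
      ∫ x, inner ℝ (torusGrad ξ x) (hessField a u η x) = 0 := by
  have hs : ∀ j, TorusContDiff ∞ fun x => partialD j ξ x * partialD j η x := fun j =>
    (hξ.partialD_smooth j).mul (hη.partialD_smooth j)
  -- Test the divergence condition with `∇ ξ · ∇ η`: by the product rule `a u · ∇ (∇ ξ · ∇ η)` is
  -- the sum of the two integrands.
  have h := hdiv _ (TorusContDiff.sum (s := Finset.univ) fun j _ => hs j)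
  rw [← integral_add (integrable_inner (.torusGrad hη.one_of_smooth 2) (memLp_hessField ha hu hξ))
    (integrable_inner (.torusGrad hξ.one_of_smooth 2) (memLp_hessField ha hu hη)), ← h]
  refine integral_congr_ae (.of_forall fun x => ?_)
  simp only [Vec.inner_eq, hessField_apply, torusGrad, Finset.mul_sum]
  simp_rw [← Finset.sum_add_distrib]
  rw [Finset.sum_comm]
  refine Finset.sum_congr rfl fun i _ => ?_
  rw [partialD_sum fun j _ => (hs j).one_of_smooth, Finset.mul_sum, Finset.mul_sum]
  refine Finset.sum_congr rfl fun j _ => ?_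
  rw [partialD_mul (hξ.partialD_smooth j).one_of_smooth (hη.partialD_smooth j).one_of_smooth]
  ring

/-- Antisymmetry against each monomial of `w`, then summed: the defining series of `G` and the
Fourier series of `∇ w` match term by term up to sign. -/
theorem IsAdvection.integral_torusGrad (ha : Continuous a) (hu : MemLp u 2)
    (hdiv : ∀ η : Torus n → ℝ, TorusContDiff ∞ η →
      ∫ x, a x * inner ℝ (u x) (torusGrad η x) = 0) {w : Torus n → ℝ} {g G : Torus n → Vec n}
    (hw : MemLp w 2) (hg : MemLp g 2) (hwg : HasWeakGrad w g) (hG : IsAdvection a u w G)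
    {η : Torus n → ℝ} (hη : TorusContDiff ∞ η) :
    ∫ x, inner ℝ (G x) (torusGrad η x) = -∫ x, inner ℝ (g x) (hessField a u η x) := by
  have h1 := hG.2 _ (.torusGrad hη.one_of_smooth 2)
  have h2 := hasSum_integral_inner_torusGrad hw hg hwg (memLp_hessField ha hu hη)
  have h3 : ∫ x, inner ℝ (torusGrad η x) (G x) = -∫ x, inner ℝ (hessField a u η x) (g x) := by
    refine h1.unique (h2.neg.congr_fun fun m => ?_)
    have h4 := integral_hessField_add ha hu hdiv (trig_smooth (fcoef w m) m) hη
    simp only [real_inner_comm (hessField a u η _)] at h4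
    linarith
  simpa only [real_inner_comm] using h3

/-- If `div (a u) = 0`, the operator `a u · ∇` is antisymmetric on gradients. -/
theorem IsAdvection.integral_add (ha : Continuous a) (hu : MemLp u 2)
    (hdiv : ∀ η : Torus n → ℝ, TorusContDiff ∞ η →
      ∫ x, a x * inner ℝ (u x) (torusGrad η x) = 0) {w w' : Torus n → ℝ}
    {g g' G G' : Torus n → Vec n} (hw : MemLp w 2) (hg : MemLp g 2) (hwg : HasWeakGrad w g)
    (hG : IsAdvection a u w G) (hw' : MemLp w' 2) (hg' : MemLp g' 2) (hwg' : HasWeakGrad w' g')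
    (hG' : IsAdvection a u w' G') :
    (∫ x, inner ℝ (G x) (g' x)) + ∫ x, inner ℝ (G' x) (g x) = 0 := by
  have h1 := hasSum_integral_inner_torusGrad hw' hg' hwg' hG.1
  have h2 := hG'.2 _ hg
  have h3 : ∫ x, inner ℝ (G x) (g' x) = -∫ x, inner ℝ (g x) (G' x) := by
    refine h1.unique (h2.neg.congr_fun fun m => ?_)
    exact hG.integral_torusGrad ha hu hdiv hw hg hwg (trig_smooth _ _)
  simp only [real_inner_comm (G' _) (g _)] at h3
  rw [h3, neg_add_cancel]

end Advection

/-! ### Existence, uniqueness and antisymmetry of the source. -/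

section Source

variable {n : ℕ} {ρ₀ : Torus n → ℝ} {u : Torus n → Vec n}

/-- On a gradient the derivative of the test field is a symmetric Hessian, so the two tensor
products in `B1` contribute equally; hence the factor `2`. -/
theorem B1_eq_integral (ρ₀ : Torus n → ℝ) (u : Torus n → Vec n) (h : L2Field n) {η : Torus n → ℝ}
    (hη : TorusContDiff ∞ η) : B1 ρ₀ u h (torusGrad η) =
      -2 * ∫ x, inner ℝ (h x) (hessField (fun x => √(ρ₀ x)) u η x) := by
  rw [B1, neg_mul, ← integral_const_mul]
  congr 1
  refine integral_congr_ae (.of_forall fun x => ?_)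
  have e : ∀ i j, partialD j (partialD i η) x = partialD i (partialD j η) x := fun i j =>
    partialD_comm (hη.mono (WithTop.coe_le_coe.2 le_top)) j i x
  simp only [Vec.inner_eq, hessField_apply, Finset.mul_sum]
  change ∑ i, ∑ j, (√(ρ₀ x) * u x i * h x j + √(ρ₀ x) * h x i * u x j) *
    partialD j (partialD i η) x = _
  simp only [add_mul, Finset.sum_add_distrib]
  have e1 : ∑ i, ∑ j, √(ρ₀ x) * u x i * h x j * partialD j (partialD i η) x =
      ∑ j, ∑ i, h x j * (√(ρ₀ x) * u x i * partialD i (partialD j η) x) := by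
    rw [Finset.sum_comm]
    refine Finset.sum_congr rfl fun j _ => Finset.sum_congr rfl fun i _ => ?_
    rw [e]
    ring
  have e2 : ∑ i, ∑ j, √(ρ₀ x) * h x i * u x j * partialD j (partialD i η) x =
      ∑ j, ∑ i, h x j * (√(ρ₀ x) * u x i * partialD i (partialD j η) x) :=
    Finset.sum_congr rfl fun j _ => Finset.sum_congr rfl fun i _ => by ring
  rw [e1, e2, ← two_mul, Finset.mul_sum]
  simp only [Finset.mul_sum]

/-- For a fixed smooth `η` the functional is `L²`-continuous in `h` even though `u` is only in `L²`,
since the derivatives fall on `η`. Linearity of the source and closedness of its graph follow. -/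
theorem exists_B1_eq_inner (hc : Continuous ρ₀) (hu : MemLp u 2) {η : Torus n → ℝ}
    (hη : TorusContDiff ∞ η) :
    ∃ K : L2Field n, ∀ h : L2Field n, B1 ρ₀ u h (torusGrad η) = inner ℝ K h := by
  have hm : MemLp (hessField (fun x => √(ρ₀ x)) u η) 2 := memLp_hessField hc.sqrt hu hη
  refine ⟨(-2 : ℝ) • hm.toLp _, fun h => ?_⟩
  rw [B1_eq_integral ρ₀ u h hη, real_inner_smul_left, real_inner_comm, L2Field.inner_eq]
  congr 1
  refine integral_congr_ae ?_
  filter_upwards [hm.coeFn_toLp] with x hx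
  rw [hx]

open Classical in
/-- The weighted gradient `√ρ₀ ∇ η` in `L²`. -/
def sqrtGrad (ρ₀ η : Torus n → ℝ) : L2Field n :=
  if h : MemLp (fun x => √(ρ₀ x) • torusGrad η x) 2 then h.toLp _ else 0

theorem coeFn_sqrtGrad (hc : Continuous ρ₀) {η : Torus n → ℝ} (hη : TorusContDiff ∞ η) :
    sqrtGrad ρ₀ η =ᵐ[volume] fun x => √(ρ₀ x) • torusGrad η x := by
  have h : MemLp (fun x => √(ρ₀ x) • torusGrad η x) 2 :=
    (MemLp.torusGrad hη.one_of_smooth 2).continuous_smul hc.sqrt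
  rw [sqrtGrad, dif_pos h]
  exact h.coeFn_toLp

theorem inner_sqrtGrad (hc : Continuous ρ₀) {η : Torus n → ℝ} (hη : TorusContDiff ∞ η)
    (h : L2Field n) :
    inner ℝ h (sqrtGrad ρ₀ η) = ∫ x, √(ρ₀ x) * inner ℝ (h x) (torusGrad η x) := by
  rw [L2Field.inner_eq]
  refine integral_congr_ae ?_
  filter_upwards [coeFn_sqrtGrad hc hη] with x hx
  rw [hx, real_inner_smul_right]

theorem sqrtGrad_mem (hc : Continuous ρ₀) (hpos : ∀ x, 0 < ρ₀ x) (hb : Continuous (invSqrt ρ₀))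
    {η : Torus n → ℝ} (hη : TorusContDiff ∞ η) :
    sqrtGrad ρ₀ η ∈ potentialFields (invSqrt ρ₀) hb := by
  have h := hη.one_of_smooth.exists_mem_gradSpace hb hc.sqrt (invSqrt_mul_sqrt hpos)
  have h1 : MemLp (fun x => √(ρ₀ x) • torusGrad η x) 2 :=
    (MemLp.torusGrad hη.one_of_smooth 2).continuous_smul hc.sqrt
  rw [sqrtGrad, dif_pos h1]
  exact mem_potentialFields.2 ⟨_, h⟩

/-- The source term by its weak formulation. -/
theorem isSource_iff (hc : Continuous ρ₀) (hpos : ∀ x, 0 < ρ₀ x) {V F : acousticSpace ρ₀} :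
    IsSource ρ₀ u V F ↔ F.1.fst = 0 ∧ ∀ η : Torus n → ℝ, TorusContDiff ∞ η →
      inner ℝ F.1.snd (sqrtGrad ρ₀ η) = B1 ρ₀ u V.1.snd (torusGrad η) := by
  have hb := continuous_invSqrt hc hpos
  refine and_congr_right fun _ => ⟨?_, fun h => ?_⟩
  · rintro ⟨P, ⟨Ψ, g, -, -, -, hP⟩, hF⟩ η hη
    rw [inner_sqrtGrad hc hη, ← hP η hη]
    refine integral_congr_ae ?_
    filter_upwards [hF] with x hx
    rw [hx, real_inner_smul_left, mul_inv_cancel_left₀ (Real.sqrt_pos.2 (hpos x)).ne']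
  · obtain ⟨w, hw⟩ := mem_potentialFields.1 ((mem_acousticSpace_iff hpos hb).1 F.2)
    obtain ⟨Ψ, hΨ, h0⟩ := exists_mean_zero_potential hw
    rw [toLp_mem_gradSpace] at hΨ
    have hg : MemLp (fun x => invSqrt ρ₀ x • F.1.snd x) 2 :=
      (Lp.memLp F.1.snd).continuous_smul hb
    have hP : MemLp (fun x => √(ρ₀ x) • F.1.snd x) 2 :=
      (Lp.memLp F.1.snd).continuous_smul hc.sqrt
    refine ⟨hP.toLp _, ⟨Ψ, hg.toLp _, hΨ.congr ae_eq_rfl hg.coeFn_toLp.symm, h0, ?_,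
      fun η hη => ?_⟩, ?_⟩
    · filter_upwards [hP.coeFn_toLp, hg.coeFn_toLp] with x h1 h2
      rw [h1, h2, smul_smul]
      congr 1
      nth_rewrite 2 [← Real.mul_self_sqrt (hpos x).le]
      rw [mul_assoc, mul_comm (√_) (invSqrt _ _), invSqrt_mul_sqrt hpos, mul_one]
    · rw [← h η hη, inner_sqrtGrad hc hη]
      refine integral_congr_ae ?_
      filter_upwards [hP.coeFn_toLp] with x h1
      rw [h1, real_inner_smul_left]
    · filter_upwards [hP.coeFn_toLp] with x h1
      rw [h1, smul_smul, inv_mul_cancel₀ (Real.sqrt_pos.2 (hpos x)).ne', one_smul]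

/-- A weak identity against the weighted gradients of smooth functions extends to `𝔻`. -/
theorem inner_snd_eq_of_forall_smooth (hc : Continuous ρ₀)
    {f : L2Field n} {G : Torus n → Vec n} (hG : MemLp G 2)
    (h : ∀ η : Torus n → ℝ, TorusContDiff ∞ η →
      inner ℝ f (sqrtGrad ρ₀ η) = ∫ x, inner ℝ (G x) (torusGrad η x))
    {k : L2Field n} {w : L2Scalar n} {g : L2Field n} (hwg : HasWeakGrad w g)
    (hk : ∀ᵐ x, k x = √(ρ₀ x) • g x) : inner ℝ f k = ∫ x, inner ℝ (G x) (g x) := by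
  have hf : MemLp (fun x => √(ρ₀ x) • f x) 2 := (Lp.memLp f).continuous_smul hc.sqrt
  have h0 : MemLp (fun _ : Torus n => (0 : ℝ)) 2 := MemLp.zero'
  -- The hypothesis says that `√ρ₀ f - G` is weakly divergence free, so it is orthogonal to every
  -- `L²` gradient and not just to smooth ones.
  have h1 := integral_eq_of_forall_smooth h0 (hf.sub hG) (fun η hη => ?_) (Lp.memLp w)
    (Lp.memLp g) hwg
  · simp only [zero_mul, integral_zero, Pi.sub_apply, inner_sub_left] at h1
    rw [integral_sub (integrable_inner hf (Lp.memLp g)) (integrable_inner hG (Lp.memLp g))] at h1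
    rw [← sub_eq_zero.1 h1.symm, L2Field.inner_eq]
    refine integral_congr_ae ?_
    filter_upwards [hk] with x hx
    rw [hx, real_inner_smul_left, real_inner_smul_right]
  · have hη' := MemLp.torusGrad hη.one_of_smooth 2
    simp only [zero_mul, integral_zero, Pi.sub_apply, inner_sub_left]
    rw [integral_sub (integrable_inner hf hη') (integrable_inner hG hη'), ← h η hη,
      inner_sqrtGrad hc hη]
    simp only [real_inner_smul_left, sub_self]

/-- The second component of the difference is orthogonal to all weighted smooth gradients, hence to
every element of `𝔻`, in particular to itself. -/
theorem IsSource.unique (hc : Continuous ρ₀) (hpos : ∀ x, 0 < ρ₀ x) {V F F' : acousticSpace ρ₀}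
    (h : IsSource ρ₀ u V F) (h' : IsSource ρ₀ u V F') : F = F' := by
  rw [isSource_iff hc hpos] at h h'
  have h1 : ∀ η : Torus n → ℝ, TorusContDiff ∞ η → inner ℝ (F.1.snd - F'.1.snd) (sqrtGrad ρ₀ η) =
      ∫ x, inner ℝ (0 : Vec n) (torusGrad η x) := fun η hη => by
    rw [inner_sub_left, h.2 η hη, h'.2 η hη]
    simp
  obtain ⟨w, g, hwg, hk⟩ := (F - F').2
  have h2 := inner_snd_eq_of_forall_smooth hc (G := fun _ => 0) MemLp.zero' h1 hwg hk
  simp only [inner_zero_left, integral_zero] at h2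
  have h3 : F.1.snd - F'.1.snd = 0 := inner_self_eq_zero.1 h2
  exact Subtype.ext (WithLp.ofLp_injective 2 (Prod.ext (h.1.trans h'.1.symm) (sub_eq_zero.1 h3)))

theorem isSource_source {V F : acousticSpace ρ₀} (h : IsSource ρ₀ u V F) :
    IsSource ρ₀ u V (source ρ₀ u V) := by
  have hex : ∃ F, IsSource ρ₀ u V F := ⟨F, h⟩
  rw [source, dif_pos hex]
  exact hex.choose_spec

theorem IsSource.eq_source (hc : Continuous ρ₀) (hpos : ∀ x, 0 < ρ₀ x) {V F : acousticSpace ρ₀}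
    (h : IsSource ρ₀ u V F) : source ρ₀ u V = F :=
  (isSource_source h).unique hc hpos h

theorem IsSource.add (hc : Continuous ρ₀) (hpos : ∀ x, 0 < ρ₀ x) (hu : MemLp u 2)
    {V F V' F' : acousticSpace ρ₀} (h : IsSource ρ₀ u V F) (h' : IsSource ρ₀ u V' F') :
    IsSource ρ₀ u (V + V') (F + F') := by
  rw [isSource_iff hc hpos] at h h' ⊢
  refine ⟨?_, fun η hη => ?_⟩
  · change F.1.fst + F'.1.fst = 0
    rw [h.1, h'.1, add_zero]
  · obtain ⟨K, hK⟩ := exists_B1_eq_inner hc hu hη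
    change inner ℝ (F.1.snd + F'.1.snd) _ = B1 ρ₀ u (V.1.snd + V'.1.snd : L2Field n) _
    rw [inner_add_left, h.2 η hη, h'.2 η hη, hK, hK, hK, inner_add_right]

theorem IsSource.smul (hc : Continuous ρ₀) (hpos : ∀ x, 0 < ρ₀ x) (hu : MemLp u 2) (r : ℝ)
    {V F : acousticSpace ρ₀} (h : IsSource ρ₀ u V F) : IsSource ρ₀ u (r • V) (r • F) := by
  rw [isSource_iff hc hpos] at h ⊢
  refine ⟨?_, fun η hη => ?_⟩
  · change r • F.1.fst = 0
    rw [h.1, smul_zero]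
  · obtain ⟨K, hK⟩ := exists_B1_eq_inner hc hu hη
    change inner ℝ (r • F.1.snd) _ = B1 ρ₀ u (r • V.1.snd : L2Field n) _
    rw [real_inner_smul_left, h.2 η hη, hK, hK, real_inner_smul_right]

/-- The weak formulation consists of conditions continuous in both `V` and `F`, so the relation has
closed graph. This feeds the closed graph theorem. -/
theorem IsSource.of_tendsto (hc : Continuous ρ₀) (hpos : ∀ x, 0 < ρ₀ x) (hu : MemLp u 2)
    {V F : ℕ → acousticSpace ρ₀} {V₀ F₀ : acousticSpace ρ₀} (h : ∀ j, IsSource ρ₀ u (V j) (F j))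
    (hV : Tendsto V atTop (𝓝 V₀)) (hF : Tendsto F atTop (𝓝 F₀)) : IsSource ρ₀ u V₀ F₀ := by
  simp only [isSource_iff hc hpos] at h ⊢
  have hfst : Continuous fun X : acousticSpace ρ₀ => X.1.fst :=
    (WithLp.fstL 2 ℝ (L2Scalar n) (L2Field n)).continuous.comp continuous_subtype_val
  have hsnd : Continuous fun X : acousticSpace ρ₀ => X.1.snd :=
    (WithLp.sndL 2 ℝ (L2Scalar n) (L2Field n)).continuous.comp continuous_subtype_val
  refine ⟨tendsto_nhds_unique ((hfst.tendsto F₀).comp hF)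
    (tendsto_const_nhds.congr fun j => (h j).1.symm), fun η hη => ?_⟩
  obtain ⟨K, hK⟩ := exists_B1_eq_inner hc hu hη
  have h1 := ((hsnd.tendsto F₀).comp hF).inner (𝕜 := ℝ)
    (tendsto_const_nhds (x := sqrtGrad ρ₀ η))
  have h2 := (tendsto_const_nhds (x := K)).inner (𝕜 := ℝ) ((hsnd.tendsto V₀).comp hV)
  rw [hK]
  refine tendsto_nhds_unique h1 (h2.congr fun j => ?_)
  exact ((h j).2 η hη ▸ hK _).symm

/-- The functional `B₁` through the advection of the gradient. -/
theorem B1_eq_of_isAdvection (hc : Continuous ρ₀) (hpos : ∀ x, 0 < ρ₀ x) (hu : MemLp u 2)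
    (hdiv : ∀ η : Torus n → ℝ, TorusContDiff ∞ η →
      ∫ x, ρ₀ x * inner ℝ (u x) (torusGrad η x) = 0) {h : L2Field n} {w : L2Scalar n}
    {g : L2Field n} (hwg : HasWeakGrad w g) (hh : ∀ᵐ x, h x = √(ρ₀ x) • g x)
    {G : Torus n → Vec n} (hG : IsAdvection ρ₀ u w G) {η : Torus n → ℝ}
    (hη : TorusContDiff ∞ η) :
    B1 ρ₀ u h (torusGrad η) = 2 * ∫ x, inner ℝ (G x) (torusGrad η x) := by
  rw [B1_eq_integral ρ₀ u h hη,
    hG.integral_torusGrad hc hu hdiv (Lp.memLp w) (Lp.memLp g) hwg hη, neg_mul, mul_neg]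
  congr 2
  refine integral_congr_ae ?_
  filter_upwards [hh] with x hx
  rw [hx, Vec.inner_eq, Vec.inner_eq]
  refine Finset.sum_congr rfl fun j _ => ?_
  simp only [PiLp.smul_apply, smul_eq_mul, hessField_apply, Finset.mul_sum]
  refine Finset.sum_congr rfl fun i _ => ?_
  rw [← Real.mul_self_sqrt (hpos x).le, Real.sqrt_mul_self (Real.sqrt_nonneg _)]
  ring

/-- The weighted Helmholtz projection is an ordinary orthogonal projection after division by `√ρ₀`:
project `2 ρ₀^{-1/2} G` onto the closed space of potential fields, where the test fields `√ρ₀ ∇ η`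
live. -/
theorem exists_isSource (hc : Continuous ρ₀) (hpos : ∀ x, 0 < ρ₀ x) (hu : MemLp u 2)
    (hdiv : ∀ η : Torus n → ℝ, TorusContDiff ∞ η →
      ∫ x, ρ₀ x * inner ℝ (u x) (torusGrad η x) = 0) {V : acousticSpace ρ₀} {w : L2Scalar n}
    {g : L2Field n} (hwg : HasWeakGrad w g) (hh : ∀ᵐ x, V.1.snd x = √(ρ₀ x) • g x)
    {G : Torus n → Vec n} (hG : IsAdvection ρ₀ u w G) : ∃ F, IsSource ρ₀ u V F := by
  have hb := continuous_invSqrt hc hpos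
  have hm : MemLp (fun x => invSqrt ρ₀ x • G x) 2 := hG.1.continuous_smul hb
  let S := potentialFields (invSqrt ρ₀) hb
  let q : L2Field n := (2 : ℝ) • hm.toLp _
  refine ⟨⟨WithLp.toLp 2 (0, (S.orthogonalProjectionOnto q : L2Field n)),
    (mem_acousticSpace_iff hpos hb).2 (S.orthogonalProjectionOnto q).2⟩,
    (isSource_iff hc hpos).2 ⟨rfl, fun η hη => ?_⟩⟩
  change inner ℝ (S.orthogonalProjectionOnto q : L2Field n) (sqrtGrad ρ₀ η) = _
  have h1 := Submodule.inner_orthogonalProjectionOnto_eq_of_mem_right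
    (⟨_, sqrtGrad_mem hc hpos hb hη⟩ : S) q
  rw [B1_eq_of_isAdvection hc hpos hu hdiv hwg hh hG hη]
  refine h1.trans ?_
  change inner ℝ ((2 : ℝ) • hm.toLp _) (sqrtGrad ρ₀ η) = _
  rw [real_inner_smul_left, L2Field.inner_eq]
  congr 1
  refine integral_congr_ae ?_
  filter_upwards [hm.coeFn_toLp, coeFn_sqrtGrad hc hη] with x hx hx'
  rw [hx, hx', real_inner_smul_left, real_inner_smul_right, ← mul_assoc, invSqrt_mul_sqrt hpos,
    one_mul]

/-- The source terms define an antisymmetric form. -/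
theorem inner_source_add (hc : Continuous ρ₀) (hpos : ∀ x, 0 < ρ₀ x) (hu : MemLp u 2)
    (hdiv : ∀ η : Torus n → ℝ, TorusContDiff ∞ η →
      ∫ x, ρ₀ x * inner ℝ (u x) (torusGrad η x) = 0) {V V' F F' : acousticSpace ρ₀}
    {w w' : L2Scalar n} {g g' : L2Field n} (hwg : HasWeakGrad w g)
    (hh : ∀ᵐ x, V.1.snd x = √(ρ₀ x) • g x) {G G' : Torus n → Vec n} (hG : IsAdvection ρ₀ u w G)
    (hwg' : HasWeakGrad w' g') (hh' : ∀ᵐ x, V'.1.snd x = √(ρ₀ x) • g' x)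
    (hG' : IsAdvection ρ₀ u w' G') (hF : IsSource ρ₀ u V F) (hF' : IsSource ρ₀ u V' F') :
    inner ℝ F V' + inner ℝ F' V = 0 := by
  -- Since `F` has zero first component, the pairing only sees the fields; the weak formulation,
  -- extended from smooth gradients to `∇ w'`, reads it as `2 ∫ G · ∇ w'`.
  have key : ∀ {V V' F : acousticSpace ρ₀} {w w' : L2Scalar n} {g g' : L2Field n}
      {G : Torus n → Vec n}, HasWeakGrad w g → (∀ᵐ x, V.1.snd x = √(ρ₀ x) • g x) →
      IsAdvection ρ₀ u w G → HasWeakGrad w' g' → (∀ᵐ x, V'.1.snd x = √(ρ₀ x) • g' x) →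
      IsSource ρ₀ u V F → inner ℝ F V' = 2 * ∫ x, inner ℝ (G x) (g' x) := by
    intro V V' F w w' g g' G hwg hh hG hwg' hh' hF
    rw [isSource_iff hc hpos] at hF
    have h1 := inner_snd_eq_of_forall_smooth hc (hG.1.const_smul (2 : ℝ)) (f := F.1.snd)
      (fun η hη => ?_) hwg' hh'
    · change inner ℝ F.1 V'.1 = _
      rw [WithLp.prod_inner_apply]
      change inner ℝ F.1.fst V'.1.fst + inner ℝ F.1.snd V'.1.snd = _
      rw [hF.1, inner_zero_left, zero_add, h1]
      simp only [Pi.smul_apply, real_inner_smul_left, integral_const_mul]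
    · rw [hF.2 η hη, B1_eq_of_isAdvection hc hpos hu hdiv hwg hh hG hη]
      simp only [Pi.smul_apply, real_inner_smul_left, integral_const_mul]
  rw [key hwg hh hG hwg' hh' hF, key hwg' hh' hG' hwg hh hF', ← mul_add,
    hG.integral_add hc hu hdiv (Lp.memLp w) (Lp.memLp g) hwg (Lp.memLp w') (Lp.memLp g') hwg' hG',
    mul_zero]

/-- States with components in `H^k` have potentials whose gradients can be advected. -/
theorem StateMemSobolev.exists_isAdvection {k : ℕ} (hρ : TorusContDiff k ρ₀)
    (hpos : ∀ x, 0 < ρ₀ x) (hu : MemLp u 2) (hk : n + 2 < 2 * k ∨ (1 ≤ k ∧ MemLp u ⊤ volume))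
    {V : acousticSpace ρ₀} (hV : StateMemSobolev k V.1) :
    ∃ (w : L2Scalar n) (g : L2Field n) (G : Torus n → Vec n), HasWeakGrad w g ∧
      (∀ᵐ x, V.1.snd x = √(ρ₀ x) • g x) ∧ IsAdvection ρ₀ u w G := by
  obtain ⟨w, g, hwg, hh⟩ := V.2
  have hg : ∀ j, MemSobolev k fun x => g x j := fun j => by
    refine ((hV.2 j).mul_contDiff (hρ.invSqrt hpos)).congr ?_
    filter_upwards [hh] with x hx
    rw [hx, PiLp.smul_apply, smul_eq_mul, ← mul_assoc, invSqrt_mul_sqrt hpos, one_mul]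
  have hG : ∃ G, IsAdvection ρ₀ u w G := by
    rcases hk with hk | ⟨hk, hu'⟩
    · exact exists_isAdvection_of_sobolev hρ.continuous_fun hu (Lp.memLp w) (Lp.memLp g) hwg hk hg
    · exact exists_isAdvection_of_bounded hρ.continuous_fun hu' (Lp.memLp w) (Lp.memLp g) hwg
        fun j => (hg j).mono hk
  obtain ⟨G, hG⟩ := hG
  exact ⟨w, g, G, hwg, hh, hG⟩

theorem integral_stateDot (V W : L2State n) : ∫ x, stateDot V W x = inner ℝ V W := by
  rw [WithLp.prod_inner_apply]
  change _ = inner ℝ V.fst W.fst + inner ℝ V.snd W.snd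
  rw [L2Scalar.inner_eq, L2Field.inner_eq]
  exact integral_add ((Lp.memLp _).integrable_mul (Lp.memLp _))
    (integrable_inner (Lp.memLp _) (Lp.memLp _))

theorem integrable_stateDot (V W : L2State n) : Integrable (stateDot V W) :=
  ((Lp.memLp _).integrable_mul (Lp.memLp _)).add (integrable_inner (Lp.memLp _) (Lp.memLp _))

end Source

/-! ### Boundedness of the source operator and the time averages. -/

section Average

variable {n : ℕ} {ρ₀ : Torus n → ℝ} {u : Torus n → Vec n}

/-- The source term composed with a power of the resolvent is a bounded operator. -/
theorem exists_source_operator (hc : Continuous ρ₀) (hpos : ∀ x, 0 < ρ₀ x) (hu : MemLp u 2)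
    (T : acousticSpace ρ₀ →L[ℝ] acousticSpace ρ₀)
    (h : ∀ V, IsSource ρ₀ u (T V) (source ρ₀ u (T V))) :
    ∃ A : acousticSpace ρ₀ →L[ℝ] acousticSpace ρ₀, ∀ V, A V = source ρ₀ u (T V) := by
  have := completeSpace_acousticSpace hpos (continuous_invSqrt hc hpos)
  let A : acousticSpace ρ₀ →ₗ[ℝ] acousticSpace ρ₀ :=
    { toFun := fun V => source ρ₀ u (T V)
      map_add' := fun V W => by
        rw [map_add]
        exact ((h V).add hc hpos hu (h W)).eq_source hc hpos
      map_smul' := fun r V => by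
        rw [map_smul]
        exact ((h V).smul hc hpos hu r).eq_source hc hpos }
  -- The linear map is defined on the whole complete space and has closed graph, hence is bounded;
  -- no explicit estimate of the advection term is needed.
  refine ⟨ContinuousLinearMap.ofSeqClosedGraph (g := A) fun v x y hv hy => ?_, fun V => rfl⟩
  exact ((IsSource.of_tendsto hc hpos hu (fun j => h (v j)) ((T.continuous.tendsto x).comp hv)
    hy).eq_source hc hpos).symm

theorem tendsto_Q1Average (U : ℝ → acousticSpace ρ₀ →L[ℝ] acousticSpace ρ₀)
    (hU : waveGroup ρ₀ = U) {V : acousticSpace ρ₀}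
    (h : AlmostPeriodic fun s => U (-s) (source ρ₀ u (U s V))) :
    Tendsto (Q1Average ρ₀ u V) atTop (𝓝 (Q1 ρ₀ u V)) := by
  obtain ⟨l, hl⟩ := (h.map (acousticSpace ρ₀).subtypeL).exists_mean
  subst hU
  exact tendsto_nhds_limUnder ⟨l, hl⟩

theorem inner_Q1Average (U : ℝ → acousticSpace ρ₀ →L[ℝ] acousticSpace ρ₀)
    (hU : waveGroup ρ₀ = U) {V : acousticSpace ρ₀}
    (h : AlmostPeriodic fun s => U (-s) (source ρ₀ u (U s V))) (W : acousticSpace ρ₀) (τ : ℝ) :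
    inner ℝ (Q1Average ρ₀ u V τ) W.1 =
      τ⁻¹ * ∫ s in (0 : ℝ)..τ, inner ℝ (U (-s) (source ρ₀ u (U s V))) W := by
  subst hU
  rw [Q1Average, real_inner_smul_left, real_inner_comm]
  congr 1
  exact ((innerSL ℝ W.1).intervalIntegral_comp_comm
    ((h.map (acousticSpace ρ₀).subtypeL).continuous.intervalIntegrable 0 τ)).symm.trans
    (intervalIntegral.integral_congr fun s _ =>
      real_inner_comm (waveGroup ρ₀ (-s) (source ρ₀ u (waveGroup ρ₀ s V))).1 W.1)

end Average

end

/-! ### The averaged term: convergence and cancellation. -/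

theorem proposition3p4 {n : ℕ} (k : ℕ)
    (ρ₀ : Torus n → ℝ) (hρ : TorusContDiff k ρ₀) (hρpos : ∀ x, 0 < ρ₀ x)
    (u : Torus n → Vec n) (hu : MemLp u 2 volume)
    (hdiv : ∀ η : Torus n → ℝ, TorusContDiff ∞ η →
      ∫ x, ρ₀ x * inner ℝ (u x) (torusGrad η x) = 0)
    (hk : n + 2 < 2 * k ∨ (1 ≤ k ∧ MemLp u ⊤ volume)) :
    (∀ V : acousticSpace ρ₀, StateMemSobolev k V.1 →
      (∀ s : ℝ, IsSource ρ₀ u (waveGroup ρ₀ s V) (source ρ₀ u (waveGroup ρ₀ s V))) ∧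
      Tendsto (Q1Average ρ₀ u V) atTop (𝓝 (Q1 ρ₀ u V)) ∧
      ∫ x, stateDot (Q1 ρ₀ u V) V.1 x = 0) ∧
    (∀ V₁ V₂ : acousticSpace ρ₀, StateMemSobolev k V₁.1 → StateMemSobolev k V₂.1 →
      ∫ x, (stateDot (Q1 ρ₀ u V₁) V₂.1 x + stateDot (Q1 ρ₀ u V₂) V₁.1 x) = 0) := by
  have hk1 : 1 ≤ k := by omega
  have hc := hρ.continuous_fun
  have hb := continuous_invSqrt hc hρpos
  obtain ⟨B⟩ := nonempty_waveBasis hb hc.sqrt (invSqrt_mul_sqrt hρpos)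
  have hgrp := B.waveGroup_eq hρpos
  set c := B.coords hρpos
  have hrange : ∀ {V : acousticSpace ρ₀}, (∃ Y, (c.resolvent ^ k) Y = V) ↔
      StateMemSobolev k V.1 := B.mem_range_resolvent_pow_iff hρpos hρ
  -- Invariance of `H^k` in time: it is the range of `R^k`, which commutes with the group.
  have hgroup : ∀ {V : acousticSpace ρ₀}, StateMemSobolev k V.1 → ∀ s,
      StateMemSobolev k (c.group s V).1 := fun {V} hV s => by
    obtain ⟨Y, rfl⟩ := hrange.2 hV
    exact hrange.1 ⟨c.group s Y, c.resolvent_pow_group k s Y⟩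
  have hsource : ∀ {V : acousticSpace ρ₀}, StateMemSobolev k V.1 →
      IsSource ρ₀ u V (source ρ₀ u V) := fun {V} hV => by
    obtain ⟨w, g, G, hwg, hh, hG⟩ := hV.exists_isAdvection hρ hρpos hu hk
    obtain ⟨F, hF⟩ := exists_isSource hc hρpos hu hdiv hwg hh hG
    exact isSource_source hF
  obtain ⟨A, hA⟩ := exists_source_operator hc hρpos hu (c.resolvent ^ k)
    fun V => hsource (hrange.1 ⟨V, rfl⟩)
  have hap : ∀ {V : acousticSpace ρ₀}, StateMemSobolev k V.1 →
      AlmostPeriodic fun s => c.group (-s) (source ρ₀ u (c.group s V)) := fun {V} hV => by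
    obtain ⟨Y, rfl⟩ := hrange.2 hV
    -- Writing `V = R^k Y` turns the unbounded source into the bounded operator `A` conjugated by
    -- the group.
    have h := c.almostPeriodic_conj A Y
    simpa only [hA, c.resolvent_pow_group] using h
  have hlim : ∀ {V : acousticSpace ρ₀}, StateMemSobolev k V.1 →
      Tendsto (Q1Average ρ₀ u V) atTop (𝓝 (Q1 ρ₀ u V)) := fun hV =>
    tendsto_Q1Average c.group hgrp (hap hV)
  have hanti : ∀ {V W : acousticSpace ρ₀}, StateMemSobolev k V.1 → StateMemSobolev k W.1 →
      inner ℝ (Q1 ρ₀ u V) W.1 + inner ℝ (Q1 ρ₀ u W) V.1 = 0 := fun {V W} hV hW => by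
    have h1 := ((hlim hV).inner (𝕜 := ℝ) (tendsto_const_nhds (x := W.1))).add
      ((hlim hW).inner (𝕜 := ℝ) (tendsto_const_nhds (x := V.1)))
    refine tendsto_nhds_unique h1 (tendsto_const_nhds.congr fun τ => ?_)
    rw [inner_Q1Average c.group hgrp (hap hV), inner_Q1Average c.group hgrp (hap hW), ← mul_add,
      ← intervalIntegral.integral_add
        (((hap hV).continuous.inner continuous_const).intervalIntegrable 0 τ)
        (((hap hW).continuous.inner continuous_const).intervalIntegrable 0 τ)]
    -- The cancellation holds at each time, before averaging: moving `𝓛(-s)` to the other side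
    -- leaves the antisymmetric form evaluated at `𝓛(s) V` and `𝓛(s) W`, both still in `H^k`.
    have h2 : ∀ s, inner ℝ (c.group (-s) (source ρ₀ u (c.group s V))) W +
        inner ℝ (c.group (-s) (source ρ₀ u (c.group s W))) V = 0 := fun s => by
      obtain ⟨w, g, G, hwg, hh, hG⟩ := (hgroup hV s).exists_isAdvection hρ hρpos hu hk
      obtain ⟨w', g', G', hwg', hh', hG'⟩ := (hgroup hW s).exists_isAdvection hρ hρpos hu hk
      rw [c.inner_group_neg, c.inner_group_neg]
      exact inner_source_add hc hρpos hu hdiv hwg hh hG hwg' hh' hG' (hsource (hgroup hV s))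
        (hsource (hgroup hW s))
    simp only [h2, intervalIntegral.integral_zero, mul_zero]
  refine ⟨fun V hV => ⟨fun s => ?_, hlim hV, ?_⟩, fun V W hV hW => ?_⟩
  · rw [hgrp]
    exact hsource (hgroup hV s)
  · rw [integral_stateDot]
    -- On the diagonal the antisymmetry says that twice the pairing is zero.
    linarith [hanti hV hV]
  · rw [integral_add (integrable_stateDot _ _) (integrable_stateDot _ _), integral_stateDot,
      integral_stateDot]
    exact hanti hV hW
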